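/- Let $\mathbb B\subset\mathbb R^2=\mathbb C$ be the open unit disc and $S^1$ its boundary circle. For a continuous $\rho\colon\mathbb B\to(0,\infty)$ let $d_\rho(x,y)=\inf_\gamma\int_\gamma\rho\,|dz|$, the infimum being over rectifiable curves in $\mathbb B$ joining $x$ to $y$; let $\partial_\rho\mathbb B$ be the completion of $(\mathbb B,d_\rho)$ minus $\mathbb B$. Call $\rho$ a *density* if $\partial_\rho\mathbb B\ne\emptyset$, every sequence in $\mathbb B$ that converges in the $d_\rho$-completion converges in $\overline{\mathbb B}$, and every sequence in $\mathbb B$ that converges in $\overline{\mathbb B}$ has at most one accumulation point in $\partial_\rho\mathbb B$ (so that points of $\partial_\rho\mathbb B$ are identified with points of $S^1$). A density $\rho$ is *conformal* if there are finite constants $c_0,c_1\ge1$ with $c_0^{-1}\le\rho(y)/\rho(x)\le c_0$ whenever $x\in\mathbb B$, $|y-x|<(1-|x|)/2$, and $\int_{\{y\in\mathbb B:\,d_\rho(x,y)<r\}}\rho^2\,d\mathcal L^2\le c_1r^2$ for all $x\in\mathbb B$, $r>0$. Write $k^-(x)=\liminf_{r\uparrow1}\log\rho(rx)/\log(1-r)$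 for $x\in S^1$; $\dim_d,\operatorname{Dim}_d$ (resp. $\dim_\rho,\operatorname{Dim}_\rho$) are the Hausdorff and packing dimensions with respect to the Euclidean metric (resp. $d_\rho$). Call numbers $0<a<b<\frac12$, $-1<\lambda<\eta<0$, $\xi$, and integers $0=n_0=N_0<n_1<N_1<n_2<N_2<\cdots$ *admissible* if $a^{1+\lambda}=b^{1+\eta}=\xi$, $-\log2<\log\xi<-\frac12\log2$, and $N_i/n_i\to\infty$, $n_{i+1}/N_i\to\infty$. Given such data, let $C\subset S^1$ be the Cantor set obtained from an arc of length $1$ by replacing, in step $k+1$ ($k\ge0$), each of the $2^k$ arcs of length $\ell_k$ by the two arcs of length $\ell_{k+1}=q_k\ell_k$ at its ends, where $q_k=b$ if $n_i\le k<N_i$ for some $i$ and $q_k=a$ otherwise ($\ell_0=1$). Put $r_k=\ell_{n_k}$ for $k\ge0$ and $R_k=\ell_{N_{k-1}}$ for $k\ge1$ (so $r_0=R_1=1$), and define $\tilde\rho\colon(0,\infty)\to(0,\infty)$ by $$\tilde\rho(t)=\Bigl(\tfrac{R_1\cdots R_k}{r_0\cdots r_{k-1}}\Bigr)^{\eta-\lambda}t^\lambda\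 \ (r_k\le t\le R_k),\qquad \tilde\rho(t)=\Bigl(\tfrac{R_1\cdots R_k}{r_0\cdots r_k}\Bigr)^{\eta-\lambda}t^\eta\ \ (R_{k+1}\le t\le r_k)$$ for $k\ge1$, and $\tilde\rho(t)=t^\lambda$ for $t\ge1$. **Claim.** Admissible data exist, and for all admissible data $\rho(x)=\tilde\rho(\operatorname{dist}(x,C))$ is a conformal density on $\mathbb B$ with the following properties. Each point of $S^1$ corresponds to exactly one point of $\partial_\rho\mathbb B$, and $\partial_\rho\mathbb B=S^1$ under this identification; $k^-=\lambda$ on $C$ and $k^-=0$ on $S^1\setminus C$; $\dim_dC=-\log2/\log a$ and $\operatorname{Dim}_dC=-\log2/\log b$; $\dim_\rho C=-\log 2/((1+\lambda)\log a)$; and $$1<\operatorname{Dim}_\rho(C)=\operatorname{Dim}_\rho(S^1)=\frac{-\log2}{(1+\lambda)\log a}<\frac{-\log2}{(1+\lambda)\log b}=\frac{\operatorname{Dim}_d(C)}{1+\lambda}=\sup_{\beta>-1}\frac{\operatorname{Dim}_d\{x\in\partial_\rho\mathbb B:k^-(x)\le\beta\}}{1+\beta}.$$ Consequently the inequality $\operatorname{Dim}_\rho(\partial_\rho\mathbb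 B)\ge\sup_{\beta>-1}\operatorname{Dim}_d\{x\in\partial_\rho\mathbb B:k^-(x)\le\beta\}/(1+\beta)$ does not hold for all conformal densities $\rho$ on $\mathbb B$ (i.e. in the lower bound $\operatorname{Dim}_\rho(\partial_\rho\mathbb B)\ge\sup_{\beta>-1}\dim_d\{x\in\partial_\rho\mathbb B:k^-(x)\le\beta\}/(1+\beta)$, $\dim_d$ cannot be replaced by $\operatorname{Dim}_d$). -/

import Mathlib

open Set Filter Topology MeasureTheory
open scoped ENNReal NNReal

/-! ### Packing measures and packing dimension -/

section Packing

variable {X : Type*} [PseudoMetricSpace X]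

/-- `t` is a finite packing of `A` at scale `ε`: its elements are pairs (centre, radius), the centres
lie in `A`, the radii in `(0, ε]`, and the open balls are pairwise disjoint. -/
def IsPacking (A : Set X) (ε : ℝ) (t : Finset (X × ℝ)) : Prop :=
  (∀ p ∈ t, p.1 ∈ A ∧ 0 < p.2 ∧ p.2 ≤ ε) ∧
    (t : Set (X × ℝ)).PairwiseDisjoint fun p => Metric.ball p.1 p.2

/-- The supremum of `∑ rᵢ ^ s` over all packings of `A` at scale `ε`. (Finite packings give the same
supremum as countable ones, the sums having nonnegative terms.) -/
noncomputable def packingPreAt (s : ℝ≥0) (ε : ℝ) (A : Set X) : ℝ≥0∞ :=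
  ⨆ (t : Finset (X × ℝ)) (_ : IsPacking A ε t), ∑ p ∈ t, ENNReal.ofReal p.2 ^ (s : ℝ)

/-- The packing premeasure, the (decreasing) limit of `packingPreAt s ε A` as `ε ↓ 0`. -/
noncomputable def packingPre (s : ℝ≥0) (A : Set X) : ℝ≥0∞ :=
  ⨅ (ε : ℝ) (_ : 0 < ε), packingPreAt s ε A

/-- The `s`-dimensional packing measure. -/
noncomputable def packingMeasure (s : ℝ≥0) (A : Set X) : ℝ≥0∞ :=
  ⨅ (F : ℕ → Set X) (_ : A ⊆ ⋃ i, F i), ∑' i, packingPre s (F i)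

/-- The packing dimension `sup {s ≥ 0 : 𝒫ˢ(A) = ∞}` (with `sup ∅ = 0`). -/
noncomputable def packingDim (A : Set X) : ℝ≥0∞ :=
  ⨆ (s : ℝ≥0) (_ : packingMeasure s A = ∞), (s : ℝ≥0∞)

end Packing

/-! ### The metric `d_ρ` on the unit disc -/

/-- A continuous function `𝔹 → (0, ∞)` on the open unit disc `𝔹` of the plane `ℂ`
(values outside the disc play no role). -/
structure DiscWeight where
  toFun : ℂ → ℝ
  continuousOn : ContinuousOn toFun (Metric.ball 0 1)
  pos : ∀ z ∈ Metric.ball (0 : ℂ) 1, 0 < toFun z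

instance : CoeFun DiscWeight fun _ => ℂ → ℝ := ⟨DiscWeight.toFun⟩

/-- `γ` is a rectifiable curve of length `L` in the open unit disc, parametrized by arc length on
`[0, L]`, which joins `x` to `y`. -/
structure IsDiscCurve (x y : ℂ) (γ : ℝ → ℂ) (L : ℝ) : Prop where
  len_nonneg : 0 ≤ L
  unitSpeed : HasUnitSpeedOn γ (Icc 0 L)
  mem : ∀ t ∈ Icc 0 L, γ t ∈ Metric.ball (0 : ℂ) 1
  source : γ 0 = x
  target : γ L = y

/-- The `ρ`-length `∫_γ ρ |dz|` of a curve parametrized by arc length on `[0, L]`. -/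
noncomputable def rhoLength (ρ : DiscWeight) (γ : ℝ → ℂ) (L : ℝ) : ℝ≥0∞ :=
  ∫⁻ t in Icc 0 L, ENNReal.ofReal (ρ (γ t))

/-- The `ρ`-distance of two points of the disc. -/
noncomputable def rhoEDist (ρ : DiscWeight) (x y : ℂ) : ℝ≥0∞ :=
  ⨅ (γ : ℝ → ℂ) (L : ℝ) (_ : IsDiscCurve x y γ L), rhoLength ρ γ L

theorem IsDiscCurve.const {x : ℂ} (hx : x ∈ Metric.ball (0 : ℂ) 1) :
    IsDiscCurve x x (fun _ => x) 0 where
  len_nonneg := le_rfl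
  unitSpeed := hasConstantSpeedOnWith_of_subsingleton _ (by simp) _
  mem := fun _ _ => hx
  source := rfl
  target := rfl

theorem HasUnitSpeedOn.comp_isometric {γ : ℝ → ℂ} {L c : ℝ}
    (h : HasUnitSpeedOn γ (Icc 0 L)) :
    HasUnitSpeedOn (fun t => γ (t - c)) (Icc c (c + L)) := by
  intro u hu v hv
  have hm : MonotoneOn (fun t : ℝ => t - c) (Icc c (c + L) ∩ Icc u v) :=
    fun a _ b _ hab => by simpa using hab
  have := eVariationOn.comp_eq_of_monotoneOn γ (fun t : ℝ => t - c) hm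
  change eVariationOn (γ ∘ fun t => t - c) _ = _
  rw [this]
  have him : (fun t : ℝ => t - c) '' (Icc c (c + L) ∩ Icc u v) =
      Icc 0 L ∩ Icc (u - c) (v - c) := by
    ext w
    simp only [mem_image, mem_inter_iff, mem_Icc]
    constructor
    · rintro ⟨z, hz, rfl⟩
      exact ⟨⟨by linarith, by linarith⟩, by linarith, by linarith⟩
    · rintro ⟨⟨h1, h2⟩, h3, h4⟩
      exact ⟨w + c, ⟨⟨by linarith, by linarith⟩, by linarith, by linarith⟩, by ring⟩
  rw [him, h ⟨by linarith [hu.1], by linarith [hu.2]⟩ ⟨by linarith [hv.1], by linarith [hv.2]⟩]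
  congr 2
  ring

theorem IsDiscCurve.reverse {x y : ℂ} {γ : ℝ → ℂ} {L : ℝ} (h : IsDiscCurve x y γ L) :
    IsDiscCurve y x (fun t => γ (L - t)) L where
  len_nonneg := h.len_nonneg
  unitSpeed := by
    intro u hu v hv
    have hm : AntitoneOn (fun t : ℝ => L - t) (Icc 0 L ∩ Icc u v) :=
      fun a _ b _ hab => sub_le_sub_left hab L
    have := eVariationOn.comp_eq_of_antitoneOn γ (fun t : ℝ => L - t) hm
    change eVariationOn (γ ∘ fun t => L - t) _ = _
    rw [this]
    have him : (fun t : ℝ => L - t) '' (Icc 0 L ∩ Icc u v) = Icc 0 L ∩ Icc (L - v) (L - u) := by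
      ext w
      simp only [mem_image, mem_inter_iff, mem_Icc]
      constructor
      · rintro ⟨z, hz, rfl⟩
        exact ⟨⟨by linarith, by linarith⟩, by linarith, by linarith⟩
      · rintro ⟨⟨h1, h2⟩, h3, h4⟩
        exact ⟨L - w, ⟨⟨by linarith, by linarith⟩, by linarith, by linarith⟩, by ring⟩
    rw [him, h.unitSpeed ⟨by linarith [hv.2], by linarith [hv.1]⟩
      ⟨by linarith [hu.2], by linarith [hu.1]⟩]
    congr 2
    ring
  mem := fun t ht => h.mem _ ⟨by linarith [ht.2], by linarith [ht.1]⟩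
  source := by simpa using h.target
  target := by simpa using h.source

theorem rhoLength_reverse (ρ : DiscWeight) (γ : ℝ → ℂ) (L : ℝ) :
    rhoLength ρ (fun t => γ (L - t)) L = rhoLength ρ γ L := by
  unfold rhoLength
  rw [← lintegral_indicator measurableSet_Icc, ← lintegral_indicator measurableSet_Icc,
    ← lintegral_sub_left_eq_self _ L]
  congr 1
  ext t
  simp only [indicator, mem_Icc, sub_nonneg, sub_sub_cancel]
  congr 1
  simp [and_comm]

theorem rhoLength_shift (ρ : DiscWeight) (γ : ℝ → ℂ) (L c : ℝ) :
    ∫⁻ t in Icc c (c + L), ENNReal.ofReal (ρ (γ (t - c))) = rhoLength ρ γ L := by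
  unfold rhoLength
  rw [← lintegral_indicator measurableSet_Icc, ← lintegral_indicator measurableSet_Icc,
    ← lintegral_sub_right_eq_self ((Icc 0 L).indicator _) c]
  congr 1
  ext t
  simp only [indicator, mem_Icc, sub_nonneg, sub_le_iff_le_add']

theorem exists_concat (ρ : DiscWeight) {x y z : ℂ} {γ₁ γ₂ : ℝ → ℂ} {L₁ L₂ : ℝ}
    (h₁ : IsDiscCurve x y γ₁ L₁) (h₂ : IsDiscCurve y z γ₂ L₂) :
    ∃ γ L, IsDiscCurve x z γ L ∧ rhoLength ρ γ L ≤ rhoLength ρ γ₁ L₁ + rhoLength ρ γ₂ L₂ := by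
  classical
  have p1 := h₁.len_nonneg
  have p2 := h₂.len_nonneg
  let γ : ℝ → ℂ := fun t => if t ≤ L₁ then γ₁ t else γ₂ (t - L₁)
  have e1 : EqOn γ γ₁ (Icc 0 L₁) := fun t ht => if_pos ht.2
  have e2 : EqOn γ (fun t => γ₂ (t - L₁)) (Icc L₁ (L₁ + L₂)) := by
    intro t ht
    rcases ht.1.eq_or_lt with h | h
    · subst h
      simp [γ, h₁.target, h₂.source]
    · exact if_neg (not_le.2 h)
  have hun : Icc 0 (L₁ + L₂) = Icc 0 L₁ ∪ Icc L₁ (L₁ + L₂) :=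
    (Icc_union_Icc_eq_Icc p1 (by linarith)).symm
  refine ⟨γ, L₁ + L₂, ⟨by linarith, ?_, ?_, ?_, ?_⟩, ?_⟩
  · refine HasUnitSpeedOn.Icc_Icc (y := L₁) ?_ ?_
    · intro u hu v hv
      rw [eVariationOn.congr (e1.mono inter_subset_left)]
      exact h₁.unitSpeed hu hv
    · intro u hu v hv
      rw [eVariationOn.congr (e2.mono inter_subset_left)]
      exact h₂.unitSpeed.comp_isometric hu hv
  · intro t ht
    rw [hun] at ht
    rcases ht with ht | ht
    · rw [e1 ht]; exact h₁.mem t ht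
    · rw [e2 ht]; exact h₂.mem _ ⟨by linarith [ht.1], by linarith [ht.2]⟩
  · rw [e1 ⟨le_rfl, p1⟩]; exact h₁.source
  · rw [e2 ⟨by linarith, le_rfl⟩]; simpa using h₂.target
  · calc rhoLength ρ γ (L₁ + L₂)
        ≤ (∫⁻ t in Icc 0 L₁, ENNReal.ofReal (ρ (γ t)))
          + ∫⁻ t in Icc L₁ (L₁ + L₂), ENNReal.ofReal (ρ (γ t)) := by
          unfold rhoLength; rw [hun]; exact lintegral_union_le _ _ _
      _ = rhoLength ρ γ₁ L₁ + rhoLength ρ γ₂ L₂ := by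
          rw [← rhoLength_shift ρ γ₂ L₂ L₁]
          congr 1
          · exact setLIntegral_congr_fun measurableSet_Icc fun t ht => by simp only [e1 ht]
          · exact setLIntegral_congr_fun measurableSet_Icc fun t ht => by simp only [e2 ht]

theorem exists_finite_curve (ρ : DiscWeight) {x y : ℂ} (hx : x ∈ Metric.ball (0 : ℂ) 1)
    (hy : y ∈ Metric.ball (0 : ℂ) 1) :
    ∃ γ L, IsDiscCurve x y γ L ∧ rhoLength ρ γ L ≠ ∞ := by
  rcases eq_or_ne x y with rfl | hne
  · refine ⟨_, _, IsDiscCurve.const hx, ?_⟩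
    simp [rhoLength]
  have hL : 0 < ‖y - x‖ := norm_pos_iff.2 (sub_ne_zero.2 hne.symm)
  let u : ℂ := (‖y - x‖⁻¹ : ℝ) • (y - x)
  have hu : ‖u‖ = 1 := by
    simp only [u, norm_smul, norm_inv, norm_norm]
    exact inv_mul_cancel₀ hL.ne'
  let γ : ℝ → ℂ := fun t => x + t • u
  have hiso : Isometry γ := by
    refine Isometry.of_dist_eq fun s t => ?_
    simp [γ, dist_eq_norm, ← sub_smul, norm_smul, hu, -Complex.real_smul]
  have hmem : ∀ t ∈ Icc 0 ‖y - x‖, γ t ∈ Metric.ball (0 : ℂ) 1 := by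
    intro t ht
    refine (convex_ball (0 : ℂ) 1).segment_subset hx hy ?_
    rw [segment_eq_image']
    refine ⟨t * ‖y - x‖⁻¹, ⟨mul_nonneg ht.1 (inv_nonneg.2 hL.le), ?_⟩, ?_⟩
    · rw [← div_eq_mul_inv]; exact (div_le_one hL).2 ht.2
    · simp only [γ, u, smul_smul]
  refine ⟨γ, ‖y - x‖, ⟨hL.le, ?_, hmem, ?_, ?_⟩, ?_⟩
  · rw [HasUnitSpeedOn, hasConstantSpeedOnWith_iff_ordered]
    intro s hs t ht hst
    have hIcc : Icc 0 ‖y - x‖ ∩ Icc s t = Icc s t :=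
      inter_eq_right.2 (Icc_subset_Icc hs.1 ht.2)
    rw [hIcc]
    apply le_antisymm
    · have h1 := (hiso.lipschitz.lipschitzOnWith (s := univ)).comp_eVariationOn_le
        (g := id) (s := Icc s t) (mapsTo_univ _ _)
      have h2 := (monotoneOn_id (s := Icc s t)).eVariationOn_eq (a := s) (b := t)
        ⟨le_rfl, hst⟩ ⟨hst, le_rfl⟩
      rw [inter_self] at h2
      rw [h2] at h1
      simpa using h1
    · have h1 := eVariationOn.edist_le γ (s := Icc s t) (x := t) (y := s) ⟨hst, le_rfl⟩ ⟨le_rfl, hst⟩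
      rw [hiso.edist_eq, edist_dist, Real.dist_eq, abs_of_nonneg (by linarith)] at h1
      simpa using h1
  · simp [γ]
  · simp only [γ, u, smul_smul, mul_inv_cancel₀ hL.ne']; simp
  · have hc : ContinuousOn (fun t => ρ (γ t)) (Icc 0 ‖y - x‖) :=
      ρ.continuousOn.comp hiso.continuous.continuousOn hmem
    have hi : IntegrableOn (fun t => ρ (γ t)) (Icc 0 ‖y - x‖) := hc.integrableOn_Icc
    exact hi.lintegral_lt_top.ne

/-- The open unit disc, carrying the metric `d_ρ`. -/
structure RhoDisc (ρ : DiscWeight) where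
  pt : ℂ
  mem : pt ∈ Metric.ball (0 : ℂ) 1

noncomputable instance (ρ : DiscWeight) : PseudoEMetricSpace (RhoDisc ρ) where
  edist x y := rhoEDist ρ x.pt y.pt
  edist_self x := by
    refine le_antisymm (iInf_le_of_le _ (iInf_le_of_le _
      (iInf_le_of_le (IsDiscCurve.const x.mem) ?_))) bot_le
    simp [rhoLength]
  edist_comm := by
    have key : ∀ x y : RhoDisc ρ, rhoEDist ρ x.pt y.pt ≤ rhoEDist ρ y.pt x.pt := by
      intro x y
      refine le_iInf fun γ => le_iInf fun L => le_iInf fun h => ?_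
      refine iInf_le_of_le _ (iInf_le_of_le _ (iInf_le_of_le h.reverse ?_))
      rw [rhoLength_reverse]
    exact fun x y => le_antisymm (key x y) (key y x)
  edist_triangle x y z := by
    simp only [rhoEDist, ENNReal.iInf_add, ENNReal.add_iInf]
    refine le_iInf fun γ₂ => le_iInf fun L₂ => le_iInf fun h₂ => ?_
    refine le_iInf fun γ₁ => le_iInf fun L₁ => le_iInf fun h₁ => ?_
    obtain ⟨γ, L, h, hle⟩ := exists_concat ρ h₁ h₂
    exact iInf_le_of_le _ (iInf_le_of_le _ (iInf_le_of_le h hle))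

noncomputable instance (ρ : DiscWeight) : PseudoMetricSpace (RhoDisc ρ) :=
  PseudoEMetricSpace.toPseudoMetricSpace fun x y => by
    obtain ⟨γ, L, h, hfin⟩ := exists_finite_curve ρ x.mem y.mem
    exact ne_top_of_le_ne_top hfin (iInf_le_of_le _ (iInf_le_of_le _ (iInf_le _ h)))

/-! ### The `ρ`-boundary, densities and conformal densities -/

/-- The metric completion of the disc with respect to `d_ρ`. -/
abbrev RhoClosure (ρ : DiscWeight) : Type := UniformSpace.Completion (RhoDisc ρ)

/-- The `ρ`-boundary: the completion minus the disc. -/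
def rhoBoundary (ρ : DiscWeight) : Set (RhoClosure ρ) :=
  (range ((↑) : RhoDisc ρ → RhoClosure ρ))ᶜ

/-- `p` and `q` correspond to each other under the natural identification of points of the completion
with points of the closed Euclidean disc: a single sequence in the disc converges to both. (The
internal metric of the disc is the Euclidean metric, and its completion is the closed disc.) -/
def Corresponds (ρ : DiscWeight) (p : RhoClosure ρ) (q : ℂ) : Prop :=
  ∃ x : ℕ → RhoDisc ρ, Tendsto (fun i => (x i : RhoClosure ρ)) atTop (𝓝 p) ∧
    Tendsto (fun i => (x i).pt) atTop (𝓝 q)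

/-- A set `A` of points of the unit circle, viewed as a subset of the `ρ`-boundary. -/
def rhoTrace (ρ : DiscWeight) (A : Set ℂ) : Set (RhoClosure ρ) :=
  {p | p ∈ rhoBoundary ρ ∧ ∃ q ∈ A, Corresponds ρ p q}

/-- A density on the disc: the identity of the disc extends to a continuous injection of the
`d_ρ`-completion into the Euclidean one, in the form of two conditions on sequences, and the
`ρ`-boundary is not empty. -/
structure IsDensity (ρ : DiscWeight) : Prop where
  tendsto_euclidean : ∀ x : ℕ → RhoDisc ρ,
    (∃ p : RhoClosure ρ, Tendsto (fun i => (x i : RhoClosure ρ)) atTop (𝓝 p)) →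
      ∃ q : ℂ, Tendsto (fun i => (x i).pt) atTop (𝓝 q)
  unique_accumulation : ∀ x : ℕ → RhoDisc ρ,
    (∃ q : ℂ, Tendsto (fun i => (x i).pt) atTop (𝓝 q)) →
      ∀ p ∈ rhoBoundary ρ, ∀ p' ∈ rhoBoundary ρ,
        MapClusterPt p atTop (fun i => (x i : RhoClosure ρ)) →
        MapClusterPt p' atTop (fun i => (x i : RhoClosure ρ)) → p = p'
  boundary_nonempty : (rhoBoundary ρ).Nonempty

/-- A conformal density on the disc: a density satisfying the Harnack inequality and the volume
growth condition `∫_{B_ρ(x,r)} ρ² ≤ c₁ r²`. -/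
structure IsConformalDensity (ρ : DiscWeight) : Prop where
  isDensity : IsDensity ρ
  harnack : ∃ c₀ : ℝ, 1 ≤ c₀ ∧ ∀ x ∈ Metric.ball (0 : ℂ) 1,
    ∀ y ∈ Metric.ball x ((1 - ‖x‖) / 2), c₀⁻¹ ≤ ρ y / ρ x ∧ ρ y / ρ x ≤ c₀
  volume_growth : ∃ c₁ : ℝ, 1 ≤ c₁ ∧ ∀ x ∈ Metric.ball (0 : ℂ) 1, ∀ r : ℝ, 0 < r →
    ∫⁻ y in {y | y ∈ Metric.ball (0 : ℂ) 1 ∧ rhoEDist ρ x y < ENNReal.ofReal r},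
      ENNReal.ofReal (ρ y ^ 2) ≤ ENNReal.ofReal (c₁ * r ^ 2)

/-- `k⁻(x) = liminf_{r ↑ 1} log ρ(r x) / log (1 - r)`, an extended real number. -/
noncomputable def kMinus (ρ : DiscWeight) (x : ℂ) : EReal :=
  liminf (fun r : ℝ => ((Real.log (ρ ((r : ℂ) * x)) / Real.log (1 - r) : ℝ) : EReal)) (𝓝[<] 1)

/-- The set `{x ∈ ∂_ρ 𝔹 : k⁻(x) ≤ β}`, as a subset of the unit circle. -/
def kMinusSublevel (ρ : DiscWeight) (β : ℝ) : Set ℂ :=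
  {x | x ∈ Metric.sphere (0 : ℂ) 1 ∧ (∃ p ∈ rhoBoundary ρ, Corresponds ρ p x) ∧
    kMinus ρ x ≤ (β : EReal)}

/-- `sup_{β > -1} Dim_d {x ∈ ∂_ρ 𝔹 : k⁻(x) ≤ β} / (1 + β)`. (The packing dimension is that of the
Euclidean metric. Two balls centred in the closed disc which meet in the plane also meet in the
closed disc, by convexity, so packings do not depend on which of the two is the ambient space.) -/
noncomputable def packingSpectrumSup (ρ : DiscWeight) : ℝ≥0∞ :=
  ⨆ (β : ℝ) (_ : -1 < β), packingDim (kMinusSublevel ρ β) / ENNReal.ofReal (1 + β)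

/-! ### The Cantor set with alternating contraction ratios -/

/-- The parameters: numbers `a`, `b`, `lam`, `eta`, `xi`, and naturals
`0 = n 0 = N 0 < n 1 < N 1 < n 2 < N 2 < ⋯` with `N i / n i → ∞` and `n (i + 1) / N i → ∞`. -/
structure IsAdmissible (a b lam eta xi : ℝ) (n N : ℕ → ℕ) : Prop where
  a_pos : 0 < a
  a_lt_b : a < b
  b_lt : b < 1 / 2
  lam_gt : -1 < lam
  lam_lt_eta : lam < eta
  eta_neg : eta < 0
  a_rpow : a ^ (1 + lam) = xi
  b_rpow : b ^ (1 + eta) = xi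
  xi_gt : -Real.log 2 < Real.log xi
  xi_lt : Real.log xi < -(1 / 2) * Real.log 2
  n_zero : n 0 = 0
  N_zero : N 0 = 0
  N_lt_n : ∀ i, N i < n (i + 1)
  n_lt_N : ∀ i, n (i + 1) < N (i + 1)
  N_div_n : Tendsto (fun i => (N i : ℝ) / n i) atTop atTop
  n_div_N : Tendsto (fun i => (n (i + 1) : ℝ) / N i) atTop atTop

open Classical in
/-- The contraction ratio used in construction step `k + 1`: it is `b` for `n i ≤ k < N i` and `a`
for `N i ≤ k < n (i + 1)`. -/
noncomputable def stepRatio (a b : ℝ) (n N : ℕ → ℕ) (k : ℕ) : ℝ :=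
  if ∃ i, n i ≤ k ∧ k < N i then b else a

/-- The length `ℓ_k` of the construction intervals of level `k`. -/
noncomputable def cantorLen (a b : ℝ) (n N : ℕ → ℕ) (k : ℕ) : ℝ :=
  ∏ j ∈ Finset.range k, stepRatio a b n N j

/-- The left endpoints of the construction intervals of level `k`: from each interval of length `ℓ_k`
the middle is removed, which leaves two intervals of length `ℓ_{k+1}` at its two ends. -/
noncomputable def cantorLeft (a b : ℝ) (n N : ℕ → ℕ) : ℕ → Set ℝ
  | 0 => {0}
  | k + 1 => cantorLeft a b n N k ∪
      (fun x => x + (cantorLen a b n N k - cantorLen a b n N (k + 1))) '' cantorLeft a b n N k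

/-- The Cantor set in `[0, 1]`. -/
noncomputable def cantorLine (a b : ℝ) (n N : ℕ → ℕ) : Set ℝ :=
  ⋂ k, ⋃ x ∈ cantorLeft a b n N k, Icc x (x + cantorLen a b n N k)

/-- The Cantor set on the unit circle, constructed in an arc of length `1`. -/
noncomputable def cantorCircle (a b : ℝ) (n N : ℕ → ℕ) : Set ℂ :=
  (fun θ : ℝ => Complex.exp (θ * Complex.I)) '' cantorLine a b n N

/-- `r_k`, the length of the construction intervals of level `n k` (and `r_0 = 1`). -/
noncomputable def smallRad (a b : ℝ) (n N : ℕ → ℕ) (k : ℕ) : ℝ := cantorLen a b n N (n k)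

/-- `R_k`, for `k ≥ 1`: the length of the construction intervals of level `N (k - 1)`
(and `R_1 = 1`). -/
noncomputable def bigRad (a b : ℝ) (n N : ℕ → ℕ) (k : ℕ) : ℝ := cantorLen a b n N (N (k - 1))

/-- `φ` is the radial profile: for every `k ≥ 1` it is
`(R_1 ⋯ R_k / (r_0 ⋯ r_{k-1})) ^ (eta - lam) * t ^ lam` on `[r_k, R_k]` and
`(R_1 ⋯ R_k / (r_0 ⋯ r_k)) ^ (eta - lam) * t ^ eta` on `[R_{k+1}, r_k]`. As `R_1 = 1`, this defines it
on `(0, 1]`; for `t ≥ 1` the formula of the first interval is continued. -/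
structure IsProfile (a b lam eta : ℝ) (n N : ℕ → ℕ) (φ : ℝ → ℝ) : Prop where
  on_lam : ∀ k, 1 ≤ k → ∀ t ∈ Icc (smallRad a b n N k) (bigRad a b n N k),
    φ t = ((∏ j ∈ Finset.Icc 1 k, bigRad a b n N j) /
      ∏ j ∈ Finset.range k, smallRad a b n N j) ^ (eta - lam) * t ^ lam
  on_eta : ∀ k, 1 ≤ k → ∀ t ∈ Icc (bigRad a b n N (k + 1)) (smallRad a b n N k),
    φ t = ((∏ j ∈ Finset.Icc 1 k, bigRad a b n N j) /
      ∏ j ∈ Finset.range (k + 1), smallRad a b n N j) ^ (eta - lam) * t ^ eta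
  on_ge_one : ∀ t, 1 ≤ t → φ t = t ^ lam

/-! ### Packing dimension: general bounds -/

section PackingBounds

variable {X : Type*} [PseudoMetricSpace X]

/-! The exponents of the weight are tuned to the contraction ratios. A step with ratio a passes
through scales where the profile φ behaves like t^λ, a step with ratio b through scales where it
behaves like t^η, and a^(1+λ) = b^(1+η) = ξ. Hence ℓ_k φ(ℓ_k) = ξ^k exactly, for every k
(`IsAdmissible.profile_cantorLen`).

The metric is explicit up to constants: with d = |x − y| and δ = dist(x, C), d_ρ(x, y) is comparable
to d φ(d + δ) (`le_rhoEDist`, `rhoEDist_le`). Only monotonicity of φ and growth with an exponent λ >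
−1 enter. It follows that the completion is the closed disc. On C, where δ = 0, the pieces of level
k have ρ-size and ρ-separation comparable to ξ^k: for d_ρ, the set C looks like a Cantor set with
the single ratio ξ (`IsAdmissible.isCoding_rho`). Its Hausdorff and packing dimensions therefore
agree and equal −log 2 / log ξ.

In the Euclidean metric the two ratios remain visible. As N_i/n_i and n_{i+1}/N_i tend to infinity,
log ℓ_k / k comes close to log a along k = n_i and to log b along k = N_i. Covers may be chosen at
the good scales, so Hausdorff dimension sees a; packings exploit the opposite ones, so packing
dimension sees b. Along a radius ending in C the distance to C is 1 − r, and the scales ℓ_k with k =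
n_i give k⁻ = λ. The quotient Dim_d C / (1 + λ) thus combines b with λ, which never occur together
at one scale, and exceeds Dim_ρ C.

The two bounds on ξ have separate roles. From ξ > 1/2 comes Dim_ρ C > 1, so the rest of the circle,
a countable union of sets on which d_ρ is dominated by arc length, adds nothing. From 2 ξ² < 1 comes
convergence of ∑ 2^k (ℓ_k φ(ℓ_k))², which is the volume growth condition near C
(`lintegral_ball_code_le`).

All dimensions are computed with the uniform measure on binary sequences, transported by a coding
map (`IsCoding.packingDim_range`, `IsCoding.dimH_range`). -/

theorem packingPreAt_mono_scale (s : ℝ≥0) {ε ε' : ℝ} (h : ε ≤ ε') (A : Set X) :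
    packingPreAt s ε A ≤ packingPreAt s ε' A := by
  refine iSup₂_le fun t ht => le_iSup₂_of_le t ⟨fun p hp => ?_, ht.2⟩ le_rfl
  exact ⟨(ht.1 p hp).1, (ht.1 p hp).2.1, (ht.1 p hp).2.2.trans h⟩

theorem packingPreAt_mono (s : ℝ≥0) (ε : ℝ) {A B : Set X} (h : A ⊆ B) :
    packingPreAt s ε A ≤ packingPreAt s ε B := by
  refine iSup₂_le fun t ht => le_iSup₂_of_le t ⟨fun p hp => ?_, ht.2⟩ le_rfl
  exact ⟨h (ht.1 p hp).1, (ht.1 p hp).2⟩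

theorem packingMeasure_mono (s : ℝ≥0) {A B : Set X} (h : A ⊆ B) :
    packingMeasure s A ≤ packingMeasure s B :=
  le_iInf₂ fun F hF => iInf₂_le F (h.trans hF)

theorem packingDim_mono {A B : Set X} (h : A ⊆ B) : packingDim A ≤ packingDim B :=
  iSup₂_le fun s hs => le_iSup₂_of_le s (top_unique (hs ▸ packingMeasure_mono s h)) le_rfl

theorem packingMeasure_eq_zero_of_cover {s : ℝ≥0} {A : Set X} {F : ℕ → Set X}
    (hA : A ⊆ ⋃ i, F i) (hF : ∀ i, packingPre s (F i) = 0) : packingMeasure s A = 0 := by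
  refine le_antisymm ((iInf₂_le F hA).trans ?_) bot_le
  simp [hF]

theorem packingDim_le_of_measure {A : Set X} {d : ℝ≥0}
    (h : ∀ s : ℝ≥0, d < s → packingMeasure s A ≠ ∞) : packingDim A ≤ d := by
  refine iSup₂_le fun s hs => ?_
  by_contra hlt
  exact h s (by simpa using hlt) hs

theorem le_packingDim_of_measure {A : Set X} {d : ℝ≥0}
    (h : ∀ s : ℝ≥0, s < d → packingMeasure s A = ∞) : (d : ℝ≥0∞) ≤ packingDim A := by
  refine ENNReal.le_of_forall_nnreal_lt fun s hs => ?_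
  exact le_iSup₂_of_le s (h s (by simpa using hs)) le_rfl

theorem packingPreAt_empty (s : ℝ≥0) (ε : ℝ) : packingPreAt s ε (∅ : Set X) = 0 := by
  refine le_antisymm (iSup₂_le fun t ht => ?_) bot_le
  have : t = ∅ := Finset.eq_empty_of_forall_notMem fun p hp => (ht.1 p hp).1
  simp [this]

theorem packingDim_empty : packingDim (∅ : Set X) = 0 := by
  refine le_antisymm ?_ bot_le
  refine packingDim_le_of_measure (d := 0) fun s _ => ?_
  rw [packingMeasure_eq_zero_of_cover (F := fun _ => ∅) (by simp)]
  · simp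
  · intro _
    exact le_antisymm ((iInf₂_le 1 one_pos).trans (packingPreAt_empty s 1).le) bot_le

/-- Balls which carry enough mass of a finite measure bound the packing premeasure. -/
theorem packingPreAt_le_of_measure {Y : Type*} [MeasurableSpace Y] (ν : Measure Y) (f : Y → X)
    {A : Set X} {s : ℝ≥0} {ε : ℝ} {M : ℝ≥0∞}
    (hm : ∀ p r, MeasurableSet (f ⁻¹' Metric.ball p r))
    (h : ∀ p ∈ A, ∀ r, 0 < r → r ≤ ε →
      ENNReal.ofReal r ^ (s : ℝ) ≤ M * ν (f ⁻¹' Metric.ball p r)) :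
    packingPreAt s ε A ≤ M * ν univ := by
  refine iSup₂_le fun t ht => ?_
  calc ∑ p ∈ t, ENNReal.ofReal p.2 ^ (s : ℝ)
      ≤ ∑ p ∈ t, M * ν (f ⁻¹' Metric.ball p.1 p.2) :=
        Finset.sum_le_sum fun p hp =>
          h p.1 (ht.1 p hp).1 p.2 (ht.1 p hp).2.1 (ht.1 p hp).2.2
    _ = M * ν (⋃ p ∈ t, f ⁻¹' Metric.ball p.1 p.2) := by
        rw [← Finset.mul_sum, measure_biUnion_finset _ fun p _ => hm p.1 p.2]
        exact fun p hp q hq hpq => (ht.2 hp hq hpq).preimage f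
    _ ≤ M * ν univ := by gcongr; exact subset_univ _

/-- At scale δ each term gains a factor δ^(s−t) over the sum with exponent t, and this factor tends
to 0. -/
theorem packingPre_eq_zero {t s : ℝ≥0} (hts : t < s) {ε : ℝ} (hε : 0 < ε) {A : Set X}
    (h : packingPreAt t ε A ≠ ∞) : packingPre s A = 0 := by
  have key : ∀ δ : ℝ, 0 < δ → δ ≤ ε →
      packingPre s A ≤ ENNReal.ofReal δ ^ ((s : ℝ) - t) * packingPreAt t ε A := by
    intro δ hδ hδε
    refine (iInf₂_le δ hδ).trans (iSup₂_le fun T hT => ?_)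
    calc ∑ p ∈ T, ENNReal.ofReal p.2 ^ (s : ℝ)
        ≤ ∑ p ∈ T, ENNReal.ofReal δ ^ ((s : ℝ) - t) * ENNReal.ofReal p.2 ^ (t : ℝ) := by
          refine Finset.sum_le_sum fun p hp => ?_
          have h0 : ENNReal.ofReal p.2 ≠ 0 := by simpa using (hT.1 p hp).2.1
          rw [show (s : ℝ) = (s - t) + t by ring, ENNReal.rpow_add _ _ h0 ENNReal.ofReal_ne_top,
            show (s : ℝ) - t + t - t = s - t by ring]
          gcongr
          · exact sub_nonneg.2 (by exact_mod_cast hts.le)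
          · exact (hT.1 p hp).2.2
      _ ≤ _ := by
          rw [← Finset.mul_sum]
          gcongr
          refine le_trans ?_ (packingPreAt_mono_scale t hδε A)
          exact le_iSup₂_of_le T hT le_rfl
  have hpos : 0 < (s : ℝ) - t := sub_pos.2 (by exact_mod_cast hts)
  have hlim : Tendsto (fun δ : ℝ => ENNReal.ofReal δ ^ ((s : ℝ) - t) * packingPreAt t ε A)
      (𝓝[>] 0) (𝓝 0) := by
    have h1 : Tendsto (fun δ : ℝ => ENNReal.ofReal δ ^ ((s : ℝ) - t)) (𝓝[>] 0) (𝓝 0) := by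
      have : Tendsto (fun δ : ℝ => ENNReal.ofReal δ ^ ((s : ℝ) - t)) (𝓝 0)
          (𝓝 (ENNReal.ofReal 0 ^ ((s : ℝ) - t))) :=
        ((ENNReal.continuous_rpow_const.comp ENNReal.continuous_ofReal).tendsto _)
      rw [ENNReal.ofReal_zero, ENNReal.zero_rpow_of_pos hpos] at this
      exact this.mono_left nhdsWithin_le_nhds
    simpa using ENNReal.Tendsto.mul_const h1 (Or.inr h)
  refine le_antisymm (ge_of_tendsto hlim ?_) bot_le
  filter_upwards [Ioc_mem_nhdsGT hε] with δ hδ using key δ hδ.1 hδ.2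

/-- A maximal `2 ε`-separated set gives a lower bound for the packing premeasure. -/
theorem measure_le_packingPreAt {Y : Type*} [MeasurableSpace Y] (ν : Measure Y) (f : Y → X)
    {A : Set X} {s : ℝ≥0} {ε : ℝ} (hε : 0 < ε) {M : ℝ≥0∞} (hM : M ≠ 0)
    (h : ∀ p ∈ A, ν (f ⁻¹' Metric.ball p (2 * ε)) ≤ M * ENNReal.ofReal ε ^ (s : ℝ)) :
    ν (f ⁻¹' A) ≤ M * packingPreAt s ε A := by
  classical
  have hε0 : ENNReal.ofReal ε ^ (s : ℝ) ≠ 0 := by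
    simpa [ENNReal.rpow_eq_zero_iff] using fun h => absurd h (not_le.2 hε)
  -- Balls of radius ε about a 2ε-separated set are disjoint, so every such set is a packing and its
  -- cardinality is controlled by the premeasure.
  let Q : ℕ → Prop := fun n => ∃ T : Finset X, T.card = n ∧ (∀ p ∈ T, p ∈ A) ∧
    (T : Set X).Pairwise fun p q => 2 * ε ≤ dist p q
  have hQ : ∀ n, Q n → (n : ℝ≥0∞) * ENNReal.ofReal ε ^ (s : ℝ) ≤ packingPreAt s ε A := by
    rintro n ⟨T, rfl, hTA, hT⟩
    have hinj : Set.InjOn (fun p : X => (p, ε)) T := fun p _ q _ h => (Prod.ext_iff.1 h).1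
    have hpk : IsPacking A ε (T.image fun p => (p, ε)) := by
      constructor
      · intro p hp
        obtain ⟨q, hq, rfl⟩ := Finset.mem_image.1 hp
        exact ⟨hTA q hq, hε, le_rfl⟩
      · intro p hp q hq hpq
        obtain ⟨p', hp', rfl⟩ := Finset.mem_image.1 (Finset.mem_coe.1 hp)
        obtain ⟨q', hq', rfl⟩ := Finset.mem_image.1 (Finset.mem_coe.1 hq)
        refine Metric.ball_disjoint_ball ?_
        have := hT hp' hq' (fun h => hpq (by rw [h]))
        linarith
    refine le_trans (le_of_eq ?_) (le_iSup₂_of_le _ hpk le_rfl)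
    rw [Finset.sum_image hinj]
    simp
  -- If the cardinalities are bounded, a largest separated set exists and its 2ε-balls cover. If
  -- not, the premeasure is infinite and there is nothing to prove.
  by_cases hb : ∃ B : ℕ, ∀ n, Q n → n ≤ B
  · obtain ⟨B, hB⟩ := hb
    have hQ0 : Q 0 := ⟨∅, rfl, by simp, by simp⟩
    have hn : Q (Nat.findGreatest Q B) := Nat.findGreatest_spec (Nat.zero_le B) hQ0
    have hn1 : ¬ Q (Nat.findGreatest Q B + 1) := fun h' =>
      absurd (Nat.le_findGreatest (hB _ h') h') (by omega)
    set n := Nat.findGreatest Q B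
    have hle := hQ n hn
    obtain ⟨T, hTn, hTA, hT⟩ := hn
    have hcov : f ⁻¹' A ⊆ ⋃ p ∈ T, f ⁻¹' Metric.ball p (2 * ε) := by
      intro y hy
      by_contra hnot
      simp only [mem_iUnion, mem_preimage, Metric.mem_ball, not_exists, not_lt] at hnot
      have hyT : f y ∉ T := fun hmem => by
        have := hnot _ hmem
        rw [dist_self] at this
        linarith
      refine hn1 ⟨insert (f y) T, by rw [Finset.card_insert_of_notMem hyT, hTn], ?_, ?_⟩
      · intro p hp
        rcases Finset.mem_insert.1 hp with rfl | hp
        exacts [hy, hTA p hp]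
      · rw [Finset.coe_insert]
        refine pairwise_insert.2 ⟨hT, fun q hq _ => ⟨hnot q hq, ?_⟩⟩
        rw [dist_comm]
        exact hnot q hq
    calc ν (f ⁻¹' A) ≤ ν (⋃ p ∈ T, f ⁻¹' Metric.ball p (2 * ε)) := measure_mono hcov
      _ ≤ ∑ p ∈ T, ν (f ⁻¹' Metric.ball p (2 * ε)) := measure_biUnion_finset_le _ _
      _ ≤ ∑ p ∈ T, M * ENNReal.ofReal ε ^ (s : ℝ) := Finset.sum_le_sum fun p hp => h p (hTA p hp)
      _ = M * (n * ENNReal.ofReal ε ^ (s : ℝ)) := by simp [hTn]; ring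
      _ ≤ _ := by gcongr
  · push Not at hb
    have htop : packingPreAt s ε A = ∞ := by
      by_contra hne
      have hne' : packingPreAt s ε A / ENNReal.ofReal ε ^ (s : ℝ) ≠ ∞ :=
        ENNReal.div_ne_top hne hε0
      obtain ⟨B, hB⟩ := ENNReal.exists_nat_gt hne'
      obtain ⟨n, hn, hBn⟩ := hb B
      have h1 := hQ n hn
      rw [← ENNReal.le_div_iff_mul_le (Or.inl hε0)
        (Or.inl (ENNReal.rpow_ne_top_of_nonneg s.2 ENNReal.ofReal_ne_top))] at h1
      exact absurd (h1.trans_lt hB) (not_lt.2 (by exact_mod_cast hBn.le))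
    rw [htop]
    rw [ENNReal.mul_top hM]
    exact le_top

/-- If a measure is uniformly small on balls of arbitrarily small radii, the packing measure of a set
of positive mass is infinite. -/
theorem packingMeasure_eq_top {Y : Type*} [MeasurableSpace Y] (ν : Measure Y) (f : Y → X)
    {A : Set X} {s t : ℝ≥0} (hst : s < t) {M : ℝ≥0∞} (hM : M ≠ 0) (hM' : M ≠ ∞)
    (hA : ν (f ⁻¹' A) ≠ 0)
    (h : ∀ δ : ℝ, 0 < δ → ∃ ε, 0 < ε ∧ ε ≤ δ ∧
      ∀ p ∈ A, ν (f ⁻¹' Metric.ball p (2 * ε)) ≤ M * ENNReal.ofReal ε ^ (t : ℝ)) :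
    packingMeasure s A = ∞ := by
  -- The premeasure is not countably subadditive, so the bound is proved for all subsets of positive
  -- mass; every countable cover of A has a member meeting A in such a subset.
  have key : ∀ B ⊆ A, ν (f ⁻¹' B) ≠ 0 → packingPre s B = ∞ := by
    intro B hBA hB
    by_contra hne
    obtain ⟨δ₀, hδ₀, hfin⟩ : ∃ δ₀ : ℝ, 0 < δ₀ ∧ packingPreAt s δ₀ B ≠ ∞ := by
      by_contra! hall
      exact hne (by simp only [packingPre]; exact iInf₂_eq_top.2 hall)
    obtain ⟨δ₁, hδ₁, hzero⟩ : ∃ δ₁ : ℝ, 0 < δ₁ ∧ ∀ ε, 0 < ε → ε ≤ δ₁ →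
        M * (ENNReal.ofReal ε ^ ((t : ℝ) - s) * packingPreAt s δ₀ B) < ν (f ⁻¹' B) := by
      have hpos : 0 < (t : ℝ) - s := sub_pos.2 (by exact_mod_cast hst)
      have hlim : Tendsto (fun δ : ℝ =>
          M * (ENNReal.ofReal δ ^ ((t : ℝ) - s) * packingPreAt s δ₀ B)) (𝓝 0) (𝓝 0) := by
        have h1 : Tendsto (fun δ : ℝ => ENNReal.ofReal δ ^ ((t : ℝ) - s)) (𝓝 0)
            (𝓝 (ENNReal.ofReal 0 ^ ((t : ℝ) - s))) :=
          ((ENNReal.continuous_rpow_const.comp ENNReal.continuous_ofReal).tendsto _)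
        rw [ENNReal.ofReal_zero, ENNReal.zero_rpow_of_pos hpos] at h1
        simpa using ENNReal.Tendsto.const_mul
          (ENNReal.Tendsto.mul_const h1 (Or.inr hfin)) (Or.inr hM')
      have hev := hlim.eventually (gt_mem_nhds (pos_iff_ne_zero.2 hB))
      obtain ⟨δ, hδ, hball⟩ := Metric.eventually_nhds_iff.1 hev
      refine ⟨δ / 2, by linarith, fun ε h0 h1 => hball ?_⟩
      rw [Real.dist_eq, sub_zero, abs_of_pos h0]
      linarith
    obtain ⟨ε, hε, hεδ, hball⟩ := h (min δ₀ δ₁) (lt_min hδ₀ hδ₁)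
    have h0 : ENNReal.ofReal ε ≠ 0 := by simpa using hε
    have hpow : ENNReal.ofReal ε ^ (t : ℝ) =
        ENNReal.ofReal ε ^ ((t : ℝ) - s) * ENNReal.ofReal ε ^ (s : ℝ) := by
      rw [← ENNReal.rpow_add _ _ h0 ENNReal.ofReal_ne_top]
      congr 1
      ring
    have hM1 : M * ENNReal.ofReal ε ^ ((t : ℝ) - s) ≠ 0 := by
      refine mul_ne_zero hM ?_
      simpa [ENNReal.rpow_eq_zero_iff] using fun h => absurd h (not_le.2 hε)
    -- The surplus ε^(t−s) is moved into the constant. With a finite premeasure it would force the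
    -- mass of B below itself as ε tends to 0.
    have h2 := measure_le_packingPreAt ν f (A := B) (s := s) hε hM1 fun p hp => by
      refine (hball p (hBA hp)).trans (le_of_eq ?_)
      rw [hpow, mul_assoc]
    have h3 := hzero ε hε (hεδ.trans (min_le_right _ _))
    refine absurd (h2.trans ?_) (not_le.2 h3)
    rw [mul_assoc]
    gcongr
    exact packingPreAt_mono_scale s (hεδ.trans (min_le_left _ _)) B
  refine iInf₂_eq_top.2 fun F hF => ?_
  obtain ⟨i, hi⟩ : ∃ i, ν (f ⁻¹' (A ∩ F i)) ≠ 0 := by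
    by_contra! hall
    refine hA (measure_mono_null ?_ (measure_iUnion_null hall))
    intro y hy
    obtain ⟨i, hi⟩ := mem_iUnion.1 (hF hy)
    exact mem_iUnion.2 ⟨i, hy, hi⟩
  have h1 : packingPre s (F i) = ∞ := by
    refine top_unique ((key _ inter_subset_left hi).symm.le.trans ?_)
    exact iInf₂_mono fun ε _ => packingPreAt_mono s ε inter_subset_right
  exact ENNReal.tsum_eq_top_of_eq_top ⟨i, h1⟩

end PackingBounds

/-! ### Cantor sets coded by binary sequences -/

/-- The uniform measure on binary sequences. -/
noncomputable def coinMeasure : Measure (ℕ → Bool) :=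
  Measure.infinitePi fun _ : ℕ => (PMF.uniformOfFintype Bool).toMeasure

instance : IsProbabilityMeasure coinMeasure := by
  unfold coinMeasure; infer_instance

/-- The sequences which start with the first `k` symbols of `w`. -/
def binCylinder (w : ℕ → Bool) (k : ℕ) : Set (ℕ → Bool) := {v | ∀ j < k, v j = w j}

theorem coinMeasure_binCylinder (w : ℕ → Bool) (k : ℕ) :
    coinMeasure (binCylinder w k) = ENNReal.ofReal ((1 / 2) ^ k) := by
  have h : binCylinder w k = Set.pi (Finset.range k) fun j => {w j} := by
    ext v; simp [binCylinder]
  rw [h, coinMeasure, Measure.infinitePi_pi _ fun j _ => measurableSet_singleton _]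
  have h2 : ∀ j, (PMF.uniformOfFintype Bool).toMeasure {w j} = ENNReal.ofReal (1 / 2) := by
    intro j
    rw [PMF.toMeasure_apply_singleton _ _ (measurableSet_singleton _)]
    simp [PMF.uniformOfFintype_apply]
  simp only [h2, Finset.prod_const, Finset.card_range]
  rw [ENNReal.ofReal_pow (by norm_num)]

theorem isOpen_binCylinder (w : ℕ → Bool) (k : ℕ) : IsOpen (binCylinder w k) := by
  have h : binCylinder w k = Set.pi (Finset.range k : Set ℕ) fun j => {w j} := by
    ext v; simp [binCylinder]
  rw [h]
  exact isOpen_set_pi (Finset.finite_toSet _) fun j _ => isOpen_discrete _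

/-- `c` codes a Cantor set by binary sequences: the pieces of level `k` have size `s k`, and
different pieces of level `k + 1` in the same piece of level `k` are separated by `s k`, up to the
factor `K`. -/
structure IsCoding {X : Type*} [PseudoMetricSpace X] (c : (ℕ → Bool) → X) (s : ℕ → ℝ) (K : ℝ) :
    Prop where
  K_pos : 0 < K
  s_pos : ∀ k, 0 < s k
  s_anti : Antitone s
  s_lim : Tendsto s atTop (𝓝 0)
  upper : ∀ k w v, (∀ j < k, w j = v j) → dist (c w) (c v) ≤ K * s k
  lower : ∀ k w v, (∀ j < k, w j = v j) → w k ≠ v k → s k ≤ K * dist (c w) (c v)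

namespace IsCoding

variable {X : Type*} [PseudoMetricSpace X] {c : (ℕ → Bool) → X} {s : ℕ → ℝ} {K : ℝ}

/-- At the first index j where the addresses differ, separation gives s_j ≤ K · dist, which is
excluded for j < k. -/
theorem agree (hc : IsCoding c s K) {k : ℕ} {w v : ℕ → Bool}
    (h : ∀ j < k, K * dist (c w) (c v) < s j) : ∀ j < k, w j = v j := by
  intro j
  induction j using Nat.strong_induction_on with
  | h j ih =>
    intro hj
    by_contra hne
    exact absurd (hc.lower j w v (fun i hi => ih i hi (hi.trans hj)) hne) (not_le.2 (h j hj))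

theorem agree_of_lt (hc : IsCoding c s K) {k : ℕ} {w v : ℕ → Bool}
    (h : K * dist (c w) (c v) < s k) : ∀ j ≤ k, w j = v j := fun j hj =>
  hc.agree (k := k + 1) (fun _ hi => h.trans_le (hc.s_anti (Nat.lt_succ_iff.1 hi))) j
    (Nat.lt_succ_iff.2 hj)

theorem continuous (hc : IsCoding c s K) : Continuous c := by
  refine continuous_iff_continuousAt.2 fun w => Metric.tendsto_nhds.2 fun ε hε => ?_
  have h1 : Tendsto (fun k => K * s k) atTop (𝓝 0) := by
    simpa using hc.s_lim.const_mul K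
  obtain ⟨k, hk⟩ := (h1.eventually (gt_mem_nhds hε)).exists
  filter_upwards [(isOpen_binCylinder w k).mem_nhds fun j _ => rfl] with v hv
  exact (hc.upper k v w hv).trans_lt hk

/-- The mass of a set of diameter at most `d`. -/
theorem measure_preimage_le (hc : IsCoding c s K) {t : ℝ≥0} {M : ℝ}
    (hM : ∀ k, (1 / 2 : ℝ) ^ k ≤ M * s k ^ (t : ℝ)) {S : Set X} {d : ℝ} (hd : 0 < d)
    (hS : ∀ p ∈ S, ∀ q ∈ S, dist p q ≤ d) :
    coinMeasure (c ⁻¹' S) ≤ ENNReal.ofReal (M * (K * d) ^ (t : ℝ)) := by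
  classical
  rcases eq_empty_or_nonempty (c ⁻¹' S) with h | ⟨w, hw⟩
  · simp [h]
  have hKd : 0 < K * d := mul_pos hc.K_pos hd
  have hM0 : 0 ≤ M := by
    have h0 := hM 0
    have h1 : 0 < s 0 ^ (t : ℝ) := Real.rpow_pos_of_pos (hc.s_pos 0) _
    by_contra hneg
    have := mul_neg_of_neg_of_pos (not_le.1 hneg) h1
    simp only [pow_zero] at h0
    linarith
  -- The first level whose size is at most K d: all earlier levels separate points by more than d,
  -- so the set lies in one cylinder of this level.
  have hex : ∃ k, s k ≤ K * d :=
    ((hc.s_lim.eventually (gt_mem_nhds hKd)).exists).imp fun k hk => hk.le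
  have hk := Nat.find_spec hex
  have hmin : ∀ j < Nat.find hex, K * d < s j := fun j hj => not_le.1 (Nat.find_min hex hj)
  set k := Nat.find hex
  have hsub : c ⁻¹' S ⊆ binCylinder w k := fun v hv => hc.agree fun j hj =>
    (mul_le_mul_of_nonneg_left (hS _ hv _ hw) hc.K_pos.le).trans_lt (hmin j hj)
  refine (measure_mono hsub).trans ?_
  rw [coinMeasure_binCylinder]
  refine ENNReal.ofReal_le_ofReal ((hM k).trans ?_)
  gcongr
  exact (hc.s_pos k).le

/-- A ball of radius r about a coded point contains a cylinder of level m + 1 with r ≤ K s_m, so its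
mass is at least a multiple of r^t. The scale K s_0 is the largest for which such an m exists. -/
theorem packingPreAt_ne_top (hc : IsCoding c s K) {t : ℝ≥0} {M : ℝ}
    (hM : ∀ k, s k ^ (t : ℝ) ≤ M * (1 / 2 : ℝ) ^ k) :
    packingPreAt t (K * s 0) (range c) ≠ ∞ := by
  classical
  have hM0 : 0 ≤ M := by
    have h0 := hM 0
    have h1 : 0 < s 0 ^ (t : ℝ) := Real.rpow_pos_of_pos (hc.s_pos 0) _
    simp only [pow_zero] at h0
    linarith
  have hK := hc.K_pos
  refine ne_top_of_le_ne_top ?_ (packingPreAt_le_of_measure coinMeasure c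
    (M := ENNReal.ofReal (K ^ (t : ℝ) * (M * 2)))
    (fun p r => (Metric.isOpen_ball.preimage hc.continuous).measurableSet) ?_)
  · exact ENNReal.mul_ne_top ENNReal.ofReal_ne_top (measure_ne_top _ _)
  rintro _ ⟨w, rfl⟩ r hr hrε
  have h1 : Tendsto (fun k => K * s k) atTop (𝓝 0) := by
    simpa using hc.s_lim.const_mul K
  have hex : ∃ k, K * s k < r := (h1.eventually (gt_mem_nhds hr)).exists
  have hk := Nat.find_spec hex
  have hmin : ∀ j < Nat.find hex, r ≤ K * s j := fun j hj => not_lt.1 (Nat.find_min hex hj)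
  obtain ⟨m, hm⟩ : ∃ m, Nat.find hex = m + 1 := by
    refine Nat.exists_eq_succ_of_ne_zero fun h0 => ?_
    rw [h0] at hk
    linarith
  rw [hm] at hk hmin
  have hsub : binCylinder w (m + 1) ⊆ c ⁻¹' Metric.ball (c w) r := fun v hv =>
    (hc.upper (m + 1) v w hv).trans_lt hk
  -- The radius is controlled by level m and the mass by level m + 1; this costs the factor 2.
  have hr1 : r ^ (t : ℝ) ≤ K ^ (t : ℝ) * (M * 2) * (1 / 2) ^ (m + 1) := by
    calc r ^ (t : ℝ) ≤ (K * s m) ^ (t : ℝ) := by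
          gcongr
          exact hmin m (Nat.lt_succ_self m)
      _ = K ^ (t : ℝ) * s m ^ (t : ℝ) := Real.mul_rpow hK.le (hc.s_pos m).le
      _ ≤ K ^ (t : ℝ) * (M * (1 / 2) ^ m) := by gcongr; exact hM m
      _ = _ := by rw [pow_succ]; ring
  calc ENNReal.ofReal r ^ (t : ℝ) = ENNReal.ofReal (r ^ (t : ℝ)) :=
        ENNReal.ofReal_rpow_of_nonneg hr.le t.coe_nonneg
    _ ≤ ENNReal.ofReal (K ^ (t : ℝ) * (M * 2)) * coinMeasure (binCylinder w (m + 1)) := by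
        rw [coinMeasure_binCylinder, ← ENNReal.ofReal_mul (by positivity)]
        exact ENNReal.ofReal_le_ofReal hr1
    _ ≤ _ := by gcongr

theorem packingPre_eq_zero (hc : IsCoding c s K) {t u : ℝ≥0} (htu : t < u) {M : ℝ}
    (hM : ∀ k, s k ^ (t : ℝ) ≤ M * (1 / 2 : ℝ) ^ k) : packingPre u (range c) = 0 :=
  _root_.packingPre_eq_zero htu (mul_pos hc.K_pos (hc.s_pos 0)) (hc.packingPreAt_ne_top hM)

/-- Packings may be taken at whichever small scales are favourable, so an estimate at infinitely
many levels suffices. -/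
theorem packingMeasure_eq_top (hc : IsCoding c s K) {t u : ℝ≥0} (hut : u < t)
    (hM : ∃ᶠ k in atTop, (1 / 2 : ℝ) ^ k ≤ s k ^ (t : ℝ)) : packingMeasure u (range c) = ∞ := by
  have hK := hc.K_pos
  refine _root_.packingMeasure_eq_top coinMeasure c hut
    (M := ENNReal.ofReal ((8 * K) ^ (t : ℝ))) ?_ ENNReal.ofReal_ne_top ?_ fun δ hδ => ?_
  · simpa using Real.rpow_pos_of_pos (by positivity) _
  · simp
  have h1 : Tendsto (fun k => s k / (8 * K)) atTop (𝓝 0) := by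
    simpa using hc.s_lim.div_const (8 * K)
  obtain ⟨k, hk, hkδ⟩ := (hM.and_eventually (h1.eventually (gt_mem_nhds hδ))).exists
  -- With this radius ε, two points at distance less than 2ε satisfy K · dist < s_k / 4, hence share
  -- their first k symbols; and (8K)^t ε^t = s_k^t.
  refine ⟨s k / (8 * K), div_pos (hc.s_pos k) (by positivity), hkδ.le, ?_⟩
  rintro _ ⟨w, rfl⟩
  have hsub : c ⁻¹' Metric.ball (c w) (2 * (s k / (8 * K))) ⊆ binCylinder w k := by
    intro v hv j hj
    refine hc.agree_of_lt (k := k) ?_ j hj.le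
    have h2 : dist (c v) (c w) < 2 * (s k / (8 * K)) := hv
    have h3 : K * (2 * (s k / (8 * K))) = s k / 4 := by field_simp; ring
    have h4 := hc.s_pos k
    nlinarith
  refine (measure_mono hsub).trans ?_
  have h5 : 0 < s k / (8 * K) := div_pos (hc.s_pos k) (by positivity)
  rw [coinMeasure_binCylinder, ENNReal.ofReal_rpow_of_nonneg h5.le t.coe_nonneg,
    ← ENNReal.ofReal_mul (by positivity), ← Real.mul_rpow (by positivity) h5.le]
  refine ENNReal.ofReal_le_ofReal (hk.trans (le_of_eq ?_))
  congr 1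
  field_simp

/-- The upper bound needs an estimate at all levels, the lower bound only at infinitely many. For
the Hausdorff dimension below the two roles are exchanged. -/
theorem packingDim_range (hc : IsCoding c s K) {β : ℝ≥0}
    (hU : ∀ t : ℝ≥0, β < t → ∃ M, ∀ k, s k ^ (t : ℝ) ≤ M * (1 / 2 : ℝ) ^ k)
    (hL : ∀ t : ℝ≥0, t < β → ∃ᶠ k in atTop, (1 / 2 : ℝ) ^ k ≤ s k ^ (t : ℝ)) :
    packingDim (range c) = β := by
  refine le_antisymm (packingDim_le_of_measure fun u hu => ?_)
    (le_packingDim_of_measure fun u hu => ?_)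
  · obtain ⟨t, ht, htu⟩ := exists_between hu
    obtain ⟨M, hM⟩ := hU t ht
    rw [packingMeasure_eq_zero_of_cover (F := fun _ => range c)
      (fun x hx => mem_iUnion.2 ⟨0, hx⟩) fun _ => hc.packingPre_eq_zero htu hM]
    exact ENNReal.zero_ne_top
  · obtain ⟨t, hut, ht⟩ := exists_between hu
    exact hc.packingMeasure_eq_top hut (hL t ht)

end IsCoding

/-- The 2^k pieces of one good level form an efficient cover, which gives the upper bound. The lower
bound is the mass distribution principle for the image of the uniform measure. -/
theorem IsCoding.dimH_range {X : Type*} [MetricSpace X] {c : (ℕ → Bool) → X} {s : ℕ → ℝ} {K : ℝ}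
    (hc : IsCoding c s K) {α : ℝ≥0}
    (hU : ∀ t : ℝ≥0, α < t → ∃ᶠ k in atTop, s k ^ (t : ℝ) ≤ (1 / 2 : ℝ) ^ k)
    (hL : ∀ t : ℝ≥0, t < α → ∃ M, ∀ k, (1 / 2 : ℝ) ^ k ≤ M * s k ^ (t : ℝ)) :
    dimH (range c) = α := by
  have hK := hc.K_pos
  borelize X
  refine le_antisymm ?_ ?_
  · refine ENNReal.le_of_forall_pos_le_add fun ε hε _ => ?_
    set t : ℝ≥0 := α + ε with ht
    rw [show (α : ℝ≥0∞) + ε = (t : ℝ≥0) by simp [ht]]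
    refine dimH_le_of_hausdorffMeasure_ne_top ?_
    refine ne_top_of_le_ne_top (ENNReal.ofReal_ne_top (r := K ^ (t : ℝ))) ?_
    let ext : ∀ k, (Fin k → Bool) → ℕ → Bool := fun k u j => if h : j < k then u ⟨j, h⟩ else false
    have hdiam : ∀ k (u : Fin k → Bool),
        Metric.ediam (c '' binCylinder (ext k u) k) ≤ ENNReal.ofReal (K * s k) := by
      intro k u
      refine Metric.ediam_le ?_
      rintro _ ⟨w, hw, rfl⟩ _ ⟨v, hv, rfl⟩
      rw [edist_dist]
      exact ENNReal.ofReal_le_ofReal (hc.upper k w v fun j hj => (hw j hj).trans (hv j hj).symm)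
    refine (Measure.hausdorffMeasure_le_liminf_sum (l := atTop) (ι := fun k => Fin k → Bool) (t : ℝ) (range c)
      (fun k => ENNReal.ofReal (K * s k)) ?_ (fun k u => c '' binCylinder (ext k u) k)
      (Eventually.of_forall hdiam) (Eventually.of_forall fun k => ?_)).trans ?_
    · have h1 : Tendsto (fun k => K * s k) atTop (𝓝 0) := by
        simpa using hc.s_lim.const_mul K
      simpa using ENNReal.tendsto_ofReal h1
    · rintro _ ⟨w, rfl⟩
      refine mem_iUnion.2 ⟨fun j => w j, w, fun j hj => ?_, rfl⟩
      simp [ext, hj]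
    -- The cover of level k costs at most 2^k (K s_k)^t, which is at most K^t at the good levels; a
    -- lower limit only needs those.
    · refine liminf_le_of_frequently_le' ((hU t ?_).mono fun k hk => ?_)
      · rw [ht]; exact lt_add_of_pos_right _ (by exact_mod_cast hε)
      · calc ∑ u : Fin k → Bool, Metric.ediam (c '' binCylinder (ext k u) k) ^ (t : ℝ)
            ≤ ∑ u : Fin k → Bool, ENNReal.ofReal (K * s k) ^ (t : ℝ) :=
              Finset.sum_le_sum fun u _ => ENNReal.rpow_le_rpow (hdiam k u) t.coe_nonneg
          _ = ENNReal.ofReal (2 ^ k * (K * s k) ^ (t : ℝ)) := by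
              rw [ENNReal.ofReal_rpow_of_nonneg (mul_pos hK (hc.s_pos k)).le t.coe_nonneg,
                ENNReal.ofReal_mul (by positivity)]
              simp
          _ ≤ ENNReal.ofReal (K ^ (t : ℝ)) := by
              refine ENNReal.ofReal_le_ofReal ?_
              rw [Real.mul_rpow hK.le (hc.s_pos k).le]
              calc (2 : ℝ) ^ k * (K ^ (t : ℝ) * s k ^ (t : ℝ))
                  ≤ 2 ^ k * (K ^ (t : ℝ) * (1 / 2) ^ k) := by gcongr
                _ = (2 * (1 / 2)) ^ k * K ^ (t : ℝ) := by rw [mul_pow]; ring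
                _ = K ^ (t : ℝ) := by norm_num
  · refine ENNReal.le_of_forall_nnreal_lt fun t ht => ?_
    rw [ENNReal.coe_lt_coe] at ht
    rcases eq_or_ne t 0 with rfl | ht0
    · simp
    obtain ⟨M, hM⟩ := hL t ht
    obtain ⟨M', hM', hMM⟩ : ∃ M' : ℝ, 0 < M' ∧ ∀ k, (1 / 2 : ℝ) ^ k ≤ M' * s k ^ (t : ℝ) := by
      refine ⟨|M| + 1, by positivity, fun k => (hM k).trans ?_⟩
      have := (Real.rpow_pos_of_pos (hc.s_pos k) (t : ℝ)).le
      gcongr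
      linarith [le_abs_self M]
    have ht1 : 0 < (t : ℝ) := by positivity
    set Q : ℝ≥0∞ := ENNReal.ofReal (M' * K ^ (t : ℝ)) with hQ
    have hQ0 : Q ≠ 0 := by simpa [hQ] using by positivity
    have hQt : Q ≠ ∞ := ENNReal.ofReal_ne_top
    have hmeas : Measurable c := hc.continuous.measurable
    have hle : Q⁻¹ • Measure.map c coinMeasure ≤ μH[(t : ℝ)] := by
      refine Measure.le_hausdorffMeasure _ _ 1 one_pos fun S hS => ?_
      have hfin : Metric.ediam S ≠ ∞ := ne_top_of_le_ne_top ENNReal.one_ne_top hS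
      -- The closure has the same diameter and is measurable, so its image mass is the mass of its
      -- preimage.
      have hb : Q⁻¹ * Measure.map c coinMeasure (closure S) ≤ Metric.ediam S ^ (t : ℝ) := by
        rw [Measure.map_apply hmeas isClosed_closure.measurableSet]
        have hd : ∀ d : ℝ, 0 < d → Metric.ediam S ≤ ENNReal.ofReal d →
            Q⁻¹ * coinMeasure (c ⁻¹' closure S) ≤ ENNReal.ofReal d ^ (t : ℝ) := by
          intro d hd hSd
          have h1 := hc.measure_preimage_le hMM (S := closure S) hd fun p hp q hq => by
            rw [← ENNReal.ofReal_le_ofReal_iff hd.le, ← edist_dist]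
            refine (Metric.edist_le_ediam_of_mem hp hq).trans ?_
            rwa [Metric.ediam_closure]
          rw [mul_comm, ← div_eq_mul_inv]
          refine ENNReal.div_le_of_le_mul (h1.trans (le_of_eq ?_))
          rw [hQ, ENNReal.ofReal_rpow_of_nonneg hd.le t.coe_nonneg, ← ENNReal.ofReal_mul (by positivity),
            Real.mul_rpow hK.le hd.le]
          congr 1
          ring
        -- The mass bound requires a positive diameter bound; sets of diameter 0 are reached by
        -- enlarging the diameter by e and letting e tend to 0.
        have hlim : Tendsto (fun e : ℝ => ENNReal.ofReal ((Metric.ediam S).toReal + e) ^ (t : ℝ))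
            (𝓝[>] 0) (𝓝 (Metric.ediam S ^ (t : ℝ))) := by
          have hcont : Continuous fun e : ℝ =>
              ENNReal.ofReal ((Metric.ediam S).toReal + e) ^ (t : ℝ) :=
            ENNReal.continuous_rpow_const.comp
              (ENNReal.continuous_ofReal.comp (continuous_const.add continuous_id))
          have := hcont.tendsto 0
          rw [add_zero, ENNReal.ofReal_toReal hfin] at this
          exact this.mono_left nhdsWithin_le_nhds
        refine ge_of_tendsto hlim (eventually_nhdsWithin_of_forall fun e he => ?_)
        have he' : (0 : ℝ) < e := he
        refine hd _ (by positivity) ?_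
        rw [← ENNReal.ofReal_toReal hfin]
        exact ENNReal.ofReal_le_ofReal (by simp [he'.le])
      refine le_trans ?_ hb
      rw [Measure.smul_apply, smul_eq_mul]
      gcongr
      exact subset_closure
    refine le_dimH_of_hausdorffMeasure_ne_zero fun h0 => ?_
    have h1 := le_antisymm ((hle (range c)).trans h0.le) bot_le
    have h2 : 1 ≤ Measure.map c coinMeasure (range c) := by
      refine le_trans ?_ (Measure.le_map_apply hmeas.aemeasurable _)
      simp
    rw [Measure.smul_apply, smul_eq_mul, mul_eq_zero, ENNReal.inv_eq_zero] at h1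
    rcases h1 with h1 | h1
    · exact hQt h1
    · rw [h1] at h2
      exact absurd h2 (by simp)

/-! ### The Cantor set with alternating ratios -/

/-! ### Arc length and chord length on the circle. -/

theorem norm_exp_mul_I_sub_le (x y : ℝ) :
    dist (Complex.exp (x * Complex.I)) (Complex.exp (y * Complex.I)) ≤ |x - y| := by
  have h : Complex.exp (x * Complex.I) - Complex.exp (y * Complex.I) =
      Complex.exp (y * Complex.I) * (Complex.exp (Complex.I * ((x - y : ℝ) : ℂ)) - 1) := by
    rw [mul_sub, ← Complex.exp_add, mul_one]
    congr 2
    push_cast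
    ring
  rw [dist_eq_norm, h, norm_mul, Complex.norm_exp_ofReal_mul_I, one_mul]
  exact Real.norm_exp_I_mul_ofReal_sub_one_le

/-- The chord is 2 |sin((x − y)/2)|; Jordan's inequality sin u ≥ 2u/π together with π ≤ 4 gives the
factor 2. -/
theorem le_norm_exp_mul_I_sub {x y : ℝ} (hxy : |x - y| ≤ 1) :
    |x - y| ≤ 2 * dist (Complex.exp (x * Complex.I)) (Complex.exp (y * Complex.I)) := by
  have h : Complex.exp (x * Complex.I) - Complex.exp (y * Complex.I) =
      Complex.exp (y * Complex.I) * (Complex.exp (Complex.I * ((x - y : ℝ) : ℂ)) - 1) := by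
    rw [mul_sub, ← Complex.exp_add, mul_one]
    congr 2
    push_cast
    ring
  rw [dist_eq_norm, h, norm_mul, Complex.norm_exp_ofReal_mul_I, one_mul,
    Complex.norm_exp_I_mul_ofReal_sub_one, norm_mul, Real.norm_eq_abs, Real.norm_eq_abs, abs_two]
  have hπ : Real.pi ≤ 4 := Real.pi_le_four
  have hπ0 := Real.pi_gt_three
  have key : ∀ z : ℝ, 0 ≤ z → z ≤ 1 → z / 4 ≤ Real.sin (z / 2) := by
    intro z hz hz1
    have h1 := Real.mul_le_sin (x := z / 2) (by linarith) (by linarith)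
    refine le_trans ?_ h1
    have h2 : 1 / 2 ≤ 2 / Real.pi := by rw [div_le_div_iff₀ two_pos Real.pi_pos]; linarith
    nlinarith
  have h3 := key |x - y| (abs_nonneg _) hxy
  have h4 : |Real.sin ((x - y) / 2)| = |Real.sin (|x - y| / 2)| := by
    rcases abs_choice (x - y) with h | h <;> rw [h]
    rw [neg_div, Real.sin_neg, abs_neg]
  rw [h4]
  have h5 := le_abs_self (Real.sin (|x - y| / 2))
  linarith

section Cantor

variable {a b lam eta xi : ℝ} {n N : ℕ → ℕ}

theorem IsAdmissible.b_pos (h : IsAdmissible a b lam eta xi n N) : 0 < b := h.a_pos.trans h.a_lt_b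

theorem IsAdmissible.log_b_neg (h : IsAdmissible a b lam eta xi n N) : Real.log b < 0 :=
  Real.log_neg h.b_pos (by linarith [h.b_lt])

theorem IsAdmissible.log_a_lt (h : IsAdmissible a b lam eta xi n N) : Real.log a < Real.log b :=
  Real.log_lt_log h.a_pos h.a_lt_b

theorem IsAdmissible.log_a_neg (h : IsAdmissible a b lam eta xi n N) : Real.log a < 0 :=
  h.log_a_lt.trans h.log_b_neg

theorem IsAdmissible.xi_pos (h : IsAdmissible a b lam eta xi n N) : 0 < xi :=
  h.a_rpow ▸ Real.rpow_pos_of_pos h.a_pos _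

theorem IsAdmissible.log_xi_eq (h : IsAdmissible a b lam eta xi n N) :
    Real.log xi = (1 + lam) * Real.log a := by
  rw [← h.a_rpow, Real.log_rpow h.a_pos]

theorem IsAdmissible.log_xi_eq' (h : IsAdmissible a b lam eta xi n N) :
    Real.log xi = (1 + eta) * Real.log b := by
  rw [← h.b_rpow, Real.log_rpow h.b_pos]

theorem IsAdmissible.log_xi_neg (h : IsAdmissible a b lam eta xi n N) : Real.log xi < 0 := by
  have := h.xi_lt
  have := Real.log_pos one_lt_two
  linarith

theorem IsAdmissible.strictMono_n (h : IsAdmissible a b lam eta xi n N) : StrictMono n := by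
  refine strictMono_nat_of_lt_succ fun i => ?_
  rcases i with _ | i
  · have := h.N_lt_n 0
    rw [h.n_zero]; omega
  · exact (h.n_lt_N i).trans (h.N_lt_n (i + 1))

theorem IsAdmissible.strictMono_N (h : IsAdmissible a b lam eta xi n N) : StrictMono N :=
  strictMono_nat_of_lt_succ fun i => (h.N_lt_n i).trans (h.n_lt_N i)

theorem IsAdmissible.stepRatio_eq_b {i k : ℕ} (h1 : n i ≤ k) (h2 : k < N i) :
    stepRatio a b n N k = b := if_pos ⟨i, h1, h2⟩

theorem IsAdmissible.stepRatio_eq_a (h : IsAdmissible a b lam eta xi n N) {i k : ℕ}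
    (h1 : N i ≤ k) (h2 : k < n (i + 1)) : stepRatio a b n N k = a := by
  refine if_neg ?_
  rintro ⟨j, hj1, hj2⟩
  rcases Nat.lt_or_ge i j with hij | hij
  · exact absurd (h.strictMono_n.monotone (Nat.succ_le_of_lt hij)) (by simp; omega)
  · exact absurd (h.strictMono_N.monotone hij) (by omega)

theorem stepRatio_eq_or (a b : ℝ) (n N : ℕ → ℕ) (k : ℕ) :
    stepRatio a b n N k = a ∨ stepRatio a b n N k = b := by
  unfold stepRatio
  split_ifs <;> simp

theorem IsAdmissible.le_stepRatio (h : IsAdmissible a b lam eta xi n N) (k : ℕ) :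
    a ≤ stepRatio a b n N k := by
  rcases stepRatio_eq_or a b n N k with h1 | h1 <;> rw [h1]
  exact h.a_lt_b.le

theorem IsAdmissible.stepRatio_le (h : IsAdmissible a b lam eta xi n N) (k : ℕ) :
    stepRatio a b n N k ≤ b := by
  rcases stepRatio_eq_or a b n N k with h1 | h1 <;> rw [h1]
  exact h.a_lt_b.le

theorem cantorLen_succ (a b : ℝ) (n N : ℕ → ℕ) (k : ℕ) :
    cantorLen a b n N (k + 1) = stepRatio a b n N k * cantorLen a b n N k := by
  rw [cantorLen, Finset.prod_range_succ, mul_comm, cantorLen]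

theorem cantorLen_zero (a b : ℝ) (n N : ℕ → ℕ) : cantorLen a b n N 0 = 1 := by simp [cantorLen]

theorem IsAdmissible.cantorLen_pos (h : IsAdmissible a b lam eta xi n N) (k : ℕ) :
    0 < cantorLen a b n N k :=
  Finset.prod_pos fun j _ => h.a_pos.trans_le (h.le_stepRatio j)

theorem IsAdmissible.cantorLen_succ_le (h : IsAdmissible a b lam eta xi n N) (k : ℕ) :
    cantorLen a b n N (k + 1) ≤ b * cantorLen a b n N k := by
  rw [cantorLen_succ]
  exact mul_le_mul_of_nonneg_right (h.stepRatio_le k) (h.cantorLen_pos k).le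

theorem IsAdmissible.le_cantorLen_succ (h : IsAdmissible a b lam eta xi n N) (k : ℕ) :
    a * cantorLen a b n N k ≤ cantorLen a b n N (k + 1) := by
  rw [cantorLen_succ]
  exact mul_le_mul_of_nonneg_right (h.le_stepRatio k) (h.cantorLen_pos k).le

theorem IsAdmissible.strictAnti_cantorLen (h : IsAdmissible a b lam eta xi n N) :
    StrictAnti (cantorLen a b n N) := by
  refine strictAnti_nat_of_succ_lt fun k => (h.cantorLen_succ_le k).trans_lt ?_
  have := h.cantorLen_pos k
  nlinarith [h.b_lt]

theorem IsAdmissible.cantorLen_le (h : IsAdmissible a b lam eta xi n N) (k : ℕ) :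
    cantorLen a b n N k ≤ (1 / 2) ^ k := by
  induction k with
  | zero => simp [cantorLen_zero]
  | succ k ih =>
    refine (h.cantorLen_succ_le k).trans ?_
    have := h.cantorLen_pos k
    rw [pow_succ]
    nlinarith [h.b_lt]

theorem IsAdmissible.tendsto_cantorLen (h : IsAdmissible a b lam eta xi n N) :
    Tendsto (cantorLen a b n N) atTop (𝓝 0) :=
  squeeze_zero (fun k => (h.cantorLen_pos k).le) h.cantorLen_le
    (tendsto_pow_atTop_nhds_zero_of_lt_one (by norm_num) (by norm_num))

/-! ### Addresses of the points of the Cantor set. -/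

/-- The left translation of step `k` for the symbol `w k`. -/
noncomputable def cantorShift (a b : ℝ) (n N : ℕ → ℕ) (w : ℕ → Bool) (k : ℕ) : ℝ :=
  if w k then cantorLen a b n N k - cantorLen a b n N (k + 1) else 0

/-- The point of the Cantor set on the line with address `w`. -/
noncomputable def cantorPoint (a b : ℝ) (n N : ℕ → ℕ) (w : ℕ → Bool) : ℝ :=
  ∑' k, cantorShift a b n N w k

theorem IsAdmissible.cantorShift_nonneg (h : IsAdmissible a b lam eta xi n N) (w : ℕ → Bool)
    (k : ℕ) : 0 ≤ cantorShift a b n N w k := by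
  unfold cantorShift
  split_ifs
  · exact sub_nonneg.2 (h.strictAnti_cantorLen (Nat.lt_succ_self k)).le
  · exact le_rfl

theorem IsAdmissible.cantorShift_le (h : IsAdmissible a b lam eta xi n N) (w : ℕ → Bool) (k : ℕ) :
    cantorShift a b n N w k ≤ cantorLen a b n N k - cantorLen a b n N (k + 1) := by
  unfold cantorShift
  split_ifs
  · exact le_rfl
  · exact sub_nonneg.2 (h.strictAnti_cantorLen (Nat.lt_succ_self k)).le

theorem IsAdmissible.hasSum_len_sub (h : IsAdmissible a b lam eta xi n N) (k : ℕ) :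
    HasSum (fun j => cantorLen a b n N (j + k) - cantorLen a b n N (j + k + 1))
      (cantorLen a b n N k) := by
  refine (hasSum_iff_tendsto_nat_of_nonneg
    (fun j => sub_nonneg.2 (h.strictAnti_cantorLen (Nat.lt_succ_self _)).le) _).2 ?_
  have h1 : ∀ m, ∑ j ∈ Finset.range m,
      (cantorLen a b n N (j + k) - cantorLen a b n N (j + k + 1)) =
      cantorLen a b n N k - cantorLen a b n N (m + k) := by
    intro m
    have := Finset.sum_range_sub' (fun j => cantorLen a b n N (j + k)) m
    simp only [zero_add] at this
    rw [← this]
    refine Finset.sum_congr rfl fun j _ => ?_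
    rw [add_right_comm]
  simp only [h1]
  simpa using ((tendsto_add_atTop_iff_nat k).2 h.tendsto_cantorLen).const_sub
    (cantorLen a b n N k)

theorem IsAdmissible.summable_shift (h : IsAdmissible a b lam eta xi n N) (w : ℕ → Bool) :
    Summable (cantorShift a b n N w) :=
  Summable.of_nonneg_of_le (h.cantorShift_nonneg w) (h.cantorShift_le w)
    (h.hasSum_len_sub 0).summable

/-- The partial sum is the left endpoint of the interval of level k; the tail is at most the
telescoping sum of ℓ_j − ℓ_{j+1}, that is ℓ_k. -/
theorem IsAdmissible.cantorPoint_eq (h : IsAdmissible a b lam eta xi n N) (w : ℕ → Bool) (k : ℕ) :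
    ∃ t, 0 ≤ t ∧ t ≤ cantorLen a b n N k ∧
      cantorPoint a b n N w = ∑ j ∈ Finset.range k, cantorShift a b n N w j + t := by
  refine ⟨∑' j, cantorShift a b n N w (j + k), tsum_nonneg fun j => h.cantorShift_nonneg w _, ?_,
    ((h.summable_shift w).sum_add_tsum_nat_add k).symm⟩
  rw [← (h.hasSum_len_sub k).tsum_eq]
  exact Summable.tsum_le_tsum (fun j => h.cantorShift_le w _)
    ((summable_nat_add_iff k).2 (h.summable_shift w)) (h.hasSum_len_sub k).summable

theorem IsAdmissible.cantorPoint_mem_Icc (h : IsAdmissible a b lam eta xi n N) (w : ℕ → Bool) :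
    cantorPoint a b n N w ∈ Icc (0 : ℝ) 1 := by
  obtain ⟨t, h0, h1, h2⟩ := h.cantorPoint_eq w 0
  rw [cantorLen_zero] at h1
  rw [h2]
  simpa using ⟨h0, h1⟩

theorem IsAdmissible.abs_cantorPoint_sub_le (h : IsAdmissible a b lam eta xi n N) {k : ℕ}
    {w v : ℕ → Bool} (hwv : ∀ j < k, w j = v j) :
    |cantorPoint a b n N w - cantorPoint a b n N v| ≤ cantorLen a b n N k := by
  obtain ⟨t, ht0, ht1, ht⟩ := h.cantorPoint_eq w k
  obtain ⟨u, hu0, hu1, hu⟩ := h.cantorPoint_eq v k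
  have hs : ∑ j ∈ Finset.range k, cantorShift a b n N w j =
      ∑ j ∈ Finset.range k, cantorShift a b n N v j := by
    refine Finset.sum_congr rfl fun j hj => ?_
    rw [cantorShift, cantorShift, hwv j (Finset.mem_range.1 hj)]
  rw [ht, hu, hs, abs_le]
  constructor <;> linarith

/-- The gap between the two intervals of level k + 1 in one of level k is ℓ_k − 2 ℓ_{k+1}, and every
ratio is at most b. -/
theorem IsAdmissible.le_abs_cantorPoint_sub (h : IsAdmissible a b lam eta xi n N) {k : ℕ}
    {w v : ℕ → Bool} (hwv : ∀ j < k, w j = v j) (hk : w k ≠ v k) :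
    (1 - 2 * b) * cantorLen a b n N k ≤ |cantorPoint a b n N w - cantorPoint a b n N v| := by
  have key : ∀ w v : ℕ → Bool, (∀ j < k, w j = v j) → w k = true → v k = false →
      (1 - 2 * b) * cantorLen a b n N k ≤ |cantorPoint a b n N w - cantorPoint a b n N v| := by
    intro w v hwv hw hv
    obtain ⟨t, ht0, ht1, ht⟩ := h.cantorPoint_eq w (k + 1)
    obtain ⟨u, hu0, hu1, hu⟩ := h.cantorPoint_eq v (k + 1)
    have hs : ∑ j ∈ Finset.range k, cantorShift a b n N w j =
        ∑ j ∈ Finset.range k, cantorShift a b n N v j := by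
      refine Finset.sum_congr rfl fun j hj => ?_
      rw [cantorShift, cantorShift, hwv j (Finset.mem_range.1 hj)]
    have hw' : cantorShift a b n N w k = cantorLen a b n N k - cantorLen a b n N (k + 1) := by
      simp [cantorShift, hw]
    have hv' : cantorShift a b n N v k = 0 := by simp [cantorShift, hv]
    rw [Finset.sum_range_succ] at ht hu
    have := h.cantorLen_succ_le k
    refine le_trans ?_ (le_abs_self _)
    rw [ht, hu, hs, hw', hv']
    linarith
  rcases hw : w k with _ | _ <;> rcases hv : v k with _ | _
  · exact absurd (hw.trans hv.symm) hk
  · rw [abs_sub_comm]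
    exact key v w (fun j hj => (hwv j hj).symm) hv hw
  · exact key w v hwv hw hv
  · exact absurd (hw.trans hv.symm) hk

/-- The point of the Cantor set on the circle with address `w`. -/
noncomputable def cantorCode (a b : ℝ) (n N : ℕ → ℕ) (w : ℕ → Bool) : ℂ :=
  Complex.exp (cantorPoint a b n N w * Complex.I)

/-- In the constant, 2 comes from the comparison of chord and arc and 1 − 2b from the relative size
of the gaps. -/
theorem IsAdmissible.isCoding (h : IsAdmissible a b lam eta xi n N) :
    IsCoding (cantorCode a b n N) (cantorLen a b n N) (2 / (1 - 2 * b)) := by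
  have hb : 0 < 1 - 2 * b := by linarith [h.b_lt]
  have hb1 : 1 ≤ 2 / (1 - 2 * b) := by
    rw [le_div_iff₀ hb]
    linarith [h.b_pos]
  refine ⟨by positivity, h.cantorLen_pos, h.strictAnti_cantorLen.antitone, h.tendsto_cantorLen,
    fun k w v hwv => ?_, fun k w v hwv hk => ?_⟩
  · refine ((norm_exp_mul_I_sub_le _ _).trans (h.abs_cantorPoint_sub_le hwv)).trans ?_
    nlinarith [h.cantorLen_pos k]
  · have h1 := h.le_abs_cantorPoint_sub hwv hk
    have h2 : |cantorPoint a b n N w - cantorPoint a b n N v| ≤ 1 := by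
      have hw := h.cantorPoint_mem_Icc w
      have hv := h.cantorPoint_mem_Icc v
      rw [abs_le]
      constructor <;> linarith [hw.1, hw.2, hv.1, hv.2]
    have h3 := h1.trans (le_norm_exp_mul_I_sub h2)
    rw [div_mul_eq_mul_div, le_div_iff₀ hb, mul_comm]
    exact h3

theorem IsAdmissible.mem_cantorLeft_iff (k : ℕ) (x : ℝ) :
    x ∈ cantorLeft a b n N k ↔
      ∃ w : ℕ → Bool, x = ∑ j ∈ Finset.range k, cantorShift a b n N w j := by
  induction k generalizing x with
  | zero => simp [cantorLeft]
  | succ k ih =>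
    -- Symbols from index k on do not affect the partial sum of length k, so symbol k can be
    -- prescribed freely.
    have hupd : ∀ (w : ℕ → Bool) (e : Bool), ∑ j ∈ Finset.range (k + 1),
        cantorShift a b n N (Function.update w k e) j =
        ∑ j ∈ Finset.range k, cantorShift a b n N w j +
          if e then cantorLen a b n N k - cantorLen a b n N (k + 1) else 0 := by
      intro w e
      rw [Finset.sum_range_succ]
      congr 1
      · refine Finset.sum_congr rfl fun j hj => ?_
        have : j ≠ k := (Finset.mem_range.1 hj).ne
        simp [cantorShift, this]
      · simp [cantorShift]
    constructor
    · rintro (hx | ⟨y, hy, rfl⟩)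
      · obtain ⟨w, rfl⟩ := (ih x).1 hx
        exact ⟨Function.update w k false, by rw [hupd]; simp⟩
      · obtain ⟨w, rfl⟩ := (ih y).1 hy
        exact ⟨Function.update w k true, by rw [hupd]; simp⟩
    · rintro ⟨w, rfl⟩
      rw [Finset.sum_range_succ]
      rcases hw : w k with _ | _
      · left
        rw [ih]
        exact ⟨w, by simp [cantorShift, hw]⟩
      · right
        exact ⟨_, (ih _).2 ⟨w, rfl⟩, by simp [cantorShift, hw]⟩

theorem IsAdmissible.continuous_cantorPoint (h : IsAdmissible a b lam eta xi n N) :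
    Continuous (cantorPoint a b n N) := by
  refine continuous_iff_continuousAt.2 fun w => Metric.tendsto_nhds.2 fun ε hε => ?_
  obtain ⟨k, hk⟩ := (h.tendsto_cantorLen.eventually (gt_mem_nhds hε)).exists
  filter_upwards [(isOpen_binCylinder w k).mem_nhds fun j _ => rfl] with v hv
  exact (h.abs_cantorPoint_sub_le hv).trans_lt hk

/-- A point lying in intervals of all levels is within ℓ_k of an addressed point for each k, and the
set of addressed points is compact, hence closed. -/
theorem IsAdmissible.cantorLine_eq (h : IsAdmissible a b lam eta xi n N) :
    cantorLine a b n N = range (cantorPoint a b n N) := by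
  refine Subset.antisymm (fun y hy => ?_) ?_
  · have hcl : IsClosed (range (cantorPoint a b n N)) :=
      (isCompact_range h.continuous_cantorPoint).isClosed
    rw [← hcl.closure_eq, Metric.mem_closure_iff]
    intro ε hε
    obtain ⟨k, hk⟩ := (h.tendsto_cantorLen.eventually (gt_mem_nhds hε)).exists
    have hyk := mem_iInter.1 hy k
    simp only [mem_iUnion, IsAdmissible.mem_cantorLeft_iff] at hyk
    obtain ⟨x, ⟨w, rfl⟩, hx⟩ := hyk
    obtain ⟨t, ht0, ht1, ht⟩ := h.cantorPoint_eq w k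
    refine ⟨_, mem_range_self w, ?_⟩
    rw [ht, Real.dist_eq]
    refine lt_of_le_of_lt ?_ hk
    rw [abs_le]
    constructor <;> linarith [hx.1, hx.2]
  · rintro _ ⟨w, rfl⟩
    refine mem_iInter.2 fun k => ?_
    simp only [mem_iUnion, IsAdmissible.mem_cantorLeft_iff]
    obtain ⟨t, ht0, ht1, ht⟩ := h.cantorPoint_eq w k
    refine ⟨_, ⟨w, rfl⟩, ?_⟩
    rw [ht, mem_Icc]
    constructor <;> linarith

theorem IsAdmissible.cantorCircle_eq (h : IsAdmissible a b lam eta xi n N) :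
    cantorCircle a b n N = range (cantorCode a b n N) := by
  rw [cantorCircle, h.cantorLine_eq, ← range_comp]
  rfl

/-! #### Growth of `log ℓ_k` -/

theorem IsAdmissible.log_cantorLen_succ (h : IsAdmissible a b lam eta xi n N) (k : ℕ) :
    Real.log (cantorLen a b n N (k + 1)) =
      Real.log (stepRatio a b n N k) + Real.log (cantorLen a b n N k) := by
  rw [cantorLen_succ, Real.log_mul (h.a_pos.trans_le (h.le_stepRatio k)).ne'
    (h.cantorLen_pos k).ne']

theorem IsAdmissible.log_cantorLen_le (h : IsAdmissible a b lam eta xi n N) (k : ℕ) :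
    Real.log (cantorLen a b n N k) ≤ k * Real.log b := by
  induction k with
  | zero => simp [cantorLen_zero]
  | succ k ih =>
    rw [h.log_cantorLen_succ]
    have := Real.log_le_log (h.a_pos.trans_le (h.le_stepRatio k)) (h.stepRatio_le k)
    push_cast
    linarith

theorem IsAdmissible.le_log_cantorLen (h : IsAdmissible a b lam eta xi n N) (k : ℕ) :
    k * Real.log a ≤ Real.log (cantorLen a b n N k) := by
  induction k with
  | zero => simp [cantorLen_zero]
  | succ k ih =>
    rw [h.log_cantorLen_succ]
    have := Real.log_le_log h.a_pos (h.le_stepRatio k)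
    push_cast
    linarith

theorem IsAdmissible.log_cantorLen_of_a (h : IsAdmissible a b lam eta xi n N) (i m : ℕ)
    (hm : N i + m ≤ n (i + 1)) : Real.log (cantorLen a b n N (N i + m)) =
      Real.log (cantorLen a b n N (N i)) + m * Real.log a := by
  induction m with
  | zero => simp
  | succ m ih =>
    rw [← add_assoc, h.log_cantorLen_succ, ih (by omega),
      h.stepRatio_eq_a (i := i) (by omega) (by omega)]
    push_cast
    ring

theorem IsAdmissible.log_cantorLen_of_b (h : IsAdmissible a b lam eta xi n N) (i m : ℕ)
    (hm : n i + m ≤ N i) : Real.log (cantorLen a b n N (n i + m)) =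
      Real.log (cantorLen a b n N (n i)) + m * Real.log b := by
  induction m with
  | zero => simp
  | succ m ih =>
    rw [← add_assoc, h.log_cantorLen_succ, ih (by omega),
      IsAdmissible.stepRatio_eq_b (i := i) (by omega) (by omega)]
    push_cast
    ring

/-- Take k = n_{i+1}: all steps from N_i on have used the ratio a, and N_i is negligible against
n_{i+1}. -/
theorem IsAdmissible.frequently_log_cantorLen_le (h : IsAdmissible a b lam eta xi n N) {c : ℝ}
    (hc : Real.log a < c) : ∃ᶠ k : ℕ in atTop, Real.log (cantorLen a b n N k) ≤ c * k := by
  have hn : Tendsto (fun i => n (i + 1)) atTop atTop :=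
    (tendsto_add_atTop_iff_nat 1).2 h.strictMono_n.tendsto_atTop
  refine hn.frequently (Eventually.frequently ?_)
  have hca : 0 < c - Real.log a := sub_pos.2 hc
  -- The threshold is the one for which (n_{i+1} − N_i) log a ≤ c n_{i+1}. The condition i ≥ 1
  -- ensures N_i > 0, so that the quotient is meaningful.
  filter_upwards [h.n_div_N.eventually_ge_atTop (-Real.log a / (c - Real.log a)),
    eventually_ge_atTop 1] with i hi hi1
  have hNpos : 0 < N i := by
    have := h.strictMono_N hi1
    omega
  have h1 := h.log_cantorLen_of_a i (n (i + 1) - N i) (by have := h.N_lt_n i; omega)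
  rw [Nat.add_sub_cancel' (h.N_lt_n i).le, Nat.cast_sub (h.N_lt_n i).le] at h1
  have h2 := h.log_cantorLen_le (N i)
  have hN' : (0 : ℝ) < N i := by exact_mod_cast hNpos
  rw [div_le_div_iff₀ hca hN'] at hi
  rw [h1]
  nlinarith [h.log_b_neg]

/-- Take k = N_{i+1}: the last N_{i+1} − n_{i+1} steps have used b, and the first n_{i+1} are
negligible even if they all used a. -/
theorem IsAdmissible.frequently_le_log_cantorLen (h : IsAdmissible a b lam eta xi n N) {c : ℝ}
    (hc : c < Real.log b) : ∃ᶠ k : ℕ in atTop, c * k ≤ Real.log (cantorLen a b n N k) := by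
  have hn : Tendsto (fun i => N (i + 1)) atTop atTop :=
    (tendsto_add_atTop_iff_nat 1).2 h.strictMono_N.tendsto_atTop
  refine hn.frequently (Eventually.frequently ?_)
  have hca : 0 < Real.log b - c := sub_pos.2 hc
  filter_upwards [((tendsto_add_atTop_iff_nat 1).2 h.N_div_n).eventually_ge_atTop
    (-Real.log a / (Real.log b - c))] with i hi
  have hNpos : 0 < n (i + 1) := by
    have := h.N_lt_n i
    omega
  have h1 := h.log_cantorLen_of_b (i + 1) (N (i + 1) - n (i + 1)) (by have := h.n_lt_N i; omega)
  rw [Nat.add_sub_cancel' (h.n_lt_N i).le, Nat.cast_sub (h.n_lt_N i).le] at h1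
  have h2 := h.le_log_cantorLen (n (i + 1))
  have hN' : (0 : ℝ) < n (i + 1) := by exact_mod_cast hNpos
  rw [div_le_div_iff₀ hca hN'] at hi
  rw [h1]
  nlinarith [h.log_b_neg]

/-! #### Euclidean dimensions -/

theorem half_pow_le_rpow_iff {x t : ℝ} (hx : 0 < x) (k : ℕ) :
    (1 / 2 : ℝ) ^ k ≤ x ^ t ↔ -Real.log 2 * k ≤ t * Real.log x := by
  rw [← Real.log_le_log_iff (by positivity) (by positivity), Real.log_pow, Real.log_rpow hx,
    one_div, Real.log_inv, mul_comm]

theorem rpow_le_half_pow_iff {x t : ℝ} (hx : 0 < x) (k : ℕ) :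
    x ^ t ≤ (1 / 2 : ℝ) ^ k ↔ t * Real.log x ≤ -Real.log 2 * k := by
  rw [← Real.log_le_log_iff (by positivity) (by positivity), Real.log_pow, Real.log_rpow hx,
    one_div, Real.log_inv, mul_comm (k : ℝ)]

theorem IsAdmissible.dimH_cantorCircle (h : IsAdmissible a b lam eta xi n N) :
    dimH (cantorCircle a b n N) = ENNReal.ofReal (-Real.log 2 / Real.log a) := by
  have ha := h.log_a_neg
  have h2 := Real.log_pos one_lt_two
  have hα : 0 ≤ -Real.log 2 / Real.log a := (div_pos_of_neg_of_neg (by linarith) ha).le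
  rw [h.cantorCircle_eq]
  refine h.isCoding.dimH_range (α := (-Real.log 2 / Real.log a).toNNReal) (fun t ht => ?_)
    fun t ht => ?_
  · have ht' : -Real.log 2 / Real.log a < t := (Real.toNNReal_lt_iff_lt_coe hα).1 ht
    have ht0 : (0 : ℝ) < t := hα.trans_lt ht'
    have hc : Real.log a < -Real.log 2 / t := by
      rw [div_lt_iff_of_neg ha] at ht'
      rw [lt_div_iff₀ ht0]
      linarith
    refine (h.frequently_log_cantorLen_le hc).mono fun k hk => ?_
    rw [rpow_le_half_pow_iff (h.cantorLen_pos k)]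
    calc (t : ℝ) * Real.log (cantorLen a b n N k) ≤ t * (-Real.log 2 / t * k) := by gcongr
      _ = _ := by field_simp
  · have ht' : (t : ℝ) < -Real.log 2 / Real.log a := Real.lt_toNNReal_iff_coe_lt.1 ht
    rw [lt_div_iff_of_neg ha] at ht'
    refine ⟨1, fun k => ?_⟩
    rw [one_mul, half_pow_le_rpow_iff (h.cantorLen_pos k)]
    have h1 := h.le_log_cantorLen k
    calc -Real.log 2 * k ≤ (t * Real.log a) * k := by gcongr
      _ = t * (k * Real.log a) := by ring
      _ ≤ _ := by gcongr

theorem IsAdmissible.packingDim_cantorCircle (h : IsAdmissible a b lam eta xi n N) :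
    packingDim (cantorCircle a b n N) = ENNReal.ofReal (-Real.log 2 / Real.log b) := by
  have ha := h.log_b_neg
  have h2 := Real.log_pos one_lt_two
  have hα : 0 ≤ -Real.log 2 / Real.log b := (div_pos_of_neg_of_neg (by linarith) ha).le
  rw [h.cantorCircle_eq]
  refine h.isCoding.packingDim_range (β := (-Real.log 2 / Real.log b).toNNReal) (fun t ht => ?_)
    fun t ht => ?_
  · have ht' : -Real.log 2 / Real.log b < t := (Real.toNNReal_lt_iff_lt_coe hα).1 ht
    rw [div_lt_iff_of_neg ha] at ht'
    refine ⟨1, fun k => ?_⟩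
    rw [one_mul, rpow_le_half_pow_iff (h.cantorLen_pos k)]
    have h1 := h.log_cantorLen_le k
    calc (t : ℝ) * Real.log (cantorLen a b n N k) ≤ t * (k * Real.log b) := by gcongr
      _ = (t * Real.log b) * k := by ring
      _ ≤ _ := by gcongr
  · have ht' : (t : ℝ) < -Real.log 2 / Real.log b := Real.lt_toNNReal_iff_coe_lt.1 ht
    -- The slope −log 2 / t used below is meaningless for t = 0, where the estimate is trivial.
    rcases eq_or_ne t 0 with rfl | ht0
    · refine (Eventually.of_forall fun k => ?_).frequently
      rw [NNReal.coe_zero, Real.rpow_zero]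
      exact pow_le_one₀ (by norm_num) (by norm_num)
    have ht0 : (0 : ℝ) < t := by positivity
    have hc : -Real.log 2 / t < Real.log b := by
      rw [lt_div_iff_of_neg ha] at ht'
      rw [div_lt_iff₀ ht0]
      linarith
    refine (h.frequently_le_log_cantorLen hc).mono fun k hk => ?_
    rw [half_pow_le_rpow_iff (h.cantorLen_pos k)]
    calc -Real.log 2 * k = t * (-Real.log 2 / t * k) := by field_simp
      _ ≤ _ := by gcongr

end Cantor

/-! ### The radial profile -/

/-- A positive, continuous, decreasing function on `(0, ∞)` which decreases at most like the power
`lam > -1`. -/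
structure IsGauge (φ : ℝ → ℝ) (lam : ℝ) : Prop where
  lam_gt : -1 < lam
  lam_neg : lam < 0
  pos : ∀ t, 0 < t → 0 < φ t
  anti : ∀ s t, 0 < s → s ≤ t → φ t ≤ φ s
  growth : ∀ s t, 0 < s → s ≤ t → φ s ≤ φ t * (t / s) ^ (-lam)
  cont : ContinuousOn φ (Ioi 0)

section Profile

variable {a b lam eta xi : ℝ} {n N : ℕ → ℕ}

/-- The logarithmic scales at which the construction uses the ratio `b`. -/
def slopeSet (a b : ℝ) (n N : ℕ → ℕ) : Set ℝ :=
  ⋃ k ∈ {k | stepRatio a b n N k = b},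
    Ico (Real.log (cantorLen a b n N (k + 1))) (Real.log (cantorLen a b n N k))

open Classical in
/-- The logarithmic derivative of the profile in logarithmic coordinates. -/
noncomputable def profileSlope (a b lam eta : ℝ) (n N : ℕ → ℕ) (v : ℝ) : ℝ :=
  if v ∈ slopeSet a b n N then eta else lam

/-- The logarithm of the profile in logarithmic coordinates. -/
noncomputable def logProfile (a b lam eta : ℝ) (n N : ℕ → ℕ) (x : ℝ) : ℝ :=
  ∫ v in (0 : ℝ)..x, profileSlope a b lam eta n N v

/-- The radial profile. -/
noncomputable def profile (a b lam eta : ℝ) (n N : ℕ → ℕ) (t : ℝ) : ℝ :=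
  Real.exp (logProfile a b lam eta n N (Real.log t))

theorem measurableSet_slopeSet : MeasurableSet (slopeSet a b n N) :=
  MeasurableSet.biUnion (to_countable _) fun _ _ => measurableSet_Ico

theorem measurable_slope : Measurable (profileSlope a b lam eta n N) :=
  Measurable.ite measurableSet_slopeSet measurable_const measurable_const

theorem IsAdmissible.slope_mem (h : IsAdmissible a b lam eta xi n N) (v : ℝ) :
    profileSlope a b lam eta n N v ∈ Icc lam eta := by
  unfold profileSlope
  split_ifs
  · exact ⟨h.lam_lt_eta.le, le_rfl⟩
  · exact ⟨le_rfl, h.lam_lt_eta.le⟩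

theorem IsAdmissible.intervalIntegrable_slope (h : IsAdmissible a b lam eta xi n N) (x y : ℝ) :
    IntervalIntegrable (profileSlope a b lam eta n N) volume x y := by
  rw [intervalIntegrable_iff]
  refine Measure.integrableOn_of_bounded (M := |lam|) (by simp)
    measurable_slope.aestronglyMeasurable (Eventually.of_forall fun v => ?_)
  have := h.slope_mem v
  have := h.eta_neg
  rw [Real.norm_eq_abs, abs_of_neg (by linarith [(h.slope_mem v).2]),
    abs_of_neg (h.lam_lt_eta.trans h.eta_neg)]
  linarith [(h.slope_mem v).1]

theorem IsAdmissible.logProfile_sub (h : IsAdmissible a b lam eta xi n N) (x y : ℝ) :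
    logProfile a b lam eta n N y - logProfile a b lam eta n N x =
      ∫ v in x..y, profileSlope a b lam eta n N v :=
  intervalIntegral.integral_interval_sub_left (h.intervalIntegrable_slope _ _)
    (h.intervalIntegrable_slope _ _)

theorem IsAdmissible.le_logProfile_sub (h : IsAdmissible a b lam eta xi n N) {x y : ℝ}
    (hxy : x ≤ y) :
    lam * (y - x) ≤ logProfile a b lam eta n N y - logProfile a b lam eta n N x := by
  rw [h.logProfile_sub]
  have := intervalIntegral.integral_mono_on (f := fun _ => lam) hxy (by simp)
    (h.intervalIntegrable_slope x y) fun v _ => (h.slope_mem v).1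
  simpa [mul_comm] using this

theorem IsAdmissible.logProfile_sub_le (h : IsAdmissible a b lam eta xi n N) {x y : ℝ}
    (hxy : x ≤ y) :
    logProfile a b lam eta n N y - logProfile a b lam eta n N x ≤ eta * (y - x) := by
  rw [h.logProfile_sub]
  have := intervalIntegral.integral_mono_on (g := fun _ => eta) hxy
    (h.intervalIntegrable_slope x y) (by simp) fun v _ => (h.slope_mem v).2
  simpa [mul_comm] using this

theorem IsAdmissible.logProfile_sub_eq (h : IsAdmissible a b lam eta xi n N) {x y c : ℝ}
    (hxy : x ≤ y) (hc : ∀ v ∈ Ico x y, profileSlope a b lam eta n N v = c) :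
    logProfile a b lam eta n N y - logProfile a b lam eta n N x = c * (y - x) := by
  rw [h.logProfile_sub, intervalIntegral.integral_of_le hxy, ← integral_Ico_eq_integral_Ioc,
    setIntegral_congr_fun measurableSet_Ico hc]
  simp [hxy, mul_comm]

theorem IsAdmissible.continuous_logProfile (h : IsAdmissible a b lam eta xi n N) :
    Continuous (logProfile a b lam eta n N) :=
  intervalIntegral.continuous_primitive (fun x y => h.intervalIntegrable_slope x y) 0

/-- All properties come from the slopes in logarithmic coordinates: at most η < 0 gives
monotonicity, at least λ gives the growth bound. -/
theorem IsAdmissible.profile_gauge (h : IsAdmissible a b lam eta xi n N) :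
    IsGauge (profile a b lam eta n N) lam where
  lam_gt := h.lam_gt
  lam_neg := h.lam_lt_eta.trans h.eta_neg
  pos t _ := Real.exp_pos _
  anti s t hs hst := by
    refine Real.exp_le_exp.2 ?_
    have h1 := Real.log_le_log hs hst
    have := h.logProfile_sub_le h1
    nlinarith [h.eta_neg]
  growth s t hs hst := by
    have ht := hs.trans_le hst
    rw [Real.rpow_def_of_pos (div_pos ht hs), Real.log_div ht.ne' hs.ne', profile, profile,
      ← Real.exp_add]
    refine Real.exp_le_exp.2 ?_
    have := h.le_logProfile_sub (Real.log_le_log hs hst)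
    linarith
  cont := Real.continuous_exp.comp_continuousOn
    (h.continuous_logProfile.comp_continuousOn (Real.continuousOn_log.mono fun x hx => hx.ne'))

/-! ### Intervals of constant slope, and the values of the profile at the scales of the
construction. -/

theorem IsAdmissible.strictAnti_log (h : IsAdmissible a b lam eta xi n N) :
    StrictAnti fun k => Real.log (cantorLen a b n N k) := fun _ j hij =>
  Real.log_lt_log (h.cantorLen_pos j) (h.strictAnti_cantorLen hij)

theorem IsAdmissible.exists_level (h : IsAdmissible a b lam eta xi n N) {v : ℝ} (hv : v < 0) :
    ∃ k, v ∈ Ico (Real.log (cantorLen a b n N (k + 1))) (Real.log (cantorLen a b n N k)) := by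
  classical
  have hex : ∃ m, Real.log (cantorLen a b n N m) ≤ v := by
    obtain ⟨m, hm⟩ := (h.tendsto_cantorLen.eventually (gt_mem_nhds (Real.exp_pos v))).exists
    exact ⟨m, (Real.log_le_iff_le_exp (h.cantorLen_pos m)).2 hm.le⟩
  have hk := Nat.find_spec hex
  have hmin : ∀ j < Nat.find hex, v < _ := fun j hj => not_le.1 (Nat.find_min hex hj)
  obtain ⟨m, hm⟩ : ∃ m, Nat.find hex = m + 1 := by
    refine Nat.exists_eq_succ_of_ne_zero fun h0 => ?_
    rw [h0, cantorLen_zero, Real.log_one] at hk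
    linarith
  rw [hm] at hk hmin
  exact ⟨m, hk, hmin m (Nat.lt_succ_self m)⟩

theorem IsAdmissible.level_unique (h : IsAdmissible a b lam eta xi n N) {v : ℝ} {k m : ℕ}
    (hk : v ∈ Ico (Real.log (cantorLen a b n N (k + 1))) (Real.log (cantorLen a b n N k)))
    (hm : v ∈ Ico (Real.log (cantorLen a b n N (m + 1))) (Real.log (cantorLen a b n N m))) :
    k = m := by
  have h1 : m < k + 1 := h.strictAnti_log.lt_iff_gt.1 (hk.1.trans_lt hm.2)
  have h2 : k < m + 1 := h.strictAnti_log.lt_iff_gt.1 (hm.1.trans_lt hk.2)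
  omega

theorem IsAdmissible.slope_eq_eta {v : ℝ} {k : ℕ}
    (hk : v ∈ Ico (Real.log (cantorLen a b n N (k + 1))) (Real.log (cantorLen a b n N k)))
    (hq : stepRatio a b n N k = b) : profileSlope a b lam eta n N v = eta :=
  if_pos (mem_biUnion (x := k) hq hk)

theorem IsAdmissible.slope_eq_lam (h : IsAdmissible a b lam eta xi n N) {v : ℝ} {k : ℕ}
    (hk : v ∈ Ico (Real.log (cantorLen a b n N (k + 1))) (Real.log (cantorLen a b n N k)))
    (hq : stepRatio a b n N k = a) : profileSlope a b lam eta n N v = lam := by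
  refine if_neg fun hv => ?_
  obtain ⟨m, hm, hvm⟩ := mem_iUnion₂.1 hv
  rw [← h.level_unique hk hvm] at hm
  exact h.a_lt_b.ne (hq.symm.trans hm)

theorem IsAdmissible.slope_eq_lam_of_nonneg (h : IsAdmissible a b lam eta xi n N) {v : ℝ}
    (hv : 0 ≤ v) : profileSlope a b lam eta n N v = lam := by
  refine if_neg fun hv' => ?_
  obtain ⟨m, -, hvm⟩ := mem_iUnion₂.1 hv'
  have h1 := h.strictAnti_log.antitone (Nat.zero_le m)
  simp only [cantorLen_zero, Real.log_one] at h1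
  linarith [hvm.2]

theorem IsAdmissible.slope_eta_of_mem (h : IsAdmissible a b lam eta xi n N) {v : ℝ} {i : ℕ}
    (hv : v ∈ Ico (Real.log (cantorLen a b n N (N i))) (Real.log (cantorLen a b n N (n i)))) :
    profileSlope a b lam eta n N v = eta := by
  have h0 : v < 0 := by
    refine hv.2.trans_le ?_
    simpa [cantorLen_zero] using h.strictAnti_log.antitone (Nat.zero_le (n i))
  obtain ⟨k, hk⟩ := h.exists_level h0
  have h1 : n i < k + 1 := h.strictAnti_log.lt_iff_gt.1 (hk.1.trans_lt hv.2)
  have h2 : k < N i := h.strictAnti_log.lt_iff_gt.1 (hv.1.trans_lt hk.2)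
  exact IsAdmissible.slope_eq_eta hk (IsAdmissible.stepRatio_eq_b (i := i) (by omega) h2)

theorem IsAdmissible.slope_lam_of_mem (h : IsAdmissible a b lam eta xi n N) {v : ℝ} {i : ℕ}
    (hv : v ∈ Ico (Real.log (cantorLen a b n N (n (i + 1))))
      (Real.log (cantorLen a b n N (N i)))) :
    profileSlope a b lam eta n N v = lam := by
  have h0 : v < 0 := by
    refine hv.2.trans_le ?_
    simpa [cantorLen_zero] using h.strictAnti_log.antitone (Nat.zero_le (N i))
  obtain ⟨k, hk⟩ := h.exists_level h0
  have h1 : N i < k + 1 := h.strictAnti_log.lt_iff_gt.1 (hk.1.trans_lt hv.2)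
  have h2 : k < n (i + 1) := h.strictAnti_log.lt_iff_gt.1 (hv.1.trans_lt hk.2)
  exact h.slope_eq_lam hk (h.stepRatio_eq_a (i := i) (by omega) h2)

/-- One step adds (1 + λ) log a or (1 + η) log b to log ℓ_k + log φ(ℓ_k). Both numbers are log ξ. -/
theorem IsAdmissible.logProfile_log_cantorLen (h : IsAdmissible a b lam eta xi n N) (k : ℕ) :
    logProfile a b lam eta n N (Real.log (cantorLen a b n N k)) =
      k * Real.log xi - Real.log (cantorLen a b n N k) := by
  induction k with
  | zero => simp [cantorLen_zero, logProfile]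
  | succ k ih =>
    have hle := (h.strictAnti_log (Nat.lt_succ_self k)).le
    have hlog := h.log_cantorLen_succ k
    rcases stepRatio_eq_or a b n N k with hq | hq
    · have h1 := h.logProfile_sub_eq hle fun v hv => h.slope_eq_lam hv hq
      rw [hq] at hlog
      have := h.log_xi_eq
      push_cast
      simp only [Nat.succ_eq_add_one] at *
      rw [hlog] at h1 ⊢
      linarith
    · have h1 := h.logProfile_sub_eq hle fun v hv => IsAdmissible.slope_eq_eta (lam := lam) (eta := eta) hv hq
      rw [hq] at hlog
      have := h.log_xi_eq'
      push_cast
      simp only [Nat.succ_eq_add_one] at *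
      rw [hlog] at h1 ⊢
      linarith

theorem IsAdmissible.profile_cantorLen (h : IsAdmissible a b lam eta xi n N) (k : ℕ) :
    cantorLen a b n N k * profile a b lam eta n N (cantorLen a b n N k) = xi ^ k := by
  rw [profile, h.logProfile_log_cantorLen, Real.exp_sub, Real.exp_log (h.cantorLen_pos k),
    mul_comm (k : ℝ), Real.exp_mul, Real.exp_log h.xi_pos, Real.rpow_natCast,
    mul_div_cancel₀ _ (h.cantorLen_pos k).ne']

/-- Subtracting λ log t leaves a function that is constant on the λ-intervals and has slope η − λ on
the η-intervals [log R_{j+1}, log r_j]; the sum collects their lengths. -/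
theorem IsAdmissible.logProfile_log_bigRad (h : IsAdmissible a b lam eta xi n N) (k : ℕ) :
    logProfile a b lam eta n N (Real.log (bigRad a b n N (k + 1))) -
      lam * Real.log (bigRad a b n N (k + 1)) =
    (eta - lam) * (∑ j ∈ Finset.Icc 1 (k + 1), Real.log (bigRad a b n N j) -
      ∑ j ∈ Finset.range (k + 1), Real.log (smallRad a b n N j)) := by
  induction k with
  | zero =>
    simp [bigRad, smallRad, h.N_zero, h.n_zero, cantorLen_zero, logProfile]
  | succ k ih =>
    have h1 := h.logProfile_sub_eq
      (h.strictAnti_log.antitone (h.N_lt_n k).le) fun v hv => h.slope_lam_of_mem hv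
    have h2 := h.logProfile_sub_eq
      (h.strictAnti_log.antitone (h.n_lt_N k).le) fun v hv => h.slope_eta_of_mem hv
    rw [Finset.sum_Icc_succ_top (by omega), Finset.sum_range_succ]
    simp only [bigRad, smallRad, Nat.add_sub_cancel] at *
    linarith

theorem IsAdmissible.isProfile (h : IsAdmissible a b lam eta xi n N) :
    IsProfile a b lam eta n N (profile a b lam eta n N) := by
  have hR : ∀ j, 0 < bigRad a b n N j := fun j => h.cantorLen_pos _
  have hr : ∀ j, 0 < smallRad a b n N j := fun j => h.cantorLen_pos _
  have hlog : ∀ k m, Real.log ((∏ j ∈ Finset.Icc 1 k, bigRad a b n N j) /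
      ∏ j ∈ Finset.range m, smallRad a b n N j) =
      ∑ j ∈ Finset.Icc 1 k, Real.log (bigRad a b n N j) -
      ∑ j ∈ Finset.range m, Real.log (smallRad a b n N j) := by
    intro k m
    rw [Real.log_div (Finset.prod_pos fun j _ => hR j).ne' (Finset.prod_pos fun j _ => hr j).ne',
      Real.log_prod fun j _ => (hR j).ne', Real.log_prod fun j _ => (hr j).ne']
  have hpos : ∀ k m, 0 < (∏ j ∈ Finset.Icc 1 k, bigRad a b n N j) /
      ∏ j ∈ Finset.range m, smallRad a b n N j := fun k m =>
    div_pos (Finset.prod_pos fun j _ => hR j) (Finset.prod_pos fun j _ => hr j)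
  refine ⟨fun k hk t ht => ?_, fun k hk t ht => ?_, fun t ht => ?_⟩
  -- With k = i + 1 the endpoints r_k and R_k belong to the levels n_{i+1} and N_i, between which
  -- the ratio is a.
  · obtain ⟨i, rfl⟩ : ∃ i, k = i + 1 := ⟨k - 1, by omega⟩
    have ht0 : 0 < t := (hr _).trans_le ht.1
    have h1 := h.logProfile_sub_eq (Real.log_le_log ht0 ht.2) fun v hv =>
      h.slope_lam_of_mem (i := i) ⟨(Real.log_le_log (hr _) ht.1).trans hv.1, hv.2⟩
    have h2 := h.logProfile_log_bigRad i
    rw [profile, Real.rpow_def_of_pos (hpos _ _), Real.rpow_def_of_pos ht0, ← Real.exp_add, hlog]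
    congr 1
    linarith
  · obtain ⟨i, rfl⟩ : ∃ i, k = i + 1 := ⟨k - 1, by omega⟩
    have ht0 : 0 < t := (hR _).trans_le ht.1
    have h1 := h.logProfile_sub_eq (Real.log_le_log ht0 ht.2) fun v hv =>
      h.slope_eta_of_mem (i := i + 1) ⟨(Real.log_le_log (hR _) ht.1).trans hv.1, hv.2⟩
    have h2 := h.logProfile_log_bigRad i
    have h3 := h.logProfile_sub_eq
      (h.strictAnti_log.antitone (h.N_lt_n i).le) fun v hv => h.slope_lam_of_mem hv
    rw [profile, Real.rpow_def_of_pos (hpos _ _), Real.rpow_def_of_pos ht0, ← Real.exp_add, hlog,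
      Finset.sum_range_succ]
    congr 1
    simp only [bigRad, smallRad, Nat.add_sub_cancel] at *
    linarith
  · have h1 := h.logProfile_sub_eq (Real.log_nonneg ht) fun v hv => h.slope_eq_lam_of_nonneg hv.1
    rw [profile, Real.rpow_def_of_pos (by linarith)]
    congr 1
    have h0 : logProfile a b lam eta n N 0 = 0 := by simp [logProfile]
    linarith

end Profile

/-! ### The metric of a weight which is a gauge of the distance to a set -/

section Gauge

variable {φ : ℝ → ℝ} {lam : ℝ}

/-- Since −λ < 1 the power may be replaced by the ratio itself: t φ(t) is increasing. -/
theorem IsGauge.le_mul_div (hφ : IsGauge φ lam) {s t : ℝ} (hs : 0 < s) (hst : s ≤ t) :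
    φ s ≤ φ t * (t / s) := by
  have ht := hs.trans_le hst
  refine (hφ.growth s t hs hst).trans ?_
  refine mul_le_mul_of_nonneg_left ?_ (hφ.pos t ht).le
  have h1 : 1 ≤ t / s := (one_le_div hs).2 hst
  calc (t / s) ^ (-lam) ≤ (t / s) ^ (1 : ℝ) :=
        Real.rpow_le_rpow_of_exponent_le h1 (by linarith [hφ.lam_gt])
    _ = t / s := Real.rpow_one _

/-- Turns every comparison of distances up to a factor c into one of weights with the same factor.
-/
theorem IsGauge.le_const_mul (hφ : IsGauge φ lam) {s t c : ℝ} (hs : 0 < s) (ht : 0 < t)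
    (hc : 1 ≤ c) (h : t ≤ c * s) : φ s ≤ c * φ t := by
  have hp := hφ.pos t ht
  rcases le_total s t with hst | hst
  · refine (hφ.le_mul_div hs hst).trans ?_
    rw [mul_comm]
    gcongr
    rwa [div_le_iff₀ hs]
  · have := hφ.anti t s ht hst
    nlinarith

theorem IsGauge.mul_mono (hφ : IsGauge φ lam) {d d' e : ℝ} (hd : 0 < d) (hdd : d ≤ d')
    (he : 0 ≤ e) : d * φ (d + e) ≤ d' * φ (d' + e) := by
  have hp := hφ.pos (d' + e) (by linarith)
  calc d * φ (d + e) ≤ d * (φ (d' + e) * ((d' + e) / (d + e))) := by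
        gcongr
        exact hφ.le_mul_div (by linarith) (by linarith)
    _ = (d * (d' + e) / (d + e)) * φ (d' + e) := by ring
    _ ≤ d' * φ (d' + e) := by
        gcongr
        rw [div_le_iff₀ (by linarith)]
        nlinarith

/-- The weight `ρ` is the gauge `φ` of the distance to the closed subset `C` of the circle. -/
structure IsGaugeWeight (ρ : DiscWeight) (φ : ℝ → ℝ) (lam : ℝ) (C : Set ℂ) : Prop where
  gauge : IsGauge φ lam
  subset : C ⊆ Metric.sphere 0 1
  nonempty : C.Nonempty
  closed : IsClosed C
  eq : ∀ z ∈ Metric.ball (0 : ℂ) 1, ρ z = φ (Metric.infDist z C)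

theorem one_sub_norm_le_infDist {C : Set ℂ} (hC : C ⊆ Metric.sphere 0 1) (hne : C.Nonempty)
    (z : ℂ) : 1 - ‖z‖ ≤ Metric.infDist z C := by
  refine (Metric.le_infDist hne).2 fun y hy => ?_
  have h1 : ‖y‖ = 1 := by simpa using hC hy
  have h2 := norm_sub_norm_le y z
  rw [dist_comm, dist_eq_norm]
  linarith

/-- The weight given by a gauge. -/
noncomputable def gaugeWeight {φ : ℝ → ℝ} {lam : ℝ} (hφ : IsGauge φ lam) {C : Set ℂ}
    (hC : C ⊆ Metric.sphere 0 1) (hne : C.Nonempty) : DiscWeight where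
  toFun z := φ (Metric.infDist z C)
  continuousOn := by
    refine hφ.cont.comp (Metric.continuous_infDist_pt C).continuousOn fun z hz => ?_
    have : ‖z‖ < 1 := by simpa using hz
    exact (sub_pos.2 this).trans_le (one_sub_norm_le_infDist hC hne z)
  pos z hz := by
    have : ‖z‖ < 1 := by simpa using hz
    exact hφ.pos _ ((sub_pos.2 this).trans_le (one_sub_norm_le_infDist hC hne z))

/-! ### Two-sided comparison of d_ρ with the Euclidean distance. -/

theorem rhoEDist_le_segment (ρ : DiscWeight) {x y : ℂ} (hx : x ∈ Metric.ball (0 : ℂ) 1)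
    (hy : y ∈ Metric.ball (0 : ℂ) 1) :
    rhoEDist ρ x y ≤
      ∫⁻ t in Icc 0 ‖y - x‖, ENNReal.ofReal (ρ (x + (t * ‖y - x‖⁻¹) • (y - x))) := by
  rcases eq_or_ne x y with rfl | hne
  · refine (iInf_le_of_le _ (iInf_le_of_le _ (iInf_le_of_le (IsDiscCurve.const hx) ?_)))
    simp [rhoLength]
  have hL : 0 < ‖y - x‖ := norm_pos_iff.2 (sub_ne_zero.2 hne.symm)
  let u : ℂ := (‖y - x‖⁻¹ : ℝ) • (y - x)
  have hu : ‖u‖ = 1 := by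
    simp only [u, norm_smul, norm_inv, norm_norm]
    exact inv_mul_cancel₀ hL.ne'
  let γ : ℝ → ℂ := fun t => x + t • u
  have hiso : Isometry γ := by
    refine Isometry.of_dist_eq fun s t => ?_
    simp [γ, dist_eq_norm, ← sub_smul, norm_smul, hu, -Complex.real_smul]
  have hmem : ∀ t ∈ Icc 0 ‖y - x‖, γ t ∈ Metric.ball (0 : ℂ) 1 := by
    intro t ht
    refine (convex_ball (0 : ℂ) 1).segment_subset hx hy ?_
    rw [segment_eq_image']
    refine ⟨t * ‖y - x‖⁻¹, ⟨mul_nonneg ht.1 (inv_nonneg.2 hL.le), ?_⟩, ?_⟩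
    · rw [← div_eq_mul_inv]; exact (div_le_one hL).2 ht.2
    · simp only [γ, u, smul_smul]
  refine iInf_le_of_le γ (iInf_le_of_le ‖y - x‖ (iInf_le_of_le ⟨hL.le, ?_, hmem, ?_, ?_⟩ ?_))
  · rw [HasUnitSpeedOn, hasConstantSpeedOnWith_iff_ordered]
    intro s hs t ht hst
    have hIcc : Icc 0 ‖y - x‖ ∩ Icc s t = Icc s t :=
      inter_eq_right.2 (Icc_subset_Icc hs.1 ht.2)
    rw [hIcc]
    apply le_antisymm
    · have h1 := (hiso.lipschitz.lipschitzOnWith (s := univ)).comp_eVariationOn_le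
        (g := id) (s := Icc s t) (mapsTo_univ _ _)
      have h2 := (monotoneOn_id (s := Icc s t)).eVariationOn_eq (a := s) (b := t)
        ⟨le_rfl, hst⟩ ⟨hst, le_rfl⟩
      rw [inter_self] at h2
      rw [h2] at h1
      simpa using h1
    · have h1 := eVariationOn.edist_le γ (s := Icc s t) (x := t) (y := s) ⟨hst, le_rfl⟩ ⟨le_rfl, hst⟩
      rw [hiso.edist_eq, edist_dist, Real.dist_eq, abs_of_nonneg (by linarith)] at h1
      simpa using h1
  · simp [γ]
  · simp only [γ, u, smul_smul, mul_inv_cancel₀ hL.ne']; simp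
  · simp only [rhoLength, γ, u, smul_smul]
    exact le_rfl

theorem rhoEDist_le_of_forall_segment (ρ : DiscWeight) {x y : ℂ} (hx : x ∈ Metric.ball (0 : ℂ) 1)
    (hy : y ∈ Metric.ball (0 : ℂ) 1) {M : ℝ} (hM : ∀ z ∈ segment ℝ x y, ρ z ≤ M) :
    rhoEDist ρ x y ≤ ENNReal.ofReal (M * ‖y - x‖) := by
  refine (rhoEDist_le_segment ρ hx hy).trans ?_
  have hM0 : 0 ≤ M := (ρ.pos x hx).le.trans (hM x (left_mem_segment ℝ x y))
  calc ∫⁻ t in Icc 0 ‖y - x‖, ENNReal.ofReal (ρ (x + (t * ‖y - x‖⁻¹) • (y - x)))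
      ≤ ∫⁻ _ in Icc 0 ‖y - x‖, ENNReal.ofReal M := by
        refine setLIntegral_mono measurable_const fun t ht => ENNReal.ofReal_le_ofReal (hM _ ?_)
        rw [segment_eq_image']
        refine ⟨t * ‖y - x‖⁻¹, ⟨mul_nonneg ht.1 (inv_nonneg.2 (norm_nonneg _)), ?_⟩, rfl⟩
        rw [← div_eq_mul_inv]
        exact div_le_one_of_le₀ ht.2 (norm_nonneg _)
    _ = ENNReal.ofReal (M * ‖y - x‖) := by
        rw [setLIntegral_const, Real.volume_Icc, sub_zero, ENNReal.ofReal_mul hM0]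

namespace IsGaugeWeight

variable {ρ : DiscWeight} {C : Set ℂ}

theorem infDist_pos (hρ : IsGaugeWeight ρ φ lam C) {z : ℂ} (hz : z ∈ Metric.ball (0 : ℂ) 1) :
    0 < Metric.infDist z C := by
  have : ‖z‖ < 1 := by simpa using hz
  exact (sub_pos.2 this).trans_le (one_sub_norm_le_infDist hρ.subset hρ.nonempty z)

/-- A curve from x to y has length at least d = |x − y|. Its initial piece of length d stays within
d of x, hence within d + δ of C, where the decreasing φ is at least φ(d + δ). -/
theorem le_rhoEDist (hρ : IsGaugeWeight ρ φ lam C) {x y : ℂ} (hx : x ∈ Metric.ball (0 : ℂ) 1) :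
    ENNReal.ofReal (dist x y * φ (dist x y + Metric.infDist x C)) ≤ rhoEDist ρ x y := by
  refine le_iInf fun γ => le_iInf fun L => le_iInf fun h => ?_
  set d := dist x y with hd
  have hlip : ∀ t ∈ Icc 0 L, dist (γ t) x ≤ t := by
    intro t ht
    have h1 := h.unitSpeed (⟨le_rfl, h.len_nonneg⟩ : (0 : ℝ) ∈ Icc 0 L) ht
    have h2 := eVariationOn.edist_le γ (s := Icc 0 L ∩ Icc 0 t) (x := t) (y := 0)
      ⟨ht, ht.1, le_rfl⟩ ⟨⟨le_rfl, h.len_nonneg⟩, le_rfl, ht.1⟩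
    rw [h1, h.source, edist_dist] at h2
    simpa [ht.1] using (ENNReal.ofReal_le_ofReal_iff (by simpa using ht.1)).1 h2
  have hdL : d ≤ L := by
    have := hlip L ⟨h.len_nonneg, le_rfl⟩
    rwa [h.target, dist_comm] at this
  have hδ := hρ.infDist_pos hx
  have hφ0 : 0 ≤ φ (d + Metric.infDist x C) := (hρ.gauge.pos _ (by positivity)).le
  calc ENNReal.ofReal (d * φ (d + Metric.infDist x C))
      = ∫⁻ _ in Icc 0 d, ENNReal.ofReal (φ (d + Metric.infDist x C)) := by
        rw [setLIntegral_const, Real.volume_Icc, sub_zero, mul_comm, ENNReal.ofReal_mul hφ0]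
    _ ≤ ∫⁻ t in Icc 0 d, ENNReal.ofReal (ρ (γ t)) := by
        refine setLIntegral_mono' measurableSet_Icc fun t ht => ENNReal.ofReal_le_ofReal ?_
        have htL : t ∈ Icc 0 L := ⟨ht.1, ht.2.trans hdL⟩
        rw [hρ.eq _ (h.mem t htL)]
        refine hρ.gauge.anti _ _ (hρ.infDist_pos (h.mem t htL)) ?_
        have h3 := Metric.infDist_le_infDist_add_dist (s := C) (x := γ t) (y := x)
        linarith [hlip t htL, ht.2]
    _ ≤ rhoLength ρ γ L := lintegral_mono_set (Icc_subset_Icc_right hdL)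

/-- After inward motion by t the weight is at most a multiple of φ(T + δ) (T/t)^(−λ), and t^λ is
integrable at 0 because λ > −1. -/
theorem rhoEDist_radial_le (hρ : IsGaugeWeight ρ φ lam C) {x : ℂ}
    (hx : x ∈ Metric.ball (0 : ℂ) 1) {T : ℝ} (hT : 0 < T) (hT1 : T ≤ 1) :
    rhoEDist ρ x ((1 - T) • x) ≤
      ENNReal.ofReal (3 / (1 + lam) * (T * φ (T + Metric.infDist x C))) := by
  have hx1 : ‖x‖ < 1 := by simpa using hx
  have hl := hρ.gauge.lam_gt
  have hδ := hρ.infDist_pos hx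
  set δ := Metric.infDist x C with hδdef
  have hφT := hρ.gauge.pos (T + δ) (by positivity)
  have hy : (1 - T) • x ∈ Metric.ball (0 : ℂ) 1 := by
    rw [mem_ball_zero_iff, norm_smul, Real.norm_eq_abs, abs_of_nonneg (by linarith)]
    nlinarith [norm_nonneg x]
  have hsub : (1 - T) • x - x = (-T) • x := by rw [← sub_eq_zero]; module
  have hnorm : ‖(1 - T) • x - x‖ = T * ‖x‖ := by
    rw [hsub, norm_smul, Real.norm_eq_abs, abs_neg, abs_of_pos hT]
  refine (rhoEDist_le_segment ρ hx hy).trans ?_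
  rw [hnorm, setLIntegral_congr Ioc_ae_eq_Icc.symm]
  have hpt : ∀ t ∈ Ioc 0 (T * ‖x‖),
      ρ (x + (t * (T * ‖x‖)⁻¹) • ((1 - T) • x - x)) ≤
        3 * φ (T + δ) * T ^ (-lam) * t ^ lam := by
    intro t ht
    have hTx : 0 < T * ‖x‖ := ht.1.trans_le ht.2
    have hx0 : 0 < ‖x‖ := pos_of_mul_pos_right hTx hT.le
    have htT : t ≤ T := ht.2.trans (by nlinarith)
    have hz : x + (t * (T * ‖x‖)⁻¹) • ((1 - T) • x - x) = (1 - t / ‖x‖) • x := by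
      rw [hsub, smul_smul, show t * (T * ‖x‖)⁻¹ * -T = -(t / ‖x‖) by field_simp]
      module
    have hs1 : t / ‖x‖ ≤ 1 := by
      rw [div_le_one hx0]
      exact ht.2.trans (by nlinarith)
    have hs0 : 0 ≤ t / ‖x‖ := by have := ht.1; positivity
    have hzn : ‖(1 - t / ‖x‖) • x‖ = ‖x‖ - t := by
      rw [norm_smul, Real.norm_eq_abs, abs_of_nonneg (by linarith)]
      field_simp
    have hzb : (1 - t / ‖x‖) • x ∈ Metric.ball (0 : ℂ) 1 := by
      rw [mem_ball_zero_iff, hzn]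
      linarith [ht.1]
    rw [hz, hρ.eq _ hzb]
    have h1 := one_sub_norm_le_infDist hρ.subset hρ.nonempty ((1 - t / ‖x‖) • x)
    rw [hzn] at h1
    have h2 := Metric.infDist_le_infDist_add_dist (s := C) (x := x) (y := (1 - t / ‖x‖) • x)
    have h3 : dist x ((1 - t / ‖x‖) • x) = t := by
      rw [dist_eq_norm, show x - (1 - t / ‖x‖) • x = (t / ‖x‖) • x by module, norm_smul,
        Real.norm_eq_abs, abs_of_nonneg hs0]
      field_simp
    rw [h3, ← hδdef] at h2
    set z := (1 - t / ‖x‖) • x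
    have ht0 := ht.1
    -- The distance from z to C is at least t, by the distance to the circle, and at least δ − t.
    have h4 : (t + δ) ≤ 3 * Metric.infDist z C := by linarith
    have h5 : φ (Metric.infDist z C) ≤ 3 * φ (t + δ) :=
      hρ.gauge.le_const_mul (hρ.infDist_pos hzb) (by positivity) (by norm_num) h4
    refine h5.trans ?_
    rw [mul_assoc 3, mul_assoc 3, mul_assoc (φ (T + δ))]
    refine mul_le_mul_of_nonneg_left ?_ (by norm_num)
    refine (hρ.gauge.growth _ _ (by positivity) (by linarith : t + δ ≤ T + δ)).trans ?_
    refine mul_le_mul_of_nonneg_left ?_ hφT.le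
    have h6 : T ^ (-lam) * t ^ lam = (T / t) ^ (-lam) := by
      rw [Real.div_rpow hT.le ht0.le, Real.rpow_neg ht0.le, div_eq_mul_inv, inv_inv]
    rw [h6]
    refine Real.rpow_le_rpow (by positivity) ?_ (by linarith [hρ.gauge.lam_neg])
    rw [div_le_div_iff₀ (by positivity) ht0]
    nlinarith
  have hint : IntervalIntegrable (fun t : ℝ => 3 * φ (T + δ) * T ^ (-lam) * t ^ lam) volume 0 T :=
    (intervalIntegral.intervalIntegrable_rpow' hl).const_mul _
  have hcalc : ∫ t in (0 : ℝ)..T, 3 * φ (T + δ) * T ^ (-lam) * t ^ lam =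
      3 / (1 + lam) * (T * φ (T + δ)) := by
    rw [intervalIntegral.integral_const_mul, integral_rpow (Or.inl hl),
      Real.zero_rpow (by linarith), sub_zero, Real.rpow_add hT, Real.rpow_one, Real.rpow_neg hT.le]
    have : (0 : ℝ) < T ^ lam := by positivity
    have h1 : 0 < 1 + lam := by linarith
    have h2 : 0 < lam + 1 := by linarith
    field_simp
    ring
  calc ∫⁻ t in Ioc 0 (T * ‖x‖), ENNReal.ofReal
        (ρ (x + (t * (T * ‖x‖)⁻¹) • ((1 - T) • x - x)))
      ≤ ∫⁻ t in Ioc 0 (T * ‖x‖), ENNReal.ofReal (3 * φ (T + δ) * T ^ (-lam) * t ^ lam) :=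
        setLIntegral_mono' measurableSet_Ioc fun t ht => ENNReal.ofReal_le_ofReal (hpt t ht)
    _ ≤ ∫⁻ t in Ioc 0 T, ENNReal.ofReal (3 * φ (T + δ) * T ^ (-lam) * t ^ lam) :=
        lintegral_mono_set (Ioc_subset_Ioc_right (by nlinarith))
    _ = _ := by
        rw [← hcalc, intervalIntegral.integral_of_le hT.le, ofReal_integral_eq_lintegral_ofReal]
        · exact (intervalIntegrable_iff_integrableOn_Ioc_of_le hT.le).1 hint
        · refine (ae_restrict_iff' measurableSet_Ioc).2 (Eventually.of_forall fun t ht => ?_)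
          have := ht.1
          positivity

end IsGaugeWeight

/-- The constant in the upper estimate of the metric. -/
noncomputable def metricConst (lam : ℝ) : ℝ := 3 * (3 / (1 + lam)) + 6

theorem IsGauge.metricConst_pos (hφ : IsGauge φ lam) : 1 ≤ metricConst lam := by
  have : 0 < 3 / (1 + lam) := div_pos (by norm_num) (by linarith [hφ.lam_gt])
  unfold metricConst
  linarith

namespace IsGaugeWeight

variable {ρ : DiscWeight} {C : Set ℂ}

theorem rhoEDist_triangle {x y z : ℂ} (hx : x ∈ Metric.ball (0 : ℂ) 1)
    (hy : y ∈ Metric.ball (0 : ℂ) 1) (hz : z ∈ Metric.ball (0 : ℂ) 1) :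
    rhoEDist ρ x z ≤ rhoEDist ρ x y + rhoEDist ρ y z :=
  edist_triangle (⟨x, hx⟩ : RhoDisc ρ) ⟨y, hy⟩ ⟨z, hz⟩

theorem rhoEDist_comm {x y : ℂ} (hx : x ∈ Metric.ball (0 : ℂ) 1)
    (hy : y ∈ Metric.ball (0 : ℂ) 1) : rhoEDist ρ x y = rhoEDist ρ y x :=
  edist_comm (⟨x, hx⟩ : RhoDisc ρ) ⟨y, hy⟩

/-- Both endpoints are contracted by the factor 1 − d/2 and joined by a segment, which stays at
distance at least d/2 from the circle. The choice d/2 is admissible since d < 2. -/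
theorem rhoEDist_le (hρ : IsGaugeWeight ρ φ lam C) {x y : ℂ} (hx : x ∈ Metric.ball (0 : ℂ) 1)
    (hy : y ∈ Metric.ball (0 : ℂ) 1) :
    rhoEDist ρ x y ≤
      ENNReal.ofReal (metricConst lam * (dist x y * φ (dist x y + Metric.infDist x C))) := by
  rcases eq_or_ne x y with rfl | hne
  · exact (edist_self (⟨x, hx⟩ : RhoDisc ρ)).le.trans bot_le
  have hx1 : ‖x‖ < 1 := by simpa using hx
  have hy1 : ‖y‖ < 1 := by simpa using hy
  have hd : 0 < dist x y := dist_pos.2 hne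
  have hd2 : dist x y < 2 := by
    rw [dist_eq_norm]
    exact (norm_sub_le _ _).trans_lt (by linarith)
  set d := dist x y with hddef
  have hδ := hρ.infDist_pos hx
  have hδy := hρ.infDist_pos hy
  set δ := Metric.infDist x C with hδdef
  have hT : 0 < d / 2 := by positivity
  have hT1 : d / 2 ≤ 1 := by linarith
  have hK : 0 < 3 / (1 + lam) := div_pos (by norm_num) (by linarith [hρ.gauge.lam_gt])
  have hφd := hρ.gauge.pos (d + δ) (by positivity)
  have hball : ∀ z ∈ Metric.ball (0 : ℂ) 1, (1 - d / 2) • z ∈ Metric.ball (0 : ℂ) 1 := by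
    intro z hz
    have hz1 : ‖z‖ < 1 := by simpa using hz
    rw [mem_ball_zero_iff, norm_smul, Real.norm_eq_abs, abs_of_nonneg (by linarith)]
    nlinarith [norm_nonneg z]
  have hyx := Metric.infDist_le_infDist_add_dist (s := C) (x := x) (y := y)
  rw [← hδdef, ← hddef] at hyx
  have e1 : rhoEDist ρ x ((1 - d / 2) • x) ≤
      ENNReal.ofReal (3 / (1 + lam) * (d * φ (d + δ))) := by
    refine (hρ.rhoEDist_radial_le hx hT hT1).trans (ENNReal.ofReal_le_ofReal ?_)
    have := hρ.gauge.mul_mono hT (by linarith : d / 2 ≤ d) hδ.le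
    gcongr
  have e3 : rhoEDist ρ ((1 - d / 2) • y) y ≤
      ENNReal.ofReal (2 * (3 / (1 + lam)) * (d * φ (d + δ))) := by
    rw [rhoEDist_comm (hball y hy) hy]
    refine (hρ.rhoEDist_radial_le hy hT hT1).trans (ENNReal.ofReal_le_ofReal ?_)
    -- From δ ≤ δ_y + d, with δ_y the distance from y to C: d + δ ≤ 2d + δ_y ≤ 4 (d/2 + δ_y).
    have h4 : φ (d / 2 + Metric.infDist y C) ≤ 4 * φ (d + δ) :=
      hρ.gauge.le_const_mul (by positivity) (by positivity) (by norm_num) (by linarith)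
    calc 3 / (1 + lam) * (d / 2 * φ (d / 2 + Metric.infDist y C))
        ≤ 3 / (1 + lam) * (d / 2 * (4 * φ (d + δ))) := by gcongr
      _ = _ := by ring
  have e2 : rhoEDist ρ ((1 - d / 2) • x) ((1 - d / 2) • y) ≤
      ENNReal.ofReal (6 * (d * φ (d + δ))) := by
    refine (rhoEDist_le_of_forall_segment ρ (M := 6 * φ (d + δ)) (hball x hx) (hball y hy)
      fun z hz => ?_).trans (ENNReal.ofReal_le_ofReal ?_)
    · have hzT : z ∈ Metric.closedBall (0 : ℂ) (1 - d / 2) := by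
        refine (convex_closedBall (0 : ℂ) (1 - d / 2)).segment_subset ?_ ?_ hz
        all_goals
          rw [mem_closedBall_zero_iff, norm_smul, Real.norm_eq_abs, abs_of_nonneg (by linarith)]
          nlinarith
      have hzn : ‖z‖ ≤ 1 - d / 2 := by simpa using hzT
      have hzb : z ∈ Metric.ball (0 : ℂ) 1 := by
        rw [mem_ball_zero_iff]; linarith
      have hzx : z ∈ Metric.closedBall x (3 / 2 * d) := by
        have hxx : dist ((1 - d / 2) • x) x ≤ d / 2 := by
          rw [dist_eq_norm, show (1 - d / 2) • x - x = (-(d / 2)) • x by module, norm_smul,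
            Real.norm_eq_abs, abs_neg, abs_of_pos hT]
          nlinarith
        refine (convex_closedBall x (3 / 2 * d)).segment_subset ?_ ?_ hz
        · rw [Metric.mem_closedBall]; linarith
        · rw [Metric.mem_closedBall]
          have hyx2 : dist ((1 - d / 2) • y) ((1 - d / 2) • x) ≤ d := by
            rw [dist_eq_norm, ← smul_sub, norm_smul, Real.norm_eq_abs,
              abs_of_nonneg (by linarith), ← dist_eq_norm, dist_comm, ← hddef]
            nlinarith
          have := dist_triangle ((1 - d / 2) • y) ((1 - d / 2) • x) x
          linarith
      have h1 := one_sub_norm_le_infDist hρ.subset hρ.nonempty z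
      have h2 := Metric.infDist_le_infDist_add_dist (s := C) (x := x) (y := z)
      rw [dist_comm, ← hδdef] at h2
      have h3 := Metric.mem_closedBall.1 hzx
      rw [hρ.eq z hzb]
      -- The segment stays within 3d/2 of x, so d + δ is at most 5d/2 plus the distance of z to C;
      -- that distance is at least d/2, whence the factor 6.
      exact hρ.gauge.le_const_mul (hρ.infDist_pos hzb) (by positivity) (by norm_num) (by linarith)
    · have : ‖(1 - d / 2) • y - (1 - d / 2) • x‖ ≤ d := by
        rw [← smul_sub, norm_smul, Real.norm_eq_abs, abs_of_nonneg (by linarith), ← dist_eq_norm,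
          dist_comm, ← hddef]
        nlinarith
      nlinarith
  calc rhoEDist ρ x y
      ≤ rhoEDist ρ x ((1 - d / 2) • x) + rhoEDist ρ ((1 - d / 2) • x) ((1 - d / 2) • y) +
        rhoEDist ρ ((1 - d / 2) • y) y := by
        refine (rhoEDist_triangle hx (hball y hy) hy).trans ?_
        gcongr
        exact rhoEDist_triangle hx (hball x hx) (hball y hy)
    _ ≤ ENNReal.ofReal (3 / (1 + lam) * (d * φ (d + δ))) +
        ENNReal.ofReal (6 * (d * φ (d + δ))) +
        ENNReal.ofReal (2 * (3 / (1 + lam)) * (d * φ (d + δ))) :=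
        add_le_add (add_le_add e1 e2) e3
    _ = _ := by
        rw [← ENNReal.ofReal_add (by positivity) (by positivity),
          ← ENNReal.ofReal_add (by positivity) (by positivity), metricConst]
        congr 1
        ring

theorem le_dist (hρ : IsGaugeWeight ρ φ lam C) (X Y : RhoDisc ρ) :
    dist X.pt Y.pt * φ (dist X.pt Y.pt + Metric.infDist X.pt C) ≤ dist X Y := by
  have h := hρ.le_rhoEDist (y := Y.pt) X.mem
  rw [show rhoEDist ρ X.pt Y.pt = edist X Y from rfl, edist_dist] at h
  exact (ENNReal.ofReal_le_ofReal_iff dist_nonneg).1 h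

theorem dist_le (hρ : IsGaugeWeight ρ φ lam C) (X Y : RhoDisc ρ) :
    dist X Y ≤
      metricConst lam * (dist X.pt Y.pt * φ (dist X.pt Y.pt + Metric.infDist X.pt C)) := by
  have h := hρ.rhoEDist_le X.mem Y.mem
  rw [show rhoEDist ρ X.pt Y.pt = edist X Y from rfl, edist_dist] at h
  refine (ENNReal.ofReal_le_ofReal_iff ?_).1 h
  have h1 := hρ.gauge.metricConst_pos
  have h2 := hρ.infDist_pos X.mem
  have := hρ.gauge.pos (dist X.pt Y.pt + Metric.infDist X.pt C) (by positivity)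
  positivity

end IsGaugeWeight

end Gauge

/-! ### The boundary of a gauge weight -/

/-- The extension of the identity of the disc to the `d_ρ`-completion. -/
noncomputable def rhoEval (ρ : DiscWeight) : RhoClosure ρ → ℂ :=
  UniformSpace.Completion.extension RhoDisc.pt

theorem exists_seq_tendsto_rhoClosure (ρ : DiscWeight) (p : RhoClosure ρ) :
    ∃ x : ℕ → RhoDisc ρ, Tendsto (fun i => (x i : RhoClosure ρ)) atTop (𝓝 p) := by
  have hp : p ∈ closure (range ((↑) : RhoDisc ρ → RhoClosure ρ)) :=
    UniformSpace.Completion.denseRange_coe p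
  obtain ⟨u, hu, hlim⟩ := mem_closure_iff_seq_limit.1 hp
  choose x hx using hu
  exact ⟨x, by simpa only [hx] using hlim⟩

/-- For d ≤ 1 one has d φ(d + e) ≤ φ(1) d^(1+λ), uniformly in e, and 1 + λ > 0. -/
theorem IsGauge.exists_modulus {φ : ℝ → ℝ} {lam : ℝ} (hφ : IsGauge φ lam) {ε : ℝ} (hε : 0 < ε) :
    ∃ η > 0, ∀ d e : ℝ, 0 < d → d < η → 0 ≤ e → metricConst lam * (d * φ (d + e)) < ε := by
  have hl : 0 < 1 + lam := by linarith [hφ.lam_gt]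
  have hcont : Tendsto (fun d : ℝ => metricConst lam * (φ 1 * d ^ (1 + lam))) (𝓝 0) (𝓝 0) := by
    have h1 : Continuous fun d : ℝ => metricConst lam * (φ 1 * d ^ (1 + lam)) :=
      continuous_const.mul (continuous_const.mul (Real.continuous_rpow_const hl.le))
    have := h1.tendsto 0
    rwa [Real.zero_rpow hl.ne', mul_zero, mul_zero] at this
  obtain ⟨η, hη, hball⟩ := Metric.eventually_nhds_iff.1 (hcont.eventually (gt_mem_nhds hε))
  refine ⟨min η 1, lt_min hη one_pos, fun d e h0 h he => ?_⟩
  refine lt_of_le_of_lt ?_ (hball (y := d) ?_)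
  · have hB := hφ.metricConst_pos
    have h2 : φ (d + e) ≤ φ d := hφ.anti _ _ h0 (by linarith)
    have h3 := hφ.growth d 1 h0 (h.le.trans (min_le_right _ _))
    rw [one_div, Real.inv_rpow h0.le, Real.rpow_neg h0.le, inv_inv] at h3
    have h4 : d * φ (d + e) ≤ φ 1 * d ^ (1 + lam) := by
      rw [Real.rpow_add h0, Real.rpow_one]
      calc d * φ (d + e) ≤ d * (φ 1 * d ^ lam) := by
            gcongr
            exact h2.trans h3
        _ = _ := by ring
    gcongr
  · rw [Real.dist_eq, sub_zero, abs_of_pos h0]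
    exact h.trans_le (min_le_left _ _)

namespace IsGaugeWeight

variable {φ : ℝ → ℝ} {lam : ℝ} {ρ : DiscWeight} {C : Set ℂ}

theorem infDist_le_two (hρ : IsGaugeWeight ρ φ lam C) {z : ℂ} (hz : ‖z‖ ≤ 1) :
    Metric.infDist z C ≤ 2 := by
  obtain ⟨c, hc⟩ := hρ.nonempty
  have h1 : ‖c‖ = 1 := by simpa using hρ.subset hc
  refine (Metric.infDist_le_dist_of_mem hc).trans ?_
  rw [dist_eq_norm]
  exact (norm_sub_le _ _).trans (by linarith)

/-- Mutual distances and distances to C are at most 2, so φ(4) bounds the weight factor from below.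
Hence the identity from d_ρ to the Euclidean metric is Lipschitz. -/
theorem dist_pt_mul_le (hρ : IsGaugeWeight ρ φ lam C) (X Y : RhoDisc ρ) :
    dist X.pt Y.pt * φ 4 ≤ dist X Y := by
  refine le_trans ?_ (hρ.le_dist X Y)
  have hX : ‖X.pt‖ < 1 := by simpa using X.mem
  have hY : ‖Y.pt‖ < 1 := by simpa using Y.mem
  have h1 := hρ.infDist_pos X.mem
  have h2 := hρ.infDist_le_two hX.le
  have h3 : dist X.pt Y.pt ≤ 2 := by
    rw [dist_eq_norm]
    exact (norm_sub_le _ _).trans (by linarith)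
  gcongr
  exact hρ.gauge.anti _ _ (by positivity) (by linarith)

theorem uniformContinuous_pt (hρ : IsGaugeWeight ρ φ lam C) :
    UniformContinuous (RhoDisc.pt : RhoDisc ρ → ℂ) := by
  have h4 := hρ.gauge.pos 4 (by norm_num)
  refine Metric.uniformContinuous_iff.2 fun ε hε => ⟨ε * φ 4, by positivity, fun {X Y} h => ?_⟩
  exact lt_of_mul_lt_mul_right ((hρ.dist_pt_mul_le X Y).trans_lt h) h4.le

theorem rhoEval_coe (hρ : IsGaugeWeight ρ φ lam C) (X : RhoDisc ρ) :
    rhoEval ρ (X : RhoClosure ρ) = X.pt :=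
  UniformSpace.Completion.extension_coe hρ.uniformContinuous_pt X

theorem continuous_rhoEval : Continuous (rhoEval ρ) :=
  UniformSpace.Completion.continuous_extension

theorem exists_modulus (hρ : IsGaugeWeight ρ φ lam C) {ε : ℝ} (hε : 0 < ε) :
    ∃ η > 0, ∀ X Y : RhoDisc ρ, dist X.pt Y.pt < η → dist X Y < ε := by
  obtain ⟨η, hη, h⟩ := hρ.gauge.exists_modulus hε
  refine ⟨η, hη, fun X Y hXY => (hρ.dist_le X Y).trans_lt ?_⟩
  rcases eq_or_lt_of_le (dist_nonneg (x := X.pt) (y := Y.pt)) with h0 | h0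
  · rw [← h0]; simpa using hε
  · exact h _ _ h0 hXY Metric.infDist_nonneg

theorem exists_tendsto_of_tendsto_pt (hρ : IsGaugeWeight ρ φ lam C) {x : ℕ → RhoDisc ρ} {q : ℂ}
    (hx : Tendsto (fun i => (x i).pt) atTop (𝓝 q)) :
    ∃ p : RhoClosure ρ, Tendsto (fun i => (x i : RhoClosure ρ)) atTop (𝓝 p) := by
  refine cauchySeq_tendsto_of_complete (Metric.cauchySeq_iff.2 fun ε hε => ?_)
  obtain ⟨η, hη, h⟩ := hρ.exists_modulus hε
  obtain ⟨M, hM⟩ := Metric.cauchySeq_iff.1 hx.cauchySeq η hη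
  refine ⟨M, fun i hi j hj => ?_⟩
  rw [UniformSpace.Completion.dist_eq]
  exact h _ _ (hM i hi j hj)

theorem tendsto_pt (hρ : IsGaugeWeight ρ φ lam C) {x : ℕ → RhoDisc ρ} {p : RhoClosure ρ}
    (hx : Tendsto (fun i => (x i : RhoClosure ρ)) atTop (𝓝 p)) :
    Tendsto (fun i => (x i).pt) atTop (𝓝 (rhoEval ρ p)) := by
  have := (continuous_rhoEval.tendsto p).comp hx
  simpa only [Function.comp_def, hρ.rhoEval_coe] using this

theorem norm_rhoEval_le (hρ : IsGaugeWeight ρ φ lam C) (p : RhoClosure ρ) :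
    ‖rhoEval ρ p‖ ≤ 1 := by
  obtain ⟨x, hx⟩ := exists_seq_tendsto_rhoClosure ρ p
  refine le_of_tendsto (hρ.tendsto_pt hx).norm (Eventually.of_forall fun i => ?_)
  have : ‖(x i).pt‖ < 1 := by simpa using (x i).mem
  exact this.le

/-- The Euclidean metric also controls d_ρ, by a uniform modulus up to the boundary; sequences that
merge in the plane merge in the completion. -/
theorem rhoEval_injective (hρ : IsGaugeWeight ρ φ lam C) : Function.Injective (rhoEval ρ) := by
  intro p q hpq
  obtain ⟨x, hx⟩ := exists_seq_tendsto_rhoClosure ρ p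
  obtain ⟨y, hy⟩ := exists_seq_tendsto_rhoClosure ρ q
  have h1 : Tendsto (fun i => dist (x i).pt (y i).pt) atTop (𝓝 0) := by
    have := (hρ.tendsto_pt hx).dist (hρ.tendsto_pt hy)
    rwa [hpq, dist_self] at this
  have h2 : Tendsto (fun i => dist (x i) (y i)) atTop (𝓝 0) := by
    refine Metric.tendsto_nhds.2 fun ε hε => ?_
    obtain ⟨η, hη, h⟩ := hρ.exists_modulus hε
    filter_upwards [h1.eventually (gt_mem_nhds hη)] with i hi
    rw [Real.dist_eq, sub_zero, abs_of_nonneg dist_nonneg]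
    exact h _ _ hi
  have h3 : Tendsto (fun i => dist (x i : RhoClosure ρ) (y i)) atTop (𝓝 (dist p q)) := hx.dist hy
  simp only [UniformSpace.Completion.dist_eq] at h3
  exact dist_eq_zero.1 (tendsto_nhds_unique h3 h2)

theorem exists_rhoEval_eq (hρ : IsGaugeWeight ρ φ lam C) {q : ℂ} (hq : ‖q‖ ≤ 1) :
    ∃ p, rhoEval ρ p = q := by
  let r : ℕ → ℝ := fun i => 1 - 1 / ((i : ℝ) + 1)
  have hr : ∀ i, 0 ≤ r i ∧ r i < 1 := by
    intro i
    have h1 : (0 : ℝ) < 1 / ((i : ℝ) + 1) := by positivity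
    have h2 : 1 / ((i : ℝ) + 1) ≤ 1 := by
      rw [div_le_one (by positivity)]
      linarith [Nat.cast_nonneg (α := ℝ) i]
    exact ⟨by simp only [r]; linarith, by simp only [r]; linarith⟩
  have hmem : ∀ i, r i • q ∈ Metric.ball (0 : ℂ) 1 := by
    intro i
    rw [mem_ball_zero_iff, norm_smul, Real.norm_eq_abs, abs_of_nonneg (hr i).1]
    nlinarith [(hr i).1, (hr i).2, norm_nonneg q]
  let x : ℕ → RhoDisc ρ := fun i => ⟨r i • q, hmem i⟩
  have hx : Tendsto (fun i => (x i).pt) atTop (𝓝 q) := by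
    have h1 : Tendsto r atTop (𝓝 1) := by
      have := (tendsto_one_div_add_atTop_nhds_zero_nat (𝕜 := ℝ)).const_sub 1
      rwa [sub_zero] at this
    have := h1.smul_const q
    rwa [one_smul] at this
  obtain ⟨p, hp⟩ := hρ.exists_tendsto_of_tendsto_pt hx
  exact ⟨p, tendsto_nhds_unique (hρ.tendsto_pt hp) hx⟩

theorem corresponds_iff (hρ : IsGaugeWeight ρ φ lam C) {p : RhoClosure ρ} {q : ℂ} :
    Corresponds ρ p q ↔ rhoEval ρ p = q := by
  constructor
  · rintro ⟨x, hx, hq⟩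
    exact tendsto_nhds_unique (hρ.tendsto_pt hx) hq
  · rintro rfl
    obtain ⟨x, hx⟩ := exists_seq_tendsto_rhoClosure ρ p
    exact ⟨x, hx, hρ.tendsto_pt hx⟩

theorem mem_rhoBoundary_iff (hρ : IsGaugeWeight ρ φ lam C) {p : RhoClosure ρ} :
    p ∈ rhoBoundary ρ ↔ ‖rhoEval ρ p‖ = 1 := by
  constructor
  · intro hp
    refine le_antisymm (hρ.norm_rhoEval_le p) (not_lt.1 fun hlt => hp ?_)
    refine ⟨⟨rhoEval ρ p, by simpa using hlt⟩, hρ.rhoEval_injective ?_⟩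
    rw [hρ.rhoEval_coe]
  · rintro hp ⟨X, rfl⟩
    have : ‖X.pt‖ < 1 := by simpa using X.mem
    rw [hρ.rhoEval_coe] at hp
    linarith

/-- A sequence convergent in the plane is d_ρ-Cauchy, so it converges in the completion and can
accumulate only at its limit. -/
theorem isDensity (hρ : IsGaugeWeight ρ φ lam C) : IsDensity ρ where
  tendsto_euclidean x := fun ⟨p, hp⟩ => ⟨rhoEval ρ p, hρ.tendsto_pt hp⟩
  unique_accumulation x := by
    rintro ⟨q, hq⟩ p - p' - hp hp'
    obtain ⟨p₀, hp₀⟩ := hρ.exists_tendsto_of_tendsto_pt hq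
    have key : ∀ p, MapClusterPt p atTop (fun i => (x i : RhoClosure ρ)) → p = p₀ := by
      intro p hp
      by_contra hpp
      obtain ⟨U, V, hU, hV, hpU, hpV, hUV⟩ := t2_separation hpp
      have h1 := hp.frequently (hU.mem_nhds hpU)
      obtain ⟨i, hi, hi'⟩ := (h1.and_eventually (hp₀.eventually (hV.mem_nhds hpV))).exists
      exact disjoint_left.1 hUV hi hi'
    rw [key p hp, key p' hp']
  boundary_nonempty := by
    obtain ⟨p, hp⟩ := hρ.exists_rhoEval_eq (q := 1) (by simp)
    exact ⟨p, hρ.mem_rhoBoundary_iff.2 (by simp [hp])⟩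

theorem existsUnique_corresponds (hρ : IsGaugeWeight ρ φ lam C) {q : ℂ}
    (hq : q ∈ Metric.sphere (0 : ℂ) 1) : ∃! p, p ∈ rhoBoundary ρ ∧ Corresponds ρ p q := by
  have hq1 : ‖q‖ = 1 := by simpa using hq
  obtain ⟨p, hp⟩ := hρ.exists_rhoEval_eq hq1.le
  refine ⟨p, ⟨hρ.mem_rhoBoundary_iff.2 (by rw [hp, hq1]), hρ.corresponds_iff.2 hp⟩, ?_⟩
  rintro p' ⟨-, hp'⟩
  exact hρ.rhoEval_injective ((hρ.corresponds_iff.1 hp').trans hp.symm)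

theorem mem_rhoTrace_iff (hρ : IsGaugeWeight ρ φ lam C) {A : Set ℂ}
    (hA : A ⊆ Metric.sphere 0 1) {p : RhoClosure ρ} : p ∈ rhoTrace ρ A ↔ rhoEval ρ p ∈ A := by
  constructor
  · rintro ⟨-, q, hq, hpq⟩
    rwa [hρ.corresponds_iff.1 hpq]
  · intro h
    exact ⟨hρ.mem_rhoBoundary_iff.2 (by simpa using hA h), _, h, hρ.corresponds_iff.2 rfl⟩

theorem rhoTrace_sphere (hρ : IsGaugeWeight ρ φ lam C) :
    rhoTrace ρ (Metric.sphere 0 1) = rhoBoundary ρ := by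
  ext p
  rw [hρ.mem_rhoTrace_iff Subset.rfl, hρ.mem_rhoBoundary_iff, mem_sphere_zero_iff_norm]

/-- The two-sided estimate of the metric on the completion, in the limit. -/
theorem dist_bounds (hρ : IsGaugeWeight ρ φ lam C) {p q : RhoClosure ρ}
    (hpq : rhoEval ρ p ≠ rhoEval ρ q) :
    dist (rhoEval ρ p) (rhoEval ρ q) *
        φ (dist (rhoEval ρ p) (rhoEval ρ q) + Metric.infDist (rhoEval ρ p) C) ≤ dist p q ∧
      dist p q ≤ metricConst lam * (dist (rhoEval ρ p) (rhoEval ρ q) *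
        φ (dist (rhoEval ρ p) (rhoEval ρ q) + Metric.infDist (rhoEval ρ p) C)) := by
  obtain ⟨x, hx⟩ := exists_seq_tendsto_rhoClosure ρ p
  obtain ⟨y, hy⟩ := exists_seq_tendsto_rhoClosure ρ q
  have h1 : Tendsto (fun i => dist (x i).pt (y i).pt) atTop
      (𝓝 (dist (rhoEval ρ p) (rhoEval ρ q))) := (hρ.tendsto_pt hx).dist (hρ.tendsto_pt hy)
  have h2 : Tendsto (fun i => Metric.infDist (x i).pt C) atTop
      (𝓝 (Metric.infDist (rhoEval ρ p) C)) :=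
    ((Metric.continuous_infDist_pt C).tendsto _).comp (hρ.tendsto_pt hx)
  have h3 : Tendsto (fun i => dist (x i) (y i)) atTop (𝓝 (dist p q)) := by
    have : Tendsto (fun i => dist (x i : RhoClosure ρ) (y i)) atTop (𝓝 (dist p q)) := hx.dist hy
    simpa only [UniformSpace.Completion.dist_eq] using this
  have hpos : 0 < dist (rhoEval ρ p) (rhoEval ρ q) + Metric.infDist (rhoEval ρ p) C :=
    add_pos_of_pos_of_nonneg (dist_pos.2 hpq) Metric.infDist_nonneg
  have h4 : Tendsto (fun i => dist (x i).pt (y i).pt *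
      φ (dist (x i).pt (y i).pt + Metric.infDist (x i).pt C)) atTop
      (𝓝 (dist (rhoEval ρ p) (rhoEval ρ q) *
        φ (dist (rhoEval ρ p) (rhoEval ρ q) + Metric.infDist (rhoEval ρ p) C))) := by
    refine h1.mul (Tendsto.comp (g := φ) ?_ (h1.add h2))
    exact (hρ.gauge.cont.continuousAt (Ioi_mem_nhds hpos)).tendsto
  exact ⟨le_of_tendsto_of_tendsto' h4 h3 fun i => hρ.le_dist _ _,
    le_of_tendsto_of_tendsto' h3 (h4.const_mul _) fun i => hρ.dist_le _ _⟩

/-- The point of the completion over a point of the circle. -/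
noncomputable def lift (hρ : IsGaugeWeight ρ φ lam C) (θ : ℝ) : RhoClosure ρ :=
  (hρ.exists_rhoEval_eq (q := Complex.exp (θ * Complex.I))
    (Complex.norm_exp_ofReal_mul_I θ).le).choose

theorem rhoEval_lift (hρ : IsGaugeWeight ρ φ lam C) (θ : ℝ) :
    rhoEval ρ (hρ.lift θ) = Complex.exp (θ * Complex.I) :=
  (hρ.exists_rhoEval_eq (q := Complex.exp (θ * Complex.I))
    (Complex.norm_exp_ofReal_mul_I θ).le).choose_spec

theorem continuous_lift (hρ : IsGaugeWeight ρ φ lam C) : Continuous hρ.lift := by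
  refine continuous_iff_continuousAt.2 fun θ => Metric.tendsto_nhds.2 fun ε hε => ?_
  obtain ⟨η, hη, h⟩ := hρ.gauge.exists_modulus hε
  filter_upwards [Metric.ball_mem_nhds θ hη] with θ' hθ'
  rcases eq_or_ne (rhoEval ρ (hρ.lift θ')) (rhoEval ρ (hρ.lift θ)) with heq | hne
  · rw [hρ.rhoEval_injective heq, dist_self]
    exact hε
  · refine (hρ.dist_bounds hne).2.trans_lt (h _ _ (dist_pos.2 hne) ?_ Metric.infDist_nonneg)
    rw [hρ.rhoEval_lift, hρ.rhoEval_lift]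
    exact (norm_exp_mul_I_sub_le _ _).trans_lt hθ'

theorem lift_arg (hρ : IsGaugeWeight ρ φ lam C) {p : RhoClosure ρ} (hp : ‖rhoEval ρ p‖ = 1) :
    hρ.lift (rhoEval ρ p).arg = p := by
  refine hρ.rhoEval_injective ?_
  rw [hρ.rhoEval_lift]
  have := Complex.norm_mul_exp_arg_mul_I (rhoEval ρ p)
  rwa [hp, Complex.ofReal_one, one_mul] at this

end IsGaugeWeight

/-! ### Packing dimension off the Cantor set -/

/-- The preimage of a ball of radius r ≤ 1 contains an interval of length 2r/M. As M ≥ 1 it stays in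
[−5, 5], whose finite Lebesgue measure bounds all packings. -/
theorem packingPreAt_one_ne_top {X : Type*} [PseudoMetricSpace X] {f : ℝ → X} (hf : Continuous f)
    {A : Set X} {M : ℝ} (hM : 1 ≤ M)
    (h : ∀ p ∈ A, ∃ θ ∈ Icc (-4 : ℝ) 4, ∀ θ', dist (f θ') p ≤ M * |θ' - θ|) :
    packingPreAt 1 1 A ≠ ∞ := by
  refine ne_top_of_le_ne_top ?_ (packingPreAt_le_of_measure (volume.restrict (Icc (-5 : ℝ) 5)) f
    (M := ENNReal.ofReal M)
    (fun p r => (Metric.isOpen_ball.preimage hf).measurableSet) ?_)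
  · exact ENNReal.mul_ne_top ENNReal.ofReal_ne_top (measure_ne_top _ _)
  intro p hp r hr hr1
  obtain ⟨θ, hθ, hd⟩ := h p hp
  have hM0 : 0 < M := by linarith
  have hrM : r / M ≤ 1 := (div_le_one hM0).2 (hr1.trans hM)
  have hsub : Ioo (θ - r / M) (θ + r / M) ⊆ f ⁻¹' Metric.ball p r ∩ Icc (-5) 5 := by
    intro θ' hθ'
    refine ⟨(hd θ').trans_lt ?_, by linarith [hθ'.1, hθ.1], by linarith [hθ'.2, hθ.2]⟩
    rw [← lt_div_iff₀' hM0, abs_lt]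
    constructor <;> linarith [hθ'.1, hθ'.2]
  calc ENNReal.ofReal r ^ ((1 : ℝ≥0) : ℝ)
      ≤ ENNReal.ofReal M * ENNReal.ofReal (θ + r / M - (θ - r / M)) := by
        rw [NNReal.coe_one, ENNReal.rpow_one, ← ENNReal.ofReal_mul hM0.le]
        refine ENNReal.ofReal_le_ofReal ?_
        have : M * (θ + r / M - (θ - r / M)) = 2 * r := by field_simp; ring
        linarith
    _ = ENNReal.ofReal M * volume (Ioo (θ - r / M) (θ + r / M)) := by rw [Real.volume_Ioo]
    _ ≤ ENNReal.ofReal M * (volume.restrict (Icc (-5 : ℝ) 5)) (f ⁻¹' Metric.ball p r) := by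
        refine mul_le_mul_right ?_ _
        rw [Measure.restrict_apply' measurableSet_Icc]
        exact measure_mono hsub

theorem arg_mem_Icc (z : ℂ) : z.arg ∈ Icc (-4 : ℝ) 4 :=
  ⟨by linarith [Complex.neg_pi_lt_arg z, Real.pi_le_four],
    (Complex.arg_le_pi z).trans Real.pi_le_four⟩

theorem packingDim_sphere_le : packingDim (Metric.sphere (0 : ℂ) 1) ≤ 1 := by
  have h1 : packingPreAt 1 1 (Metric.sphere (0 : ℂ) 1) ≠ ∞ := by
    refine packingPreAt_one_ne_top (f := fun θ : ℝ => Complex.exp (θ * Complex.I)) (by fun_prop)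
      le_rfl fun p hp => ⟨p.arg, arg_mem_Icc p, fun θ' => ?_⟩
    have hp1 : ‖p‖ = 1 := by simpa using hp
    have h2 := Complex.norm_mul_exp_arg_mul_I p
    rw [hp1, Complex.ofReal_one, one_mul] at h2
    have h3 := norm_exp_mul_I_sub_le θ' p.arg
    rwa [h2, ← one_mul |_|] at h3
  refine packingDim_le_of_measure (d := 1) fun s hs => ?_
  rw [packingMeasure_eq_zero_of_cover (F := fun _ => Metric.sphere (0 : ℂ) 1)
    (fun x hx => mem_iUnion.2 ⟨0, hx⟩) fun _ => packingPre_eq_zero hs one_pos h1]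
  exact ENNReal.zero_ne_top

namespace IsGaugeWeight

variable {φ : ℝ → ℝ} {lam : ℝ} {ρ : DiscWeight} {C : Set ℂ}

/-- At distance at least e from C the weight factor is at most φ(e), so d_ρ is bounded by a multiple
of arc length. -/
theorem packingPreAt_off_ne_top (hρ : IsGaugeWeight ρ φ lam C) {e : ℝ} (he : 0 < e) :
    packingPreAt 1 1
      (rhoTrace ρ {q | q ∈ Metric.sphere (0 : ℂ) 1 ∧ e ≤ Metric.infDist q C}) ≠ ∞ := by
  have hB := hρ.gauge.metricConst_pos
  have hφ := hρ.gauge.pos e he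
  refine packingPreAt_one_ne_top hρ.continuous_lift (M := max 1 (metricConst lam * φ e))
    (le_max_left _ _) fun p hp => ?_
  rw [hρ.mem_rhoTrace_iff fun q hq => hq.1] at hp
  have hp1 : ‖rhoEval ρ p‖ = 1 := by simpa using hp.1
  refine ⟨(rhoEval ρ p).arg, arg_mem_Icc _, fun θ' => ?_⟩
  rcases eq_or_ne (rhoEval ρ p) (rhoEval ρ (hρ.lift θ')) with heq | hne
  · rw [hρ.rhoEval_injective heq, dist_self]
    positivity
  · rw [dist_comm]
    refine (hρ.dist_bounds hne).2.trans ?_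
    have h1 : dist (rhoEval ρ p) (rhoEval ρ (hρ.lift θ')) ≤ |θ' - (rhoEval ρ p).arg| := by
      have hq := hρ.rhoEval_lift (rhoEval ρ p).arg
      rw [hρ.lift_arg hp1] at hq
      have h3 := norm_exp_mul_I_sub_le θ' (rhoEval ρ p).arg
      rwa [← hq, ← hρ.rhoEval_lift, dist_comm] at h3
    have h2 : φ (dist (rhoEval ρ p) (rhoEval ρ (hρ.lift θ')) + Metric.infDist (rhoEval ρ p) C) ≤
        φ e := hρ.gauge.anti _ _ he (hp.2.trans (le_add_of_nonneg_left dist_nonneg))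
    have h5 := hρ.gauge.pos _ (add_pos_of_pos_of_nonneg (dist_pos.2 hne)
      (Metric.infDist_nonneg (x := rhoEval ρ p) (s := C)))
    calc metricConst lam * (dist (rhoEval ρ p) (rhoEval ρ (hρ.lift θ')) *
          φ (dist (rhoEval ρ p) (rhoEval ρ (hρ.lift θ')) + Metric.infDist (rhoEval ρ p) C))
        ≤ metricConst lam * (|θ' - (rhoEval ρ p).arg| * φ e) := by gcongr
      _ = (metricConst lam * φ e) * |θ' - (rhoEval ρ p).arg| := by ring
      _ ≤ _ := by gcongr; exact le_max_right _ _

end IsGaugeWeight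

/-! ### Harnack inequality and volume growth -/

theorem volume_closedBall_eq_ofReal (z : ℂ) {r : ℝ} (hr : 0 ≤ r) :
    volume (Metric.closedBall z r) = ENNReal.ofReal (r ^ 2 * Real.pi) := by
  rw [Complex.volume_closedBall, ENNReal.ofReal_mul (by positivity), ENNReal.ofReal_pow hr,
    ← NNReal.coe_real_pi, ENNReal.ofReal_coe_nnreal]

theorem volume_ball_eq_ofReal (z : ℂ) {r : ℝ} (hr : 0 ≤ r) :
    volume (Metric.ball z r) = ENNReal.ofReal (r ^ 2 * Real.pi) := by
  rw [Complex.volume_ball, ENNReal.ofReal_mul (by positivity), ENNReal.ofReal_pow hr,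
    ← NNReal.coe_real_pi, ENNReal.ofReal_coe_nnreal]

namespace IsGaugeWeight

variable {φ : ℝ → ℝ} {lam : ℝ} {ρ : DiscWeight} {C : Set ℂ}

/-- As 1 − |x| ≤ dist(x, C), such a displacement changes the distance to C by a factor at most 2
either way. -/
theorem harnack (hρ : IsGaugeWeight ρ φ lam C) : ∃ c₀ : ℝ, 1 ≤ c₀ ∧
    ∀ x ∈ Metric.ball (0 : ℂ) 1, ∀ y ∈ Metric.ball x ((1 - ‖x‖) / 2),
      c₀⁻¹ ≤ ρ y / ρ x ∧ ρ y / ρ x ≤ c₀ := by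
  refine ⟨2, by norm_num, fun x hx y hy => ?_⟩
  have hx1 : ‖x‖ < 1 := by simpa using hx
  have hyx : dist y x < (1 - ‖x‖) / 2 := hy
  have hyb : y ∈ Metric.ball (0 : ℂ) 1 := by
    rw [mem_ball_zero_iff]
    have := norm_le_norm_add_norm_sub' y x
    rw [← dist_eq_norm] at this
    linarith
  have h0 := one_sub_norm_le_infDist hρ.subset hρ.nonempty x
  have h1 := Metric.infDist_le_infDist_add_dist (s := C) (x := y) (y := x)
  have h2 := Metric.infDist_le_infDist_add_dist (s := C) (x := x) (y := y)
  rw [dist_comm] at h2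
  have hdx := hρ.infDist_pos hx
  have hdy := hρ.infDist_pos hyb
  have h3 := hρ.gauge.le_const_mul hdx hdy one_le_two (by linarith)
  have h4 := hρ.gauge.le_const_mul hdy hdx one_le_two (by linarith)
  have hpx := hρ.gauge.pos _ hdx
  rw [hρ.eq x hx, hρ.eq y hyb]
  refine ⟨?_, (div_le_iff₀ hpx).2 h4⟩
  rw [le_div_iff₀ hpx]
  linarith

/-- Volume growth at the points of a coded Cantor set. -/
theorem lintegral_ball_code_le (hρ : IsGaugeWeight ρ φ lam C) {c : (ℕ → Bool) → ℂ} {s : ℕ → ℝ}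
    {K q x : ℝ} (hc : IsCoding c s K) (hC : C = range c) (hs0 : s 0 = 1) (hq : 0 < q) (hq1 : q ≤ 1)
    (hqs : ∀ k, q * s k ≤ s (k + 1)) (hx : 0 < x) (hx1 : 2 * x ^ 2 < 1)
    (hsx : ∀ k, s k * φ (s k) = x ^ k) :
    ∃ M : ℝ, 0 ≤ M ∧ ∀ p ∈ C, ∀ R : ℝ, 0 < R → R ≤ 6 →
      ∫⁻ y in Metric.ball p R ∩ Metric.ball 0 1,
        ENNReal.ofReal (φ (Metric.infDist y C) ^ 2) ≤ ENNReal.ofReal (M * (R * φ R) ^ 2) := by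
  classical
  have hK := hc.K_pos
  have hx2 : 0 < 1 - 2 * x ^ 2 := by linarith
  -- Chosen so that R ≤ B s_m: the summand 6 serves m = 0, where s_0 = 1, and the other one comes
  -- from 2KR < s_{m−1} ≤ s_m / q.
  set B : ℝ := 6 + 1 / (2 * K * q) with hB
  have hB1 : 1 ≤ B := by
    have : 0 < 1 / (2 * K * q) := by positivity
    linarith
  refine ⟨B ^ 2 * Real.pi + q⁻¹ ^ 2 * (1 + K) ^ 2 * Real.pi * (2 * K * B) ^ 2 / (1 - 2 * x ^ 2),
    by positivity, fun p hp R hR hR6 => ?_⟩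
  have hφR := hρ.gauge.pos R hR
  obtain ⟨w, rfl⟩ : ∃ w, c w = p := by rwa [hC] at hp
  -- The level matching R: points of C within 2R of p share their first m symbols with p.
  have hex : ∃ m, s m ≤ 2 * K * R :=
    ((hc.s_lim.eventually (gt_mem_nhds (show 0 < 2 * K * R by positivity))).exists).imp
      fun k hk => hk.le
  have hm := Nat.find_spec hex
  have hmin : ∀ j < Nat.find hex, 2 * K * R < s j := fun j hj => not_le.1 (Nat.find_min hex hj)
  set m := Nat.find hex with hmdef
  clear_value m
  have hsm := hc.s_pos m
  have hRm : R ≤ B * s m := by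
    rcases Nat.eq_zero_or_pos m with h0 | h0
    · rw [h0, hs0, mul_one, hB]
      have : 0 < 1 / (2 * K * q) := by positivity
      linarith
    · obtain ⟨j, rfl⟩ : ∃ j, m = j + 1 := ⟨m - 1, by omega⟩
      have h1 := hmin j (Nat.lt_succ_self j)
      have h2 := hqs j
      have h3 : R ≤ 1 / (2 * K * q) * s (j + 1) := by
        rw [div_mul_eq_mul_div, one_mul, le_div_iff₀ (by positivity)]
        nlinarith
      have h4 : 0 ≤ 6 * s (j + 1) := by positivity
      rw [hB, add_mul]
      linarith
  have hφm : φ (s m) ≤ B * φ R := hρ.gauge.le_const_mul hsm hR hB1 hRm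
  have hφm0 := hρ.gauge.pos _ hsm
  have hxm : x ^ m ≤ 2 * K * B * (R * φ R) := by
    rw [← hsx m]
    calc s m * φ (s m) ≤ (2 * K * R) * (B * φ R) := by gcongr
      _ = _ := by ring
  let v : ∀ k, (Fin k → Bool) → ℕ → Bool := fun k u j =>
    if j < m then w j else if h : j - m < k then u ⟨j - m, h⟩ else false
  -- The points of the ball whose distance to C lies between s_{m+k+1} and s_{m+k} are within (1 +
  -- K) s_{m+k} of one of 2^k representatives, one for each continuation of the prefix of length m.
  let U : ℕ → Set ℂ := fun k =>
    ⋃ u : Fin k → Bool, Metric.closedBall (c (v k u)) ((1 + K) * s (m + k))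
  let A : ℕ → ℝ := fun k => q⁻¹ ^ 2 * φ (s (m + k)) ^ 2
  have hA : ∀ k, 0 ≤ A k := fun k => by positivity
  have hUm : ∀ k, MeasurableSet (U k) := fun k =>
    MeasurableSet.iUnion fun u => Metric.isClosed_closedBall.measurableSet
  have hUvol : ∀ k, volume (U k) ≤
      ENNReal.ofReal (2 ^ k * (((1 + K) * s (m + k)) ^ 2 * Real.pi)) := by
    intro k
    have hsk := hc.s_pos (m + k)
    refine (measure_iUnion_le _).trans ?_
    have hr : 0 ≤ (1 + K) * s (m + k) := by positivity
    simp only [volume_closedBall_eq_ofReal _ hr, tsum_fintype]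
    rw [Finset.sum_const, Finset.card_univ, Fintype.card_fun, Fintype.card_bool, Fintype.card_fin,
      nsmul_eq_mul, ENNReal.ofReal_mul (p := 2 ^ k) (by positivity),
      ENNReal.ofReal_pow (p := 2) (by norm_num)]
    simp only [ENNReal.ofReal_ofNat, Nat.cast_pow, Nat.cast_ofNat, le_refl]
  have hpt : ∀ y ∈ Metric.ball (c w) R ∩ Metric.ball 0 1,
      ENNReal.ofReal (φ (Metric.infDist y C) ^ 2) ≤ ENNReal.ofReal (φ (s m) ^ 2) +
        ∑' k, (U k).indicator (fun _ => ENNReal.ofReal (A k)) y := by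
    rintro y ⟨hyR, hyb⟩
    have hyR' : dist y (c w) < R := hyR
    have hδ := hρ.infDist_pos hyb
    have hφδ := hρ.gauge.pos _ hδ
    rcases le_total (s m) (Metric.infDist y C) with hle | hle
    · refine le_trans (ENNReal.ofReal_le_ofReal ?_) le_self_add
      have := hρ.gauge.anti _ _ hsm hle
      gcongr
    · have hex2 : ∃ k, s (m + k) < Metric.infDist y C := by
        obtain ⟨k, hk⟩ := ((hc.s_lim.eventually (gt_mem_nhds hδ)).and
          (eventually_ge_atTop m)).exists
        exact ⟨k - m, by rw [Nat.add_sub_cancel' hk.2]; exact hk.1⟩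
      have hk := Nat.find_spec hex2
      have hkmin : ∀ j < Nat.find hex2, Metric.infDist y C ≤ s (m + j) := fun j hj =>
        not_lt.1 (Nat.find_min hex2 hj)
      obtain ⟨k, hkk⟩ : ∃ k, Nat.find hex2 = k + 1 := by
        refine Nat.exists_eq_succ_of_ne_zero fun h0 => ?_
        rw [h0, add_zero] at hk
        linarith
      rw [hkk] at hk hkmin
      have hδk := hkmin k (Nat.lt_succ_self k)
      have hsk := hc.s_pos (m + k)
      have hsk1 := hc.s_pos (m + k + 1)
      have h1 : φ (Metric.infDist y C) ≤ q⁻¹ * φ (s (m + k)) := by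
        refine (hρ.gauge.anti _ _ hsk1 hk.le).trans ?_
        refine hρ.gauge.le_const_mul hsk1 hsk ((one_le_inv₀ hq).2 hq1) ?_
        rw [inv_mul_eq_div, le_div_iff₀ hq, mul_comm]
        exact hqs _
      have hyU : y ∈ U k := by
        have hcomp : IsCompact C := by rw [hC]; exact isCompact_range hc.continuous
        obtain ⟨c', hc', hdc⟩ := hcomp.exists_infDist_eq_dist hρ.nonempty y
        obtain ⟨w', rfl⟩ : ∃ w', c w' = c' := by rwa [hC] at hc'
        have h2 : dist (c w') (c w) < 2 * R := by
          have h3 := Metric.infDist_le_dist_of_mem hp (x := y)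
          have h4 := dist_triangle_left (c w') (c w) y
          linarith
        have hagree : ∀ j < m, w' j = w j := hc.agree fun j hj => by
          have := hmin j hj
          nlinarith
        refine mem_iUnion.2 ⟨fun j => w' (m + j), ?_⟩
        have h5 : dist (c w') (c (v k fun j => w' (m + j))) ≤ K * s (m + k) := by
          refine hc.upper (m + k) _ _ fun j hj => ?_
          simp only [v]
          split_ifs with h6 h7
          · exact hagree j h6
          · congr 1; omega
          · omega
        rw [Metric.mem_closedBall]
        have := dist_triangle y (c w') (c (v k fun j => w' (m + j)))
        linarith
      refine le_trans ?_ le_add_self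
      refine le_trans ?_ (ENNReal.le_tsum k)
      rw [indicator_of_mem hyU]
      refine ENNReal.ofReal_le_ofReal ?_
      simp only [A]
      rw [← mul_pow]
      gcongr
  -- Weight squared times area is (s φ(s))² = x^(2(m+k)) for each of the 2^k pieces: a geometric
  -- series with ratio 2x² < 1.
  have hgeom : ∀ k, ENNReal.ofReal (A k) * volume (U k) ≤
      ENNReal.ofReal (q⁻¹ ^ 2 * (1 + K) ^ 2 * Real.pi * (x ^ m) ^ 2 * (2 * x ^ 2) ^ k) := by
    intro k
    refine (mul_le_mul_right (hUvol k) _).trans ?_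
    rw [← ENNReal.ofReal_mul (hA k)]
    refine ENNReal.ofReal_le_ofReal (le_of_eq ?_)
    have h1 := hsx (m + k)
    calc A k * (2 ^ k * (((1 + K) * s (m + k)) ^ 2 * Real.pi))
        = q⁻¹ ^ 2 * (1 + K) ^ 2 * Real.pi * (s (m + k) * φ (s (m + k))) ^ 2 * 2 ^ k := by
          simp only [A]; ring
      _ = _ := by rw [h1, pow_add, mul_pow 2, ← pow_mul x 2 k]; ring
  have hsum : HasSum (fun k => q⁻¹ ^ 2 * (1 + K) ^ 2 * Real.pi * (x ^ m) ^ 2 * (2 * x ^ 2) ^ k)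
      (q⁻¹ ^ 2 * (1 + K) ^ 2 * Real.pi * (x ^ m) ^ 2 * (1 - 2 * x ^ 2)⁻¹) :=
    (hasSum_geometric_of_lt_one (by positivity) hx1).mul_left _
  calc ∫⁻ y in Metric.ball (c w) R ∩ Metric.ball 0 1,
        ENNReal.ofReal (φ (Metric.infDist y C) ^ 2)
      ≤ ∫⁻ y in Metric.ball (c w) R ∩ Metric.ball 0 1, (ENNReal.ofReal (φ (s m) ^ 2) +
        ∑' k, (U k).indicator (fun _ => ENNReal.ofReal (A k)) y) :=
        setLIntegral_mono' (Metric.isOpen_ball.measurableSet.inter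
          Metric.isOpen_ball.measurableSet) hpt
    _ = ENNReal.ofReal (φ (s m) ^ 2) * volume (Metric.ball (c w) R ∩ Metric.ball 0 1) +
        ∑' k, ∫⁻ y in Metric.ball (c w) R ∩ Metric.ball 0 1,
          (U k).indicator (fun _ => ENNReal.ofReal (A k)) y := by
        rw [lintegral_add_left measurable_const, setLIntegral_const, lintegral_tsum fun k =>
          (measurable_const.indicator (hUm k)).aemeasurable]
    _ ≤ ENNReal.ofReal (φ (s m) ^ 2) * ENNReal.ofReal (R ^ 2 * Real.pi) +
        ∑' k, ENNReal.ofReal (A k) * volume (U k) := by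
        gcongr with k
        · refine (measure_mono inter_subset_left).trans (le_of_eq ?_)
          rw [volume_ball_eq_ofReal _ hR.le]
        · refine (setLIntegral_le_lintegral _ _).trans (le_of_eq ?_)
          rw [lintegral_indicator_const (hUm k)]
    _ ≤ ENNReal.ofReal (φ (s m) ^ 2 * (R ^ 2 * Real.pi)) +
        ENNReal.ofReal (q⁻¹ ^ 2 * (1 + K) ^ 2 * Real.pi * (x ^ m) ^ 2 * (1 - 2 * x ^ 2)⁻¹) := by
        rw [ENNReal.ofReal_mul (p := φ (s m) ^ 2) (by positivity), ← hsum.tsum_eq,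
          ENNReal.ofReal_tsum_of_nonneg (fun k => by positivity) hsum.summable]
        exact add_le_add_right (ENNReal.tsum_le_tsum hgeom) _
    _ ≤ _ := by
        rw [← ENNReal.ofReal_add (by positivity) (by positivity)]
        refine ENNReal.ofReal_le_ofReal ?_
        calc φ (s m) ^ 2 * (R ^ 2 * Real.pi) +
              q⁻¹ ^ 2 * (1 + K) ^ 2 * Real.pi * (x ^ m) ^ 2 * (1 - 2 * x ^ 2)⁻¹
            ≤ (B * φ R) ^ 2 * (R ^ 2 * Real.pi) + q⁻¹ ^ 2 * (1 + K) ^ 2 * Real.pi *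
              (2 * K * B * (R * φ R)) ^ 2 * (1 - 2 * x ^ 2)⁻¹ := by gcongr
          _ = _ := by field_simp

/-- A ρ-ball of radius r lies in a Euclidean ball of radius R with R φ(R + δ) ≤ r. Either that ball
is far from C and the weight is nearly constant on it, or it lies in a ball of radius 3R centred on
C. -/
theorem volume_growth_of_ball (hρ : IsGaugeWeight ρ φ lam C) {M : ℝ} (hM : 0 ≤ M)
    (h : ∀ p ∈ C, ∀ R : ℝ, 0 < R → R ≤ 6 → ∫⁻ y in Metric.ball p R ∩ Metric.ball 0 1,
        ENNReal.ofReal (φ (Metric.infDist y C) ^ 2) ≤ ENNReal.ofReal (M * (R * φ R) ^ 2)) :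
    ∃ c₁ : ℝ, 1 ≤ c₁ ∧ ∀ x ∈ Metric.ball (0 : ℂ) 1, ∀ r : ℝ, 0 < r →
      ∫⁻ y in {y | y ∈ Metric.ball (0 : ℂ) 1 ∧ rhoEDist ρ x y < ENNReal.ofReal r},
        ENNReal.ofReal (ρ y ^ 2) ≤ ENNReal.ofReal (c₁ * r ^ 2) := by
  have key : ∀ x ∈ Metric.ball (0 : ℂ) 1, ∀ R : ℝ, 0 < R → R ≤ 2 →
      ∫⁻ y in Metric.ball x R ∩ Metric.ball 0 1, ENNReal.ofReal (φ (Metric.infDist y C) ^ 2) ≤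
        ENNReal.ofReal (9 * (M + Real.pi) * (R * φ (R + Metric.infDist x C)) ^ 2) := by
    intro x hx R hR hR2
    have hδ := hρ.infDist_pos hx
    have hφ := hρ.gauge.pos (R + Metric.infDist x C) (by positivity)
    have hπ := Real.pi_pos
    rcases le_total (2 * R) (Metric.infDist x C) with hle | hle
    · calc ∫⁻ y in Metric.ball x R ∩ Metric.ball 0 1, ENNReal.ofReal (φ (Metric.infDist y C) ^ 2)
          ≤ ∫⁻ _ in Metric.ball x R ∩ Metric.ball 0 1,
            ENNReal.ofReal ((3 * φ (R + Metric.infDist x C)) ^ 2) := by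
            refine setLIntegral_mono measurable_const fun y hy => ENNReal.ofReal_le_ofReal ?_
            have h1 := Metric.infDist_le_infDist_add_dist (s := C) (x := x) (y := y)
            have h2 : dist x y < R := by rw [dist_comm]; exact hy.1
            have h3 := hρ.infDist_pos hy.2
            have h4 : φ (Metric.infDist y C) ≤ 3 * φ (R + Metric.infDist x C) :=
              hρ.gauge.le_const_mul h3 (by positivity) (by norm_num) (by linarith)
            have h5 := hρ.gauge.pos _ h3
            gcongr
        _ = ENNReal.ofReal ((3 * φ (R + Metric.infDist x C)) ^ 2) *
            volume (Metric.ball x R ∩ Metric.ball 0 1) := setLIntegral_const _ _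
        _ ≤ ENNReal.ofReal ((3 * φ (R + Metric.infDist x C)) ^ 2) *
            ENNReal.ofReal (R ^ 2 * Real.pi) := by
            refine mul_le_mul_right ((measure_mono inter_subset_left).trans (le_of_eq ?_)) _
            rw [volume_ball_eq_ofReal _ hR.le]
        _ ≤ _ := by
            rw [← ENNReal.ofReal_mul (by positivity)]
            refine ENNReal.ofReal_le_ofReal ?_
            have : 0 ≤ 9 * M * (R * φ (R + Metric.infDist x C)) ^ 2 := by positivity
            nlinarith
    · obtain ⟨p, hp, hdp⟩ := (((isCompact_sphere (0 : ℂ) 1).of_isClosed_subset hρ.closed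
        hρ.subset).exists_infDist_eq_dist hρ.nonempty x)
      refine (lintegral_mono_set (t := Metric.ball p (3 * R) ∩ Metric.ball 0 1) ?_).trans
        ((h p hp (3 * R) (by positivity) (by linarith)).trans (ENNReal.ofReal_le_ofReal ?_))
      · refine inter_subset_inter_left _ (Metric.ball_subset_ball' ?_)
        rw [← hdp]
        linarith
      · have h1 : φ (3 * R) ≤ φ (R + Metric.infDist x C) :=
          hρ.gauge.anti _ _ (by positivity) (by linarith)
        have h2 := hρ.gauge.pos (3 * R) (by positivity)
        calc M * (3 * R * φ (3 * R)) ^ 2 ≤ M * (3 * R * φ (R + Metric.infDist x C)) ^ 2 := by gcongr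
          _ = 9 * M * (R * φ (R + Metric.infDist x C)) ^ 2 := by ring
          _ ≤ _ := by gcongr; linarith
  refine ⟨max 1 (9 * (M + Real.pi)), le_max_left _ _, fun x hx r hr => ?_⟩
  have hδ := hρ.infDist_pos hx
  set δ := Metric.infDist x C with hδdef
  have hx1 : ‖x‖ < 1 := by simpa using hx
  obtain ⟨R, hR, hR2, hRr, hsub⟩ : ∃ R, 0 < R ∧ R ≤ 2 ∧ R * φ (R + δ) ≤ r ∧
      ∀ y ∈ Metric.ball (0 : ℂ) 1, rhoEDist ρ x y < ENNReal.ofReal r → dist y x < R := by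
    -- For large r the whole disc is taken, with R = 2. Otherwise R solves R φ(R + δ) = r, and
    -- monotonicity of the left side turns the lower metric estimate into the inclusion.
    rcases le_or_gt (2 * φ (2 + δ)) r with hle | hlt
    · refine ⟨2, two_pos, le_rfl, hle, fun y hy _ => ?_⟩
      have hy1 : ‖y‖ < 1 := by simpa using hy
      rw [dist_eq_norm]
      exact (norm_sub_le _ _).trans_lt (by linarith)
    · have hcont : ContinuousOn (fun d : ℝ => d * φ (d + δ)) (Icc 0 2) := by
        refine continuousOn_id.mul (hρ.gauge.cont.comp (by fun_prop) fun d hd => ?_)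
        exact add_pos_of_nonneg_of_pos hd.1 hδ
      obtain ⟨R, hR, hRr⟩ := intermediate_value_Icc (by norm_num) hcont
        (show r ∈ Icc _ _ from ⟨by simpa using hr.le, hlt.le⟩)
      have hR0 : 0 < R := by
        rcases hR.1.eq_or_lt with h0 | h0
        · rw [← h0] at hRr
          simp only [zero_mul] at hRr
          linarith
        · exact h0
      refine ⟨R, hR0, hR.2, hRr.le, fun y hy hyr => ?_⟩
      by_contra hge
      have h1 := (hρ.le_rhoEDist (y := y) hx).trans_lt hyr
      have h2 := (ENNReal.ofReal_lt_ofReal_iff hr).1 h1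
      have h3 := hρ.gauge.mul_mono hR0 (not_lt.1 hge) hδ.le
      rw [dist_comm] at h2
      simp only at hRr
      linarith
  have hφ := hρ.gauge.pos (R + δ) (by positivity)
  calc ∫⁻ y in {y | y ∈ Metric.ball (0 : ℂ) 1 ∧ rhoEDist ρ x y < ENNReal.ofReal r},
        ENNReal.ofReal (ρ y ^ 2)
      ≤ ∫⁻ y in Metric.ball x R ∩ Metric.ball 0 1, ENNReal.ofReal (ρ y ^ 2) :=
        lintegral_mono_set fun y hy => ⟨hsub y hy.1 hy.2, hy.1⟩
    _ = ∫⁻ y in Metric.ball x R ∩ Metric.ball 0 1,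
        ENNReal.ofReal (φ (Metric.infDist y C) ^ 2) :=
        setLIntegral_congr_fun (Metric.isOpen_ball.measurableSet.inter
          Metric.isOpen_ball.measurableSet) fun y hy => by simp only [hρ.eq y hy.2]
    _ ≤ ENNReal.ofReal (9 * (M + Real.pi) * (R * φ (R + δ)) ^ 2) := key x hx R hR hR2
    _ ≤ ENNReal.ofReal (max 1 (9 * (M + Real.pi)) * r ^ 2) := by
        refine ENNReal.ofReal_le_ofReal ?_
        gcongr
        exact le_max_right _ _

end IsGaugeWeight

/-! ### The lower local exponents -/

section Cantor

variable {a b lam eta xi : ℝ} {n N : ℕ → ℕ} {ρ : DiscWeight}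

/-- The numerator converges to a finite number while log(1 − r) tends to −∞. -/
theorem IsGaugeWeight.kMinus_eq_zero {φ : ℝ → ℝ} {C : Set ℂ} (hρ : IsGaugeWeight ρ φ lam C)
    {x : ℂ} (hx : x ∈ Metric.sphere (0 : ℂ) 1 \ C) : kMinus ρ x = 0 := by
  have hx1 : ‖x‖ = 1 := by simpa using hx.1
  have hpos : 0 < Metric.infDist x C := (hρ.closed.notMem_iff_infDist_pos hρ.nonempty).1 hx.2
  have h1 : Tendsto (fun r : ℝ => Real.log (φ (Metric.infDist ((r : ℂ) * x) C))) (𝓝[<] 1)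
      (𝓝 (Real.log (φ (Metric.infDist x C)))) := by
    have hc : Tendsto (fun r : ℝ => Metric.infDist ((r : ℂ) * x) C) (𝓝[<] 1)
        (𝓝 (Metric.infDist x C)) := by
      have : Continuous fun r : ℝ => Metric.infDist ((r : ℂ) * x) C :=
        (Metric.continuous_infDist_pt C).comp (by fun_prop)
      have h2 := this.tendsto 1
      rw [Complex.ofReal_one, one_mul] at h2
      exact h2.mono_left nhdsWithin_le_nhds
    have hφ : ContinuousAt φ (Metric.infDist x C) :=
      hρ.gauge.cont.continuousAt (Ioi_mem_nhds hpos)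
    exact ((Real.continuousAt_log (hρ.gauge.pos _ hpos).ne').tendsto.comp (hφ.tendsto.comp hc))
  have h2 : Tendsto (fun r : ℝ => Real.log (1 - r)) (𝓝[<] 1) atBot := by
    refine Real.tendsto_log_nhdsGT_zero.comp ?_
    refine tendsto_nhdsWithin_iff.2 ⟨?_, ?_⟩
    · have : Tendsto (fun r : ℝ => 1 - r) (𝓝 1) (𝓝 (1 - 1)) :=
        (continuous_const.sub continuous_id).tendsto 1
      rw [sub_self] at this
      exact this.mono_left nhdsWithin_le_nhds
    · exact eventually_nhdsWithin_of_forall fun r hr => mem_Ioi.2 (sub_pos.2 hr)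
  have h3 : Tendsto (fun r : ℝ => Real.log (ρ ((r : ℂ) * x)) / Real.log (1 - r)) (𝓝[<] 1)
      (𝓝 0) := by
    refine (h1.div_atBot h2).congr' ?_
    filter_upwards [Ioo_mem_nhdsLT (zero_lt_one (α := ℝ))] with r hr
    rw [hρ.eq]
    rw [mem_ball_zero_iff, norm_mul, hx1, mul_one, Complex.norm_real, Real.norm_eq_abs,
      abs_of_pos hr.1]
    exact hr.2
  have h4 : Tendsto (fun r : ℝ =>
      ((Real.log (ρ ((r : ℂ) * x)) / Real.log (1 - r) : ℝ) : EReal)) (𝓝[<] 1) (𝓝 ((0 : ℝ) : EReal)) :=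
    (continuous_coe_real_ereal.tendsto 0).comp h3
  exact h4.liminf_eq

/-- On the radius ending at x in C the distance to C is exactly 1 − r. Slopes at least λ bound the
quotient from below; scales ℓ_k with log ℓ_k close to k log a bring it close to λ. -/
theorem IsAdmissible.kMinus_eq_lam (h : IsAdmissible a b lam eta xi n N)
    (hρ : IsGaugeWeight ρ (profile a b lam eta n N) lam (cantorCircle a b n N)) {x : ℂ}
    (hx : x ∈ cantorCircle a b n N) : kMinus ρ x = (lam : EReal) := by
  have hx1 : ‖x‖ = 1 := by simpa using hρ.subset hx
  have hval : ∀ r ∈ Ioo (0 : ℝ) 1, Real.log (ρ ((r : ℂ) * x)) / Real.log (1 - r) =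
      logProfile a b lam eta n N (Real.log (1 - r)) / Real.log (1 - r) := by
    intro r hr
    have hn : ‖(r : ℂ) * x‖ = r := by
      rw [norm_mul, hx1, mul_one, Complex.norm_real, Real.norm_eq_abs, abs_of_pos hr.1]
    have hd : Metric.infDist ((r : ℂ) * x) (cantorCircle a b n N) = 1 - r := by
      refine le_antisymm ?_ ?_
      · refine (Metric.infDist_le_dist_of_mem hx).trans (le_of_eq ?_)
        rw [dist_eq_norm, show (r : ℂ) * x - x = ((r - 1 : ℝ) : ℂ) * x by push_cast; ring, norm_mul,
          hx1, mul_one, Complex.norm_real, Real.norm_eq_abs, abs_of_neg (by linarith [hr.2])]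
        ring
      · have := one_sub_norm_le_infDist hρ.subset hρ.nonempty ((r : ℂ) * x)
        rwa [hn] at this
    rw [hρ.eq _ (by rw [mem_ball_zero_iff, hn]; exact hr.2), hd, profile, Real.log_exp]
  refine le_antisymm ?_ ?_
  · refine EReal.le_of_forall_lt_iff_le.1 fun c hc => ?_
    have hc' : lam < c := by exact_mod_cast hc
    have hl := h.lam_gt
    have hlim : Tendsto (fun k => 1 - cantorLen a b n N k) atTop (𝓝[<] 1) := by
      refine tendsto_nhdsWithin_iff.2 ⟨by simpa using h.tendsto_cantorLen.const_sub 1, ?_⟩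
      exact Eventually.of_forall fun k => by
        have := h.cantorLen_pos k
        simp only [mem_Iio]
        linarith
    have hfreq : ∃ᶠ k in atTop, Real.log (ρ (((1 - cantorLen a b n N k : ℝ) : ℂ) * x)) /
        Real.log (1 - (1 - cantorLen a b n N k)) ≤ c := by
      -- At 1 − r = ℓ_k the quotient is k log ξ / log ℓ_k − 1, so it is at most c when log ℓ_k ≤ k
      -- log ξ / (1 + c).
      have hlog : Real.log a < Real.log xi / (1 + c) := by
        rw [lt_div_iff₀ (by linarith), h.log_xi_eq]
        nlinarith [h.log_a_neg]
      refine ((h.frequently_log_cantorLen_le hlog).and_eventually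
        (eventually_ge_atTop 1)).mono fun k hk => ?_
      have hk1 : cantorLen a b n N k < 1 := by
        have := h.strictAnti_cantorLen hk.2
        rwa [cantorLen_zero] at this
      have hk0 := h.cantorLen_pos k
      rw [hval _ ⟨by linarith, by linarith⟩, sub_sub_cancel, h.logProfile_log_cantorLen,
        div_le_iff_of_neg (Real.log_neg hk0 hk1)]
      have h1 := hk.1
      rw [div_mul_eq_mul_div, le_div_iff₀ (by linarith)] at h1
      linarith
    refine liminf_le_of_frequently_le' (hlim.frequently ?_)
    exact hfreq.mono fun k hk => by exact_mod_cast hk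
  · refine le_liminf_of_le (by isBoundedDefault) ?_
    filter_upwards [Ioo_mem_nhdsLT (zero_lt_one (α := ℝ))] with r hr
    rw [hval r hr, EReal.coe_le_coe_iff]
    have hneg : Real.log (1 - r) < 0 := Real.log_neg (by linarith [hr.2]) (by linarith [hr.1])
    rw [le_div_iff_of_neg hneg]
    have h1 := h.le_logProfile_sub hneg.le
    have h0 : logProfile a b lam eta n N 0 = 0 := by simp [logProfile]
    linarith

/-! ### The density of the Cantor set -/

theorem IsAdmissible.cantorCircle_subset (h : IsAdmissible a b lam eta xi n N) :
    cantorCircle a b n N ⊆ Metric.sphere 0 1 := by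
  rw [h.cantorCircle_eq]
  rintro _ ⟨w, rfl⟩
  rw [mem_sphere_zero_iff_norm]
  exact Complex.norm_exp_ofReal_mul_I _

theorem IsAdmissible.cantorCircle_nonempty (h : IsAdmissible a b lam eta xi n N) :
    (cantorCircle a b n N).Nonempty := by
  rw [h.cantorCircle_eq]
  exact range_nonempty _

/-- The conformal density attached to admissible data. -/
noncomputable def IsAdmissible.density (h : IsAdmissible a b lam eta xi n N) : DiscWeight :=
  gaugeWeight h.profile_gauge h.cantorCircle_subset h.cantorCircle_nonempty

theorem IsAdmissible.isGaugeWeight (h : IsAdmissible a b lam eta xi n N) :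
    IsGaugeWeight h.density (profile a b lam eta n N) lam (cantorCircle a b n N) where
  gauge := h.profile_gauge
  subset := h.cantorCircle_subset
  nonempty := h.cantorCircle_nonempty
  closed := by
    rw [h.cantorCircle_eq]
    exact (isCompact_range h.isCoding.continuous).isClosed
  eq _ _ := rfl

theorem IsAdmissible.two_mul_xi_sq_lt (h : IsAdmissible a b lam eta xi n N) :
    2 * xi ^ 2 < 1 := by
  have h0 := h.xi_pos
  rw [← Real.log_neg_iff (by positivity), Real.log_mul two_ne_zero (by positivity), Real.log_pow]
  have := h.xi_lt
  push_cast
  linarith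

theorem IsAdmissible.isConformalDensity (h : IsAdmissible a b lam eta xi n N) :
    IsConformalDensity h.density where
  isDensity := h.isGaugeWeight.isDensity
  harnack := h.isGaugeWeight.harnack
  volume_growth := by
    obtain ⟨M, hM, hball⟩ := h.isGaugeWeight.lintegral_ball_code_le h.isCoding h.cantorCircle_eq
      (cantorLen_zero a b n N) h.a_pos (by linarith [h.a_lt_b, h.b_lt]) h.le_cantorLen_succ h.xi_pos
      h.two_mul_xi_sq_lt h.profile_cantorLen
    exact h.isGaugeWeight.volume_growth_of_ball hM hball

/-- The point of the `ρ`-boundary with address `w`. -/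
noncomputable def IsAdmissible.rhoCode (h : IsAdmissible a b lam eta xi n N) (w : ℕ → Bool) :
    RhoClosure h.density :=
  h.isGaugeWeight.lift (cantorPoint a b n N w)

theorem IsAdmissible.rhoEval_rhoCode (h : IsAdmissible a b lam eta xi n N) (w : ℕ → Bool) :
    rhoEval h.density (h.rhoCode w) = cantorCode a b n N w :=
  h.isGaugeWeight.rhoEval_lift _

theorem IsAdmissible.rhoTrace_cantorCircle (h : IsAdmissible a b lam eta xi n N) :
    rhoTrace h.density (cantorCircle a b n N) = range h.rhoCode := by
  ext p
  rw [h.isGaugeWeight.mem_rhoTrace_iff h.cantorCircle_subset, h.cantorCircle_eq]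
  constructor
  · rintro ⟨w, hw⟩
    exact ⟨w, h.isGaugeWeight.rhoEval_injective ((h.rhoEval_rhoCode w).trans hw)⟩
  · rintro ⟨w, rfl⟩
    exact ⟨w, (h.rhoEval_rhoCode w).symm⟩

theorem IsAdmissible.xi_lt_one (h : IsAdmissible a b lam eta xi n N) : xi < 1 :=
  (Real.log_neg_iff h.xi_pos).1 h.log_xi_neg

/-- On C the metric is comparable to D φ(D), where D is the chord, and t φ(t) is increasing. Chords
comparable to ℓ_k therefore give ρ-distances comparable to ℓ_k φ(ℓ_k) = ξ^k. -/
theorem IsAdmissible.isCoding_rho (h : IsAdmissible a b lam eta xi n N) :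
    IsCoding h.rhoCode (fun k => xi ^ k) (metricConst lam * (2 / (1 - 2 * b))) := by
  have hb : 0 < 1 - 2 * b := by linarith [h.b_lt]
  have hK : 1 ≤ 2 / (1 - 2 * b) := by
    rw [le_div_iff₀ hb]
    linarith [h.b_pos]
  have hB := h.profile_gauge.metricConst_pos
  set K := 2 / (1 - 2 * b)
  have hK0 : 0 < K := by linarith
  have hg := h.profile_gauge
  have hd0 : ∀ w, Metric.infDist (cantorCode a b n N w) (cantorCircle a b n N) = 0 := fun w =>
    Metric.infDist_zero_of_mem (by rw [h.cantorCircle_eq]; exact mem_range_self w)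
  have hbd : ∀ w v, cantorCode a b n N w ≠ cantorCode a b n N v → _ := fun w v hne =>
    h.isGaugeWeight.dist_bounds (p := h.rhoCode w) (q := h.rhoCode v)
      (by rwa [h.rhoEval_rhoCode, h.rhoEval_rhoCode])
  simp only [h.rhoEval_rhoCode, hd0] at hbd
  refine ⟨by positivity, fun k => pow_pos h.xi_pos k,
    pow_right_anti₀ h.xi_pos.le h.xi_lt_one.le,
    tendsto_pow_atTop_nhds_zero_of_lt_one h.xi_pos.le h.xi_lt_one, fun k w v hwv => ?_,
    fun k w v hwv hk => ?_⟩
  · have hl := h.cantorLen_pos k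
    have hx := pow_pos h.xi_pos k
    rcases eq_or_ne (cantorCode a b n N w) (cantorCode a b n N v) with heq | hne
    · rw [h.isGaugeWeight.rhoEval_injective
        ((h.rhoEval_rhoCode w).trans (heq.trans (h.rhoEval_rhoCode v).symm)), dist_self]
      positivity
    · have h1 := h.isCoding.upper k w v hwv
      have h2 := hg.mul_mono (dist_pos.2 hne) h1 le_rfl
      refine (hbd w v hne).2.trans ?_
      have h3 : profile a b lam eta n N (K * cantorLen a b n N k) ≤
          profile a b lam eta n N (cantorLen a b n N k) :=
        hg.anti _ _ hl (by nlinarith)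
      calc _ ≤ metricConst lam * (K * cantorLen a b n N k *
            profile a b lam eta n N (K * cantorLen a b n N k + 0)) := by gcongr
        _ ≤ metricConst lam * (K * cantorLen a b n N k *
            profile a b lam eta n N (cantorLen a b n N k)) := by rw [add_zero]; gcongr
        _ = metricConst lam * K * xi ^ k := by rw [← h.profile_cantorLen k]; ring
  · have hl := h.cantorLen_pos k
    have h1 := h.isCoding.lower k w v hwv hk
    have hne : cantorCode a b n N w ≠ cantorCode a b n N v := by
      intro heq
      rw [heq, dist_self, mul_zero] at h1
      linarith
    have h2 : cantorLen a b n N k / K ≤ dist (cantorCode a b n N w) (cantorCode a b n N v) := by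
      rw [div_le_iff₀ hK0, mul_comm]
      exact h1
    have hlK : 0 < cantorLen a b n N k / K := by positivity
    have h3 := (hg.mul_mono hlK h2 le_rfl).trans (hbd w v hne).1
    have h4 : profile a b lam eta n N (cantorLen a b n N k) ≤
        profile a b lam eta n N (cantorLen a b n N k / K) :=
      hg.anti _ _ hlK (div_le_self hl.le hK)
    rw [add_zero] at h3
    have h5 : xi ^ k ≤ K * dist (h.rhoCode w) (h.rhoCode v) := by
      rw [← h.profile_cantorLen k]
      calc cantorLen a b n N k * profile a b lam eta n N (cantorLen a b n N k)
          ≤ cantorLen a b n N k * profile a b lam eta n N (cantorLen a b n N k / K) := by gcongr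
        _ = K * (cantorLen a b n N k / K *
            profile a b lam eta n N (cantorLen a b n N k / K)) := by field_simp
        _ ≤ _ := by gcongr
    have h6 : 0 ≤ K * dist (h.rhoCode w) (h.rhoCode v) := by positivity
    nlinarith

/-- The dimension of the Cantor set with respect to `d_ρ`. -/
noncomputable def rhoDim (xi : ℝ) : ℝ≥0 := (-Real.log 2 / Real.log xi).toNNReal

theorem IsAdmissible.coe_rhoDim (h : IsAdmissible a b lam eta xi n N) :
    (rhoDim xi : ℝ) = -Real.log 2 / Real.log xi :=
  Real.coe_toNNReal _
    (div_pos_of_neg_of_neg (by linarith [Real.log_pos one_lt_two]) h.log_xi_neg).le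

theorem IsAdmissible.one_lt_rhoDim (h : IsAdmissible a b lam eta xi n N) : 1 < rhoDim xi := by
  rw [← NNReal.coe_lt_coe, h.coe_rhoDim, NNReal.coe_one, lt_div_iff_of_neg h.log_xi_neg, one_mul]
  exact h.xi_gt

theorem IsAdmissible.xi_pow_le (h : IsAdmissible a b lam eta xi n N) {t : ℝ≥0} (ht : rhoDim xi ≤ t)
    (k : ℕ) : (xi ^ k) ^ (t : ℝ) ≤ (1 / 2 : ℝ) ^ k := by
  have ht' : -Real.log 2 / Real.log xi ≤ t := by rw [← h.coe_rhoDim]; exact_mod_cast ht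
  rw [div_le_iff_of_neg h.log_xi_neg] at ht'
  rw [rpow_le_half_pow_iff (pow_pos h.xi_pos k), Real.log_pow]
  calc (t : ℝ) * (k * Real.log xi) = (t * Real.log xi) * k := by ring
    _ ≤ _ := by gcongr

theorem IsAdmissible.le_xi_pow (h : IsAdmissible a b lam eta xi n N) {t : ℝ≥0} (ht : t ≤ rhoDim xi)
    (k : ℕ) : (1 / 2 : ℝ) ^ k ≤ (xi ^ k) ^ (t : ℝ) := by
  have ht' : (t : ℝ) ≤ -Real.log 2 / Real.log xi := by rw [← h.coe_rhoDim]; exact_mod_cast ht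
  rw [le_div_iff_of_neg h.log_xi_neg] at ht'
  rw [half_pow_le_rpow_iff (pow_pos h.xi_pos k), Real.log_pow]
  calc -Real.log 2 * k ≤ (t * Real.log xi) * k := by gcongr
    _ = _ := by ring

/-! ### Dimensions with respect to d_ρ. -/

theorem IsAdmissible.dimH_rhoTrace (h : IsAdmissible a b lam eta xi n N) :
    dimH (rhoTrace h.density (cantorCircle a b n N)) = rhoDim xi := by
  rw [h.rhoTrace_cantorCircle]
  refine h.isCoding_rho.dimH_range (fun t ht => ?_) fun t ht => ⟨1, fun k => ?_⟩
  · exact (Eventually.of_forall fun k => h.xi_pow_le ht.le k).frequently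
  · rw [one_mul]
    exact h.le_xi_pow ht.le k

theorem IsAdmissible.packingDim_rhoTrace (h : IsAdmissible a b lam eta xi n N) :
    packingDim (rhoTrace h.density (cantorCircle a b n N)) = rhoDim xi := by
  rw [h.rhoTrace_cantorCircle]
  refine h.isCoding_rho.packingDim_range (fun t ht => ⟨1, fun k => ?_⟩) fun t ht => ?_
  · rw [one_mul]
    exact h.xi_pow_le ht.le k
  · exact (Eventually.of_forall fun k => h.le_xi_pow ht.le k).frequently

/-- The circle is C together with the sets at distance at least 1/(j+1) from C. The latter have
packing dimension at most 1, which is below that of C. -/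
theorem IsAdmissible.packingDim_rhoTrace_sphere (h : IsAdmissible a b lam eta xi n N) :
    packingDim (rhoTrace h.density (Metric.sphere 0 1)) = rhoDim xi := by
  have hρ := h.isGaugeWeight
  refine le_antisymm (packingDim_le_of_measure fun s hs => ?_) ?_
  · let A : ℕ → Set ℂ := fun j => {q | q ∈ Metric.sphere (0 : ℂ) 1 ∧
      1 / ((j : ℝ) + 1) ≤ Metric.infDist q (cantorCircle a b n N)}
    let F : ℕ → Set (RhoClosure h.density) := fun i =>
      Nat.casesOn i (rhoTrace h.density (cantorCircle a b n N)) fun j => rhoTrace h.density (A j)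
    rw [packingMeasure_eq_zero_of_cover (F := F)]
    · exact ENNReal.zero_ne_top
    · intro p hp
      rw [hρ.mem_rhoTrace_iff Subset.rfl] at hp
      by_cases hpC : rhoEval h.density p ∈ cantorCircle a b n N
      · exact mem_iUnion.2 ⟨0, (hρ.mem_rhoTrace_iff h.cantorCircle_subset).2 hpC⟩
      · obtain ⟨j, hj⟩ := exists_nat_one_div_lt
          ((hρ.closed.notMem_iff_infDist_pos hρ.nonempty).1 hpC)
        exact mem_iUnion.2 ⟨j + 1, (hρ.mem_rhoTrace_iff fun q hq => hq.1).2 ⟨hp, hj.le⟩⟩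
    · rintro (_ | j)
      · change packingPre s (rhoTrace h.density (cantorCircle a b n N)) = 0
        rw [h.rhoTrace_cantorCircle]
        exact h.isCoding_rho.packingPre_eq_zero hs (M := 1) fun k => by
          rw [one_mul]
          exact h.xi_pow_le le_rfl k
      · exact packingPre_eq_zero (h.one_lt_rhoDim.trans hs) one_pos
          (hρ.packingPreAt_off_ne_top (by positivity))
  · rw [← h.packingDim_rhoTrace]
    refine packingDim_mono fun p hp => ?_
    rw [hρ.mem_rhoTrace_iff h.cantorCircle_subset] at hp
    exact (hρ.mem_rhoTrace_iff Subset.rfl).2 (h.cantorCircle_subset hp)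

/-! ### Comparison of the ρ-dimension with the supremum over the exponents β. -/

theorem IsAdmissible.rhoDim_lt (h : IsAdmissible a b lam eta xi n N) :
    -Real.log 2 / ((1 + lam) * Real.log a) < -Real.log 2 / ((1 + lam) * Real.log b) := by
  have hl : 0 < 1 + lam := by linarith [h.lam_gt]
  have h1 : 0 < -((1 + lam) * Real.log b) := by nlinarith [h.log_b_neg]
  have h2 : -((1 + lam) * Real.log b) < -((1 + lam) * Real.log a) := by nlinarith [h.log_a_lt]
  rw [neg_div, neg_div, ← div_neg, ← div_neg]
  exact div_lt_div_of_pos_left (Real.log_pos one_lt_two) h1 h2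

theorem IsAdmissible.coe_rhoDim_eq_ofReal (h : IsAdmissible a b lam eta xi n N) :
    (rhoDim xi : ℝ≥0∞) = ENNReal.ofReal (-Real.log 2 / ((1 + lam) * Real.log a)) := by
  rw [← h.log_xi_eq]
  rfl

theorem IsAdmissible.packingDim_div (h : IsAdmissible a b lam eta xi n N) :
    ENNReal.ofReal (-Real.log 2 / ((1 + lam) * Real.log b)) =
      packingDim (cantorCircle a b n N) / ENNReal.ofReal (1 + lam) := by
  rw [h.packingDim_cantorCircle, ← ENNReal.ofReal_div_of_pos (by linarith [h.lam_gt]), div_div,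
    mul_comm (Real.log b)]

theorem IsAdmissible.rhoDim_lt_div (h : IsAdmissible a b lam eta xi n N) :
    (rhoDim xi : ℝ≥0∞) < packingDim (cantorCircle a b n N) / ENNReal.ofReal (1 + lam) := by
  rw [← h.packingDim_div, h.coe_rhoDim_eq_ofReal, ENNReal.ofReal_lt_ofReal_iff_of_nonneg]
  · exact h.rhoDim_lt
  · rw [← h.log_xi_eq, ← h.coe_rhoDim]
    exact NNReal.coe_nonneg _

/-- The supremum is attained at β = λ. The sublevel set is empty for β < λ and lies in C for λ ≤ β <
0, where the denominator only grows; for β ≥ 0 the quotient is at most 1, which is less than Dim_ρ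
C. -/
theorem IsAdmissible.packingSpectrumSup_eq (h : IsAdmissible a b lam eta xi n N) :
    packingDim (cantorCircle a b n N) / ENNReal.ofReal (1 + lam) =
      packingSpectrumSup h.density := by
  have hρ := h.isGaugeWeight
  have hl := h.lam_gt
  have hl0 := h.profile_gauge.lam_neg
  refine le_antisymm ?_ (iSup₂_le fun β hβ => ?_)
  · refine le_iSup₂_of_le lam h.lam_gt (ENNReal.div_le_div_right (packingDim_mono fun x hx => ?_) _)
    obtain ⟨p, hp, -⟩ := hρ.existsUnique_corresponds (h.cantorCircle_subset hx)
    exact ⟨h.cantorCircle_subset hx, ⟨p, hp⟩, (h.kMinus_eq_lam hρ hx).le⟩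
  · rcases lt_or_ge β 0 with hβ0 | hβ0
    · have hsub : kMinusSublevel h.density β ⊆ cantorCircle a b n N := by
        rintro x ⟨hx, -, hk⟩
        by_contra hxC
        rw [hρ.kMinus_eq_zero ⟨hx, hxC⟩] at hk
        exact absurd (EReal.coe_le_coe_iff.1 hk) (not_le.2 hβ0)
      rcases lt_or_ge β lam with hβl | hβl
      · have hempty : kMinusSublevel h.density β = ∅ := by
          refine eq_empty_of_forall_notMem fun x hx => ?_
          have hk := hx.2.2
          rw [h.kMinus_eq_lam hρ (hsub hx)] at hk
          exact absurd (EReal.coe_le_coe_iff.1 hk) (not_le.2 hβl)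
        rw [hempty, packingDim_empty, ENNReal.zero_div]
        exact bot_le
      · exact ENNReal.div_le_div (packingDim_mono hsub)
          (ENNReal.ofReal_le_ofReal (by linarith))
    · have h1 : packingDim (kMinusSublevel h.density β) ≤ 1 :=
        (packingDim_mono fun x hx => hx.1).trans packingDim_sphere_le
      calc packingDim (kMinusSublevel h.density β) / ENNReal.ofReal (1 + β)
          ≤ 1 / 1 := by
            refine ENNReal.div_le_div h1 ?_
            rw [← ENNReal.ofReal_one]
            exact ENNReal.ofReal_le_ofReal (by linarith)
        _ = 1 := by simp
        _ ≤ rhoDim xi := by exact_mod_cast h.one_lt_rhoDim.le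
        _ ≤ _ := h.rhoDim_lt_div.le

end Cantor

/-! ### Existence of admissible data -/

theorem exists_isAdmissible :
    ∃ (a b lam eta xi : ℝ) (n N : ℕ → ℕ), IsAdmissible a b lam eta xi n N := by
  have hfac : ∀ m : ℕ, (m + 1) * (m.factorial - 1) ≤ (m + 1).factorial - 1 := by
    intro m
    rw [Nat.factorial_succ, Nat.mul_sub, mul_one]
    omega
  have hlim : ∀ u : ℕ → ℕ, (∀ i, i ≤ u i) → (∀ i, 1 ≤ i → 2 ≤ u i) →
      Tendsto (fun i => (((u i + 1).factorial - 1 : ℕ) : ℝ) / ((u i).factorial - 1 : ℕ))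
        atTop atTop := by
    intro u hu hu2
    refine tendsto_atTop_mono' atTop ?_ (tendsto_natCast_atTop_atTop (R := ℝ))
    filter_upwards [eventually_ge_atTop 1] with i hi
    have h1 : 0 < (u i).factorial - 1 := by
      have := Nat.self_le_factorial (u i)
      have := hu2 i hi
      omega
    rw [le_div_iff₀ (by exact_mod_cast h1)]
    have h2 : i * ((u i).factorial - 1) ≤ (u i + 1).factorial - 1 :=
      (Nat.mul_le_mul_right _ ((hu i).trans (Nat.le_succ _))).trans (hfac _)
    exact_mod_cast h2
  have h2 : (0 : ℝ) < 2 := two_pos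
  have hlog := Real.log_pos one_lt_two
  -- Here log ξ = −(3/4) log 2 is the midpoint of the allowed interval. Consecutive factorials have
  -- unbounded quotients, and subtracting 1 gives n_0 = N_0 = 0 because 0! = 1! = 1.
  refine ⟨2 ^ (-3 : ℝ), 2 ^ (-3 / 2 : ℝ), -3 / 4, -1 / 2, 2 ^ (-3 / 4 : ℝ),
    fun i => (2 * i).factorial - 1, fun i => (2 * i + 1).factorial - 1, ?_⟩
  have hlt : ∀ m : ℕ, 0 < m → m.factorial - 1 < (m + 1).factorial - 1 := by
    intro m hm
    have h3 := (Nat.factorial_lt hm).2 (Nat.lt_succ_self m)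
    have h4 := Nat.factorial_pos m
    simp only [Nat.succ_eq_add_one] at h3
    omega
  exact
    { a_pos := by positivity
      a_lt_b := Real.rpow_lt_rpow_of_exponent_lt one_lt_two (by norm_num)
      b_lt := by
        have : (1 / 2 : ℝ) = 2 ^ (-1 : ℝ) := by rw [Real.rpow_neg_one]; norm_num
        rw [this]
        exact Real.rpow_lt_rpow_of_exponent_lt one_lt_two (by norm_num)
      lam_gt := by norm_num
      lam_lt_eta := by norm_num
      eta_neg := by norm_num
      a_rpow := by rw [← Real.rpow_mul h2.le]; norm_num
      b_rpow := by rw [← Real.rpow_mul h2.le]; norm_num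
      xi_gt := by rw [Real.log_rpow h2]; linarith
      xi_lt := by rw [Real.log_rpow h2]; linarith
      n_zero := rfl
      N_zero := rfl
      N_lt_n := fun i => hlt (2 * i + 1) (by omega)
      n_lt_N := fun i => hlt (2 * (i + 1)) (by omega)
      N_div_n := hlim (fun i => 2 * i) (fun i => by omega) fun i hi => by omega
      n_div_N := hlim (fun i => 2 * i + 1) (fun i => by omega) fun i hi => by omega }

theorem mainTheorem7 :
    (∃ (a b lam eta xi : ℝ) (n N : ℕ → ℕ), IsAdmissible a b lam eta xi n N) ∧
    (∀ (a b lam eta xi : ℝ) (n N : ℕ → ℕ), IsAdmissible a b lam eta xi n N →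
      ∃ (φ : ℝ → ℝ) (ρ : DiscWeight),
        IsProfile a b lam eta n N φ ∧
        (∀ z ∈ Metric.ball (0 : ℂ) 1, ρ z = φ (Metric.infDist z (cantorCircle a b n N))) ∧
        IsConformalDensity ρ ∧
        -- the `ρ`-boundary is identified with the unit circle
        (∀ q ∈ Metric.sphere (0 : ℂ) 1, ∃! p, p ∈ rhoBoundary ρ ∧ Corresponds ρ p q) ∧
        rhoTrace ρ (Metric.sphere 0 1) = rhoBoundary ρ ∧
        -- the limits `k⁻` and the Euclidean dimensions of the Cantor set
        (∀ x ∈ cantorCircle a b n N, kMinus ρ x = (lam : EReal)) ∧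
        (∀ x ∈ Metric.sphere (0 : ℂ) 1 \ cantorCircle a b n N, kMinus ρ x = 0) ∧
        dimH (cantorCircle a b n N) = ENNReal.ofReal (-Real.log 2 / Real.log a) ∧
        packingDim (cantorCircle a b n N) = ENNReal.ofReal (-Real.log 2 / Real.log b) ∧
        -- dimensions with respect to `d_ρ`
        dimH (rhoTrace ρ (cantorCircle a b n N)) =
          ENNReal.ofReal (-Real.log 2 / ((1 + lam) * Real.log a)) ∧
        1 < packingDim (rhoTrace ρ (cantorCircle a b n N)) ∧
        packingDim (rhoTrace ρ (cantorCircle a b n N)) =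
          packingDim (rhoTrace ρ (Metric.sphere 0 1)) ∧
        packingDim (rhoTrace ρ (Metric.sphere 0 1)) =
          ENNReal.ofReal (-Real.log 2 / ((1 + lam) * Real.log a)) ∧
        ENNReal.ofReal (-Real.log 2 / ((1 + lam) * Real.log a)) <
          ENNReal.ofReal (-Real.log 2 / ((1 + lam) * Real.log b)) ∧
        ENNReal.ofReal (-Real.log 2 / ((1 + lam) * Real.log b)) =
          packingDim (cantorCircle a b n N) / ENNReal.ofReal (1 + lam) ∧
        packingDim (cantorCircle a b n N) / ENNReal.ofReal (1 + lam) = packingSpectrumSup ρ) ∧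
    -- the lower bound with the packing dimension in place of the Hausdorff dimension fails
    ¬ ∀ ρ : DiscWeight, IsConformalDensity ρ → packingSpectrumSup ρ ≤ packingDim (rhoBoundary ρ) := by

  refine ⟨exists_isAdmissible, fun a b lam eta xi n N h => ?_, fun hall => ?_⟩
  · have hρ := h.isGaugeWeight
    refine ⟨profile a b lam eta n N, h.density, h.isProfile, fun z _ => rfl, h.isConformalDensity,
      fun q hq => hρ.existsUnique_corresponds hq, hρ.rhoTrace_sphere,
      fun x hx => h.kMinus_eq_lam hρ hx, fun x hx => hρ.kMinus_eq_zero hx, h.dimH_cantorCircle,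
      h.packingDim_cantorCircle, h.dimH_rhoTrace.trans h.coe_rhoDim_eq_ofReal, ?_,
      h.packingDim_rhoTrace.trans h.packingDim_rhoTrace_sphere.symm,
      h.packingDim_rhoTrace_sphere.trans h.coe_rhoDim_eq_ofReal, ?_, h.packingDim_div,
      h.packingSpectrumSup_eq⟩
    · rw [h.packingDim_rhoTrace]
      exact_mod_cast h.one_lt_rhoDim
    · rw [← h.coe_rhoDim_eq_ofReal, h.packingDim_div]
      exact h.rhoDim_lt_div
  · obtain ⟨a, b, lam, eta, xi, n, N, h⟩ := exists_isAdmissible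
    have h1 := hall h.density h.isConformalDensity
    rw [← h.packingSpectrumSup_eq, ← h.isGaugeWeight.rhoTrace_sphere,
      h.packingDim_rhoTrace_sphere] at h1
    exact absurd h.rhoDim_lt_div (not_lt.2 h1)
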